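/- **Setting.** Let $G_0$ be a real Lie group whose Lie algebra $\mathfrak g_0$ is a real form of a finite-dimensional simple complex Lie algebra $\mathfrak g=\mathbb C\otimes\mathfrak g_0$, and let $\kappa$ be the opposite of the Killing form. Let $\mathbb D=\mathbb R$ or $\mathbb R/2\pi\mathbb Z$ and $N\in\mathbb N$. Let $z_1,\dots,z_N\in\mathbb R$ be distinct, $\ell_r\in\mathbb R\setminus\{0\}$, $k_r\in\mathbb R$, $\ell^\infty\in\mathbb R\setminus\{0\}$, and assume that the twist function $$\varphi(z)=\sum_{r=1}^N\Big(\frac{\ell_r}{(z-z_r)^2}-\frac{2k_r}{z-z_r}\Big)-\ell^\infty$$ has $2N$ distinct zeros $\zeta_1,\dots,\zeta_{2N}\in\mathbb C$. Let $\epsilon_i=\pm1$ with $\epsilon_i=\epsilon_{i'}$ if $\zeta_{i'}=\overline{\zeta_i}$ (reality of the Hamiltonian; automatic for real zeros), $I_\pm=\{i:\epsilon_i=\pm1\}$, and assume $|I_+|=|I_-|=N$. **Hamiltonian model.** For each $r$ choose local coordinates $\phi^i$ on $G_0$ and, on this patch, a two-form with components $\lambda_{ij}$ such that $\partial_i\lambda_{jk}+\partial_j\lambda_{ki}+\partial_k\lambda_{ij}=\kappa(g^{-1}\partial_ig,[g^{-1}\partial_jg,g^{-1}\partial_kg])$.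 The canonical fields are $N$ fields $g^{(r)}$ in these patches with conjugate momenta $\pi^{(r)}_i$. With $g^{-1}\partial_ig=L^a{}_iI_a$, $(I^a)$ the $\kappa$-dual basis of a basis $(I_a)$ of $\mathfrak g_0$ and $(L^i{}_a)$ the inverse of $(L^a{}_i)$, put (for each copy $r$) $j=g^{-1}\partial_xg$, $X=L^i{}_a\pi_iI^a$, $W=\lambda_{ij}\,\partial_x\phi^i\,L^j{}_aI^a$, and $$\Gamma(z)=\sum_{r=1}^N\Big(\frac{\ell_r\,j^{(r)}}{(z-z_r)^2}+\frac{X^{(r)}-k_rj^{(r)}-k_rW^{(r)}}{z-z_r}\Big),\qquad \mathcal H=\sum_{i=1}^{2N}\epsilon_i\,\mathop{\mathrm{res}}_{z=\zeta_i}\Big(-\frac1{2\varphi(z)}\int_{\mathbb D}\kappa(\Gamma(z),\Gamma(z))\,dx\Big)dz.$$ Time evolution is $\partial_t=\{\mathcal H,\cdot\}$ with $\{\pi_i(x),\phi^j(y)\}=\delta_i^j\delta(x-y)$. Put $\mathcal L=\Gamma/\varphi$, $\mathcal M(z)=\sum_i\frac{\epsilon_i}{\varphi'(\zeta_i)}\frac{\Gamma(\zeta_i)}{z-\zeta_i}$,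 $\mathcal L_\pm=\mathcal M\pm\mathcal L$, $\partial_\pm=\partial_t\pm\partial_x$, $j^{(r)}_\pm=(g^{(r)})^{-1}\partial_\pm g^{(r)}$. **Coefficients.** Let $\varphi_\pm^{(r)}(z)=\prod_{i\in I_\pm}(z-\zeta_i)\big/\prod_{s\ne r}(z-z_s)$ and $$\rho_{rr}=\tfrac{\ell^\infty}4\big(\varphi_+^{(r)\prime}(z_r)\varphi_-^{(r)}(z_r)-\varphi_+^{(r)}(z_r)\varphi_-^{(r)\prime}(z_r)\big),\qquad \rho_{rs}=\tfrac{\ell^\infty}2\,\frac{\varphi_+^{(r)}(z_r)\,\varphi_-^{(s)}(z_s)}{z_r-z_s}\quad(r\neq s).$$ **Claims.** 1. $\ell_r=-\ell^\infty\varphi_+^{(r)}(z_r)\varphi_-^{(r)}(z_r)$, $\;k_r=\frac{\ell^\infty}2\big(\varphi_+^{(r)}(z_r)\varphi_-^{(r)\prime}(z_r)+\varphi_+^{(r)\prime}(z_r)\varphi_-^{(r)}(z_r)\big)$, and all $\rho_{rs}$ are real. 2. The inverse Legendre transform exists: for given $\phi^{(r)},\partial_x\phi^{(r)},\partial_t\phi^{(r)}$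 the relations $\partial_t\phi^{(r)}=\{\mathcal H,\phi^{(r)}\}$ determine the momenta $\pi^{(r)}$ uniquely, and then the Lagrangian density $\sum_r\pi^{(r)}_i\partial_t\phi^{(r)i}-h$, with $h$ the density of $\mathcal H$, equals $\sum_{r,s}\rho_{rs}\,\kappa(j^{(r)}_+,j^{(s)}_-)+\sum_rk_r\,\lambda_{ij}\,\partial_x\phi^{(r)i}\partial_t\phi^{(r)j}$. 3. Let $g^{(r)}(t,x)$ be smooth fields in the patches, with momenta as in 2, such that $\kappa(j^{(r)}_a,j^{(s)}_b)$ ($a,b=\pm$) and $\lambda_{ij}\,\partial_x\phi^{(r)i}\,\partial_t\phi^{(r)j}$ are integrable on $\mathbb R\times\mathbb D$. Then the action $S=\iint dt\,dx\sum_r\pi^{(r)}_i\partial_t\phi^{(r)i}-\int dt\,\mathcal H$ is $$S[g^{(1)},\dots,g^{(N)}]=\iint_{\mathbb R\times\mathbb D}dt\,dx\sum_{r,s=1}^N\rho_{rs}\,\kappa\big(j_+^{(r)},j_-^{(s)}\big)+\sum_{r=1}^Nk_r\,I_{\mathrm{WZ}}[g^{(r)}],$$ where $I_{\mathrm{WZ}}[g]=\iiint_{\mathbb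 B}dt\,dx\,d\xi\;\kappa(g^{-1}\partial_\xi g,[g^{-1}\partial_xg,g^{-1}\partial_tg])$ is computed with any smooth extension of $g$, inside the patch, to $\mathbb B=[0,1]_\xi\times\mathbb R\times\mathbb D$, equal to $g$ at $\xi=1$ and independent of $x$ at $\xi=0$, for which this integrand and the functions $\lambda_{ij}\,\partial_\xi\phi^i\,\partial_t\phi^j$ and $\lambda_{ij}\,\partial_\xi\phi^i\,\partial_x\phi^j$ are integrable on $\mathbb B$. 4. For all smooth fields with momenta as in 2, and all $z\in\mathbb C\setminus\{z_r,\zeta_i\}$, $$\mathcal L_\pm(z)=\sum_{r=1}^N\frac{\varphi_\pm^{(r)}(z_r)}{\varphi_\pm^{(r)}(z)}\,j_\pm^{(r)},$$ and $(\mathcal L_+,\mathcal L_-)$ is a Lax pair of the model: the remaining equations of motion $\partial_t\pi^{(r)}=\{\mathcal H,\pi^{(r)}\}$ hold if and only if $\partial_+\mathcal L_-(z)-\partial_-\mathcal L_+(z)+[\mathcal L_+(z),\mathcal L_-(z)]=0$ for all such $z$. -/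

import Mathlib

open scoped Manifold ContDiff TensorProduct Topology
open MeasureTheory

namespace CoupledPCM

/-! ### The Lie algebra `𝔤₀` of `G₀`, its complexification `𝔤`, and the form `κ` -/

section Algebra

variable (E G : Type*) [NormedAddCommGroup E] [NormedSpace ℝ E] [FiniteDimensional ℝ E]
  [TopologicalSpace G] [ChartedSpace E G] [Group G]

/-- The real Lie algebra `𝔤₀` of the Lie group `G₀ = G`. -/
abbrev RealAlg : Type _ := GroupLieAlgebra 𝓘(ℝ, E) G

instance instLieGroupThree [LieGroup 𝓘(ℝ, E) ∞ G] :
    LieGroup 𝓘(ℝ, E) (minSmoothness ℝ 3) G :=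
  LieGroup.of_le (n := ∞) (by
    rw [minSmoothness_of_isRCLikeNormedField]; exact ENat.LEInfty.out)

instance instFiniteRealAlg : Module.Finite ℝ (RealAlg E G) :=
  inferInstanceAs (FiniteDimensional ℝ E)

variable [LieGroup 𝓘(ℝ, E) ∞ G]

/-- The complex Lie algebra `𝔤 = ℂ ⊗ 𝔤₀`, of which `𝔤₀` is a real form. -/
abbrev CplxAlg : Type _ := ℂ ⊗[ℝ] RealAlg E G

/-- `κ` on `𝔤₀`: the opposite of the Killing form. -/
noncomputable def kappa : LinearMap.BilinForm ℝ (RealAlg E G) := -killingForm ℝ (RealAlg E G)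

/-- `κ` on `𝔤`: the opposite of the Killing form. -/
noncomputable def kappaC : LinearMap.BilinForm ℂ (CplxAlg E G) := -killingForm ℂ (CplxAlg E G)

/-- The form `κ` of `𝔤₀` is the restriction of the one of `𝔤`. -/
theorem kappaC_tmul (a b : ℂ) (x y : RealAlg E G) :
    kappaC E G (a ⊗ₜ x) (b ⊗ₜ y) = a * b * (kappa E G x y : ℂ) := by
  have h : killingForm ℂ (CplxAlg E G) = (killingForm ℝ (RealAlg E G)).baseChange ℂ :=
    LieModule.traceForm_baseChange (R := ℝ) (L := RealAlg E G) (M := RealAlg E G) ℂ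
  simp [kappaC, kappa, h, mul_comm]

theorem kappa_nondegenerate [LieAlgebra.IsSimple ℂ (CplxAlg E G)] :
    (kappa E G).Nondegenerate := by
  have hC : (killingForm ℂ (CplxAlg E G)).Nondegenerate :=
    LieAlgebra.IsKilling.killingForm_nondegenerate ℂ (CplxAlg E G)
  have hsym : (kappa E G).IsRefl := by
    intro x y h
    have := LieModule.traceForm_comm ℝ (RealAlg E G) (RealAlg E G) x y
    simp only [kappa, LinearMap.neg_apply, neg_eq_zero] at h ⊢
    rw [← this]; exact h
  refine hsym.nondegenerate_iff_separatingLeft.mpr fun x hx => ?_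
  have h1 : ∀ w, kappaC E G ((1 : ℂ) ⊗ₜ x) w = 0 := by
    intro w
    induction w using TensorProduct.induction_on with
    | zero => simp
    | tmul b y => rw [kappaC_tmul, hx y]; simp
    | add u v hu hv => rw [map_add, hu, hv, add_zero]
  have h2 : ((1 : ℂ) ⊗ₜ[ℝ] x : CplxAlg E G) = 0 :=
    hC.1 _ fun w => by simpa [kappaC] using h1 w
  exact (Module.FaithfullyFlat.one_tmul_eq_zero_iff (R := ℝ) (M := RealAlg E G) (A := ℂ) x).mp h2

end Algebra

/-! ### The coordinate patch, the left-invariant form and the two-form `Λ` -/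

section Patch

variable {E G : Type*} [NormedAddCommGroup E] [NormedSpace ℝ E] [FiniteDimensional ℝ E]
  [TopologicalSpace G] [ChartedSpace E G] [Group G]

/-- In the coordinates `c`, the left-invariant form `u ↦ g⁻¹ ∂_u g` at the point `g` of
coordinates `q`, with values in `𝔤₀`. In a basis `I_a` it reads `u ↦ L^a_i u^i I_a`. -/
noncomputable def leftForm (c : OpenPartialHomeomorph G E) (q : E) : E →L[ℝ] RealAlg E G :=
  mfderiv 𝓘(ℝ, E) 𝓘(ℝ, E) (fun q' : E => (c.symm q)⁻¹ * c.symm q') q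

variable [LieGroup 𝓘(ℝ, E) ∞ G]

/-- Local coordinates `c` on `G₀`, with a two-form `Λ = lam` on the coordinate patch such that
`dΛ = Ω`, the canonical three-form `κ(g⁻¹∂_u g, [g⁻¹∂_v g, g⁻¹∂_w g])`; in components
`ω_{ijk} = ∂_i λ_{jk} + ∂_j λ_{ki} + ∂_k λ_{ij}`. -/
structure Patch (E G : Type*) [NormedAddCommGroup E] [NormedSpace ℝ E] [FiniteDimensional ℝ E]
    [TopologicalSpace G] [ChartedSpace E G] [Group G] [LieGroup 𝓘(ℝ, E) ∞ G] where
  c : OpenPartialHomeomorph G E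
  mem_atlas : c ∈ IsManifold.maximalAtlas 𝓘(ℝ, E) ∞ G
  lam : E → E [⋀^Fin 2]→L[ℝ] ℝ
  smooth_lam : ContDiffOn ℝ ∞ lam c.target
  extDeriv_lam : ∀ q ∈ c.target, ∀ u v w : E,
    extDeriv lam q ![u, v, w] =
      kappa E G (leftForm c q u) ⁅leftForm c q v, leftForm c q w⁆

/-- The `𝔤₀`-valued quantity `y = L^i_a α_i I^a` attached to a covector `α` at the point of
coordinates `q`; it is characterised by `κ(y, g⁻¹ ∂_u g) = α(u)`. -/
noncomputable def Patch.toAlg [LieAlgebra.IsSimple ℂ (CplxAlg E G)] (P : Patch E G) (q : E)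
    (α : E →L[ℝ] ℝ) : RealAlg E G :=
  ((kappa E G).toDual (kappa_nondegenerate E G)).symm
    (α.toLinearMap ∘ₗ (leftForm P.c q).inverse.toLinearMap)

/-- The covector `λ_{ij} u^i dφ^j`. -/
noncomputable def Patch.lamLeft (P : Patch E G) (q u : E) : E →L[ℝ] ℝ :=
  have h : ∀ v : E, ![u, v] = Function.update ![u, 0] 1 v := fun v => by
    ext i; fin_cases i <;> simp
  LinearMap.toContinuousLinearMap
    { toFun := fun v => P.lam q ![u, v]
      map_add' := fun v w => by rw [h, h v, h w, (P.lam q).map_update_add]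
      map_smul' := fun a v => by rw [h, h v, (P.lam q).map_update_smul]; rfl }

/-- The defining property of `toAlg` where `leftForm` is invertible, as it is on the patch. -/
theorem Patch.kappa_toAlg [LieAlgebra.IsSimple ℂ (CplxAlg E G)] (P : Patch E G) (q : E)
    (α : E →L[ℝ] ℝ) (h : (leftForm P.c q).IsInvertible) (u : E) :
    kappa E G (P.toAlg q α) (leftForm P.c q u) = α u := by
  rw [← LinearMap.BilinForm.toDual_def (kappa_nondegenerate E G), Patch.toAlg,
    LinearEquiv.apply_symm_apply]
  exact congrArg α (h.inverse_apply_eq.mpr rfl)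

end Patch

/-! ### Parameters of the model, twist function and its zeros -/

/-- Parameters of a local affine Gaudin model with `N` real sites of multiplicity two:
positions `z_r`, levels `ℓ_{r,1} = ℓ_r` and `ℓ_{r,0} = -2 k_r`, constant term `ℓ^∞`, a labelling
`ζ_i` of the `M = 2N` zeros of the twist function, and signs `ε_i = ±1`. -/
structure Params (N : ℕ) where
  z : Fin N → ℝ
  ell : Fin N → ℝ
  k : Fin N → ℝ
  ellInf : ℝ
  zeta : Fin (2 * N) → ℂ
  eps : Fin (2 * N) → ℤˣ

namespace Params

variable {N : ℕ} (A : Params N)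

/-- The twist function `φ(w) = ∑_r (ℓ_r/(w-z_r)² - 2k_r/(w-z_r)) - ℓ^∞`. -/
noncomputable def twist (w : ℂ) : ℂ :=
  ∑ r, ((A.ell r : ℂ) / (w - A.z r) ^ 2 - 2 * (A.k r : ℂ) / (w - A.z r)) - A.ellInf

/-- The index set `I_+` (for `s = 1`) or `I_-` (for `s = -1`). -/
def idx (s : ℤˣ) : Finset (Fin (2 * N)) := Finset.univ.filter fun i => A.eps i = s

/-- `w` is neither a position of a site nor a zero of the twist function. -/
def Regular (w : ℂ) : Prop := (∀ r, w ≠ A.z r) ∧ ∀ i, w ≠ A.zeta i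

/-- Standing assumptions: distinct positions, non-zero highest levels, `ℓ^∞ ≠ 0`; the `ζ_i` are
`2N` distinct zeros of the twist function (so all of them, and simple); `|I_+| = |I_-| = N`;
complex conjugate zeros carry the same sign, i.e. the Hamiltonian is real. -/
structure Admissible : Prop where
  z_injective : Function.Injective A.z
  ell_ne_zero : ∀ r, A.ell r ≠ 0
  ellInf_ne_zero : A.ellInf ≠ 0
  zeta_injective : Function.Injective A.zeta
  zeta_ne_z : ∀ i r, A.zeta i ≠ A.z r
  twist_zeta : ∀ i, A.twist (A.zeta i) = 0
  card_plus : (A.idx 1).card = N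
  card_minus : (A.idx (-1)).card = N
  eps_conj : ∀ i, ∃ i', A.zeta i' = starRingEnd ℂ (A.zeta i) ∧ A.eps i' = A.eps i

/-- `φ_±^{(r)}(w) = ∏_{i ∈ I_±} (w - ζ_i) / ∏_{s ≠ r} (w - z_s)`, with `s = ±1` for the sign. -/
noncomputable def phi (s : ℤˣ) (r : Fin N) (w : ℂ) : ℂ :=
  (∏ i ∈ A.idx s, (w - A.zeta i)) / ∏ t ∈ Finset.univ.erase r, (w - (A.z t : ℂ))

/-- The levels `ℓ_r` in terms of positions and zeros. -/
noncomputable def ellOfZeros (r : Fin N) : ℂ :=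
  -A.ellInf * A.phi 1 r (A.z r) * A.phi (-1) r (A.z r)

/-- The Wess-Zumino levels `k_r` in terms of positions and zeros. -/
noncomputable def kOfZeros (r : Fin N) : ℂ :=
  A.ellInf / 2 * (A.phi 1 r (A.z r) * deriv (A.phi (-1) r) (A.z r)
    + deriv (A.phi 1 r) (A.z r) * A.phi (-1) r (A.z r))

/-- The couplings `ρ_{rs}` in terms of positions and zeros. -/
noncomputable def rho (r s : Fin N) : ℂ :=
  if r = s then
    A.ellInf / 4 * (deriv (A.phi 1 r) (A.z r) * A.phi (-1) r (A.z r)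
      - A.phi 1 r (A.z r) * deriv (A.phi (-1) r) (A.z r))
  else
    A.ellInf / 2 * (A.phi 1 r (A.z r) * A.phi (-1) s (A.z s)) / ((A.z r : ℂ) - A.z s)

end Params

/-! ### Hamiltonian formulation

At a point of space, the canonical fields are the coordinates `q r` of `g^{(r)}`, with their space
derivatives `q' r`, and the conjugate momenta `p r` (covectors). -/

section Hamiltonian

variable {E G : Type*} [NormedAddCommGroup E] [NormedSpace ℝ E] [FiniteDimensional ℝ E]
  [TopologicalSpace G] [ChartedSpace E G] [Group G] [LieGroup 𝓘(ℝ, E) ∞ G]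
  [LieAlgebra.IsSimple ℂ (CplxAlg E G)]
  {N : ℕ} (A : Params N) (P : Fin N → Patch E G)
  (q q' : Fin N → E) (p : Fin N → (E →L[ℝ] ℝ))

/-- The current `J^{(r)}_{[1]} = ℓ_r j^{(r)}`, where `j = g⁻¹ ∂_x g`. -/
noncomputable def takiffOne (r : Fin N) : RealAlg E G :=
  A.ell r • leftForm (P r).c (q r) (q' r)

/-- The current `J^{(r)}_{[0]} = X^{(r)} - k_r j^{(r)} - k_r W^{(r)}`, where
`X = L^i_a π_i I^a`, `j = g⁻¹ ∂_x g` and `W = λ_{ij} ∂_xφ^i L^j_a I^a`. -/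
noncomputable def takiffZero (r : Fin N) : RealAlg E G :=
  (P r).toAlg (q r) (p r) - A.k r • leftForm (P r).c (q r) (q' r)
    - A.k r • (P r).toAlg (q r) ((P r).lamLeft (q r) (q' r))

/-- The Gaudin Lax matrix `Γ(w)`. -/
noncomputable def gaudin (w : ℂ) : CplxAlg E G :=
  ∑ r, ((1 / (w - A.z r) ^ 2) ⊗ₜ[ℝ] takiffOne A P q q' r
    + (1 / (w - A.z r)) ⊗ₜ[ℝ] takiffZero A P q q' p r)

/-- The density of `𝒬(w) = -(1/2φ(w)) ∫ κ(Γ(w), Γ(w))`. -/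
noncomputable def quadDensity (w : ℂ) : ℂ :=
  -(1 / (2 * A.twist w)) * kappaC E G (gaudin A P q q' p w) (gaudin A P q q' p w)

/-- The residue of a function with at most a simple pole at `a`. -/
noncomputable def simpleResidue (f : ℂ → ℂ) (a : ℂ) : ℂ :=
  Filter.limUnder (𝓝[≠] a) fun w => (w - a) * f w

/-- The density of the Hamiltonian `ℋ = ∑_i ε_i 𝒬_i`, with `𝒬_i` the residue of `𝒬` at `ζ_i`. -/
noncomputable def ham : ℂ :=
  ∑ i, (((A.eps i : ℤ) : ℝ) : ℂ) * simpleResidue (quadDensity A P q q' p) (A.zeta i)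

/-- The Lax matrix `ℒ(w) = Γ(w)/φ(w)`. -/
noncomputable def laxL (w : ℂ) : CplxAlg E G := (A.twist w)⁻¹ • gaudin A P q q' p w

/-- The temporal component `ℳ(w) = ∑_i (ε_i/φ'(ζ_i)) Γ(ζ_i)/(w - ζ_i)` of the Lax pair. -/
noncomputable def laxM (w : ℂ) : CplxAlg E G :=
  ∑ i, ((((A.eps i : ℤ) : ℝ) : ℂ) / (deriv A.twist (A.zeta i) * (w - A.zeta i))) •
    gaudin A P q q' p (A.zeta i)

/-- The light-cone components `ℒ_± = ℳ ± ℒ` of the Lax pair, with `s = ±1` for the sign. -/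
noncomputable def laxPM (s : ℤˣ) (w : ℂ) : CplxAlg E G :=
  laxM A P q q' p w + (((s : ℤ) : ℝ) : ℂ) • laxL A P q q' p w

/-- First half of Hamilton's equations, `v = {ℋ, q} = ∂ℋ/∂p`, for the velocities `v`. -/
def VelocityEq (v : Fin N → E) : Prop :=
  ∀ δ : Fin N → (E →L[ℝ] ℝ),
    HasLineDerivAt ℝ (fun p' => ham A P q q' p') ((∑ r, δ r (v r) : ℝ) : ℂ) p δ

/-- The light-cone current `j_±^{(r)} = g⁻¹ ∂_t g ± g⁻¹ ∂_x g`, with velocity `v`. -/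
noncomputable def lightCurrent (v : Fin N → E) (s : ℤˣ) (r : Fin N) : RealAlg E G :=
  leftForm (P r).c (q r) (v r) + ((s : ℤ) : ℝ) • leftForm (P r).c (q r) (q' r)

end Hamiltonian

/-! ### Fields on space-time

A point of space-time is `(t, x)`. Space is the real line or the circle `ℝ/2πℤ`. -/

/-- The two choices of the space `𝔻`. -/
inductive Space
  | line
  | circle

/-- A fundamental domain of `𝔻` in the coordinate `x`. -/
def Space.dom : Space → Set ℝ
  | .line => Set.univ
  | .circle => Set.Ioc 0 (2 * Real.pi)

/-- Space-time `ℝ × 𝔻`. -/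
def Space.world (D : Space) : Set (ℝ × ℝ) := Set.univ ×ˢ D.dom

/-- The three-dimensional domain `𝔹 = [0,1] × ℝ × 𝔻`, with coordinates `(ξ, t, x)`. -/
def Space.bulk (D : Space) : Set (ℝ × ℝ × ℝ) := Set.Icc 0 1 ×ˢ (Set.univ ×ˢ D.dom)

section Fields

variable {E G : Type*} [NormedAddCommGroup E] [NormedSpace ℝ E] [FiniteDimensional ℝ E]
  [TopologicalSpace G] [ChartedSpace E G] [Group G] [LieGroup 𝓘(ℝ, E) ∞ G]

/-- The derivative `∂_t`. -/
noncomputable def dt {F : Type*} [NormedAddCommGroup F] [NormedSpace ℝ F]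
    (f : ℝ × ℝ → F) (y : ℝ × ℝ) : F := fderiv ℝ f y (1, 0)

/-- The derivative `∂_x`. -/
noncomputable def dx {F : Type*} [NormedAddCommGroup F] [NormedSpace ℝ F]
    (f : ℝ × ℝ → F) (y : ℝ × ℝ) : F := fderiv ℝ f y (0, 1)

/-- A smooth field on `ℝ × 𝔻` with values in the patch, given by its coordinates. -/
structure IsField (D : Space) (P : Patch E G) (φ : ℝ × ℝ → E) : Prop where
  smooth : ContDiff ℝ ∞ φ
  mem : ∀ y, φ y ∈ P.c.target
  periodic : D = .circle → ∀ t x, φ (t, x + 2 * Real.pi) = φ (t, x)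

/-- `g⁻¹ ∂_ξ g`, `g⁻¹ ∂_t g` or `g⁻¹ ∂_x g` for a field on the bulk, `e` being the corresponding
coordinate vector. -/
noncomputable def bulkCurrent (P : Patch E G) (Φ : ℝ × ℝ × ℝ → E) (e : ℝ × ℝ × ℝ)
    (y : ℝ × ℝ × ℝ) : RealAlg E G := leftForm P.c (Φ y) (fderiv ℝ Φ y e)

/-- The density `κ(g⁻¹∂_ξ g, [g⁻¹∂_x g, g⁻¹∂_t g])`. -/
noncomputable def wzDensity (P : Patch E G) (Φ : ℝ × ℝ × ℝ → E) (y : ℝ × ℝ × ℝ) : ℝ :=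
  kappa E G (bulkCurrent P Φ (1, 0, 0) y)
    ⁅bulkCurrent P Φ (0, 0, 1) y, bulkCurrent P Φ (0, 1, 0) y⁆

/-- The Wess-Zumino term `I_WZ[g]`, computed with an extension of `g` to the bulk. -/
noncomputable def wzTerm (D : Space) (P : Patch E G) (Φ : ℝ × ℝ × ℝ → E) : ℝ :=
  ∫ y in D.bulk, wzDensity P Φ y

/-- `Φ` is an extension of the field `φ` to the bulk, inside the patch: it restricts to `φ` at
`ξ = 1`; at `ξ = 0` it does not depend on `x`, so that space is capped off and `ξ = 1` is the whole
boundary; and the three-form `Ω` and the two-form `Λ` (its components `ξt` and `ξx`) pulled back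
to the bulk are integrable, so that there is no boundary at infinity. -/
structure IsExtension (D : Space) (P : Patch E G) (φ : ℝ × ℝ → E) (Φ : ℝ × ℝ × ℝ → E) :
    Prop where
  smooth : ContDiff ℝ ∞ Φ
  mem : ∀ ξ ∈ Set.Icc (0 : ℝ) 1, ∀ t x, Φ (ξ, t, x) ∈ P.c.target
  periodic : D = .circle → ∀ ξ t x, Φ (ξ, t, x + 2 * Real.pi) = Φ (ξ, t, x)
  top : ∀ t x, Φ (1, t, x) = φ (t, x)
  bot : ∀ t x, Φ (0, t, x) = Φ (0, t, 0)
  integrable_wz : IntegrableOn (wzDensity P Φ) D.bulk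
  integrable_t : IntegrableOn
    (fun y => P.lam (Φ y) ![fderiv ℝ Φ y (1, 0, 0), fderiv ℝ Φ y (0, 1, 0)]) D.bulk
  integrable_x : IntegrableOn
    (fun y => P.lam (Φ y) ![fderiv ℝ Φ y (1, 0, 0), fderiv ℝ Φ y (0, 0, 1)]) D.bulk

variable [LieAlgebra.IsSimple ℂ (CplxAlg E G)]
  {N : ℕ} (A : Params N) (P : Fin N → Patch E G)
  (φ : Fin N → ℝ × ℝ → E) (π : Fin N → ℝ × ℝ → (E →L[ℝ] ℝ))

/-- The current `j_±^{(r)} = (g^{(r)})⁻¹ ∂_± g^{(r)}` of the Lagrangian fields. -/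
noncomputable def fieldCurrent (s : ℤˣ) (r : Fin N) (y : ℝ × ℝ) : RealAlg E G :=
  lightCurrent P (fun r => φ r y) (fun r => dx (φ r) y) (fun r => dt (φ r) y) s r

/-- The terms `κ(j_a^{(r)}, j_b^{(s)})` and `λ_{ij} ∂_xφ^i ∂_tφ^j` are integrable on `ℝ × 𝔻`. -/
def FiniteAction (D : Space) : Prop :=
  (∀ (a b : ℤˣ) (r s : Fin N), IntegrableOn
    (fun y => kappa E G (fieldCurrent P φ a r y) (fieldCurrent P φ b s y)) D.world) ∧
  ∀ r, IntegrableOn (fun y => (P r).lam (φ r y) ![dx (φ r) y, dt (φ r) y]) D.world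

/-- The Hamiltonian density along a field configuration. -/
noncomputable def fieldHam (y : ℝ × ℝ) : ℂ :=
  ham A P (fun r => φ r y) (fun r => dx (φ r) y) (fun r => π r y)

/-- The light-cone components `ℒ_±(w, x, t)` of the Lax pair along a field configuration. -/
noncomputable def fieldLax (s : ℤˣ) (w : ℂ) (y : ℝ × ℝ) : CplxAlg E G :=
  laxPM A P (fun r => φ r y) (fun r => dx (φ r) y) (fun r => π r y) s w

/-- The momenta `π` are related to the fields `φ` by `∂_t φ = {ℋ, φ}` everywhere. -/
def IsLegendre : Prop :=
  ∀ y, VelocityEq A P (fun r => φ r y) (fun r => dx (φ r) y) (fun r => π r y)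
    (fun r => dt (φ r) y)

/-- The action `∬ dt dx ∑_r π_i^{(r)} ∂_tφ^{(r)i} - ∫ dt ℋ`. -/
noncomputable def action (D : Space) : ℂ :=
  ((∫ y in D.world, ∑ r, π r y (dt (φ r) y) : ℝ) : ℂ)
    - ∫ t : ℝ, ∫ x in D.dom, fieldHam A P φ π (t, x)

/-- Second half of Hamilton's equations, `∂_t π = {ℋ, π} = -∂ℋ/∂φ + ∂_x (∂ℋ/∂(∂_xφ))`, paired
with a constant variation `u`. -/
def MomentumEq : Prop :=
  ∀ (t x : ℝ) (u : Fin N → E),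
    HasDerivAt (fun τ : ℝ => ((∑ r, π r (τ, x) (u r) : ℝ) : ℂ))
      (deriv (fun ξ : ℝ =>
          lineDeriv ℝ (fun q' => ham A P (fun r => φ r (t, ξ)) q' (fun r => π r (t, ξ)))
            (fun r => dx (φ r) (t, ξ)) u) x
        - lineDeriv ℝ (fun q => ham A P q (fun r => dx (φ r) (t, x)) (fun r => π r (t, x)))
            (fun r => φ r (t, x)) u) t

/-- The zero curvature equation `∂_+ ℒ_- - ∂_- ℒ_+ + [ℒ_+, ℒ_-] = 0`, with `∂_± = ∂_t ± ∂_x`, for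
all values `w` of the spectral parameter away from the sites and the zeros of the twist function;
the derivatives of `𝔤`-valued fields are taken componentwise, i.e. through linear forms on `𝔤`. -/
def ZeroCurvature : Prop :=
  ∀ w, A.Regular w → ∀ (f : Module.Dual ℂ (CplxAlg E G)) (y : ℝ × ℝ),
    (dt (fun y' => f (fieldLax A P φ π (-1) w y')) y
      + dx (fun y' => f (fieldLax A P φ π (-1) w y')) y)
    - (dt (fun y' => f (fieldLax A P φ π 1 w y')) y
      - dx (fun y' => f (fieldLax A P φ π 1 w y')) y)
    + f ⁅fieldLax A P φ π 1 w y, fieldLax A P φ π (-1) w y⁆ = 0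

end Fields

end CoupledPCM

/-! Write `R_±` for `ratio`, the quotient of `∏_{i ∈ I_±} (w - ζ_i)` by `∏_t (w - z_t)`. Everything
rests on the factorisation `φ = -ℓ^∞ R_+ R_-` (`twist_eq`). Since `|I_±| = N`, each `R_±` is `1`
plus simple poles at the sites, with residues `φ_±^{(r)}(z_r)` (`ratio_eq`). Multiplying such
expansions gives `ratio_mul_eq`, where the double poles carry `ℓ_r`, and the simple ones `k_r` and
the couplings `ρ_{rs}`. Uniqueness of the principal parts (`eq_zero_of_sum_eq_zero`) then yields the
levels, and reality follows because conjugation permutes the zeros in each of `I_±`.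

The Hamiltonian density is half the quadratic form attached to the symmetric form `hamPolar`, in the
currents `(j, J_{[0]})`. The velocity relation is not inverted directly: the answer `solved`, linear
in the `j_±`, is written down and checked. For it, `Γ` is a sum of terms in `j_+` proportional to
`R_-` and terms in `j_-` proportional to `R_+` (`gaudinAlg_solved`), so at a zero in `I_±` only
`j_±` survives. Hence `ℳ` is a sum of two interpolants, one for each chirality, with `ℳ(z_r) = g⁻¹
∂_t g` at the site `r`; this is the velocity relation. Uniqueness of the momenta follows from
solvability for every velocity and the symmetry of `hamPolar`. The Lagrangian and the formula for
`ℒ_±` are read off from the same expressions.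

The Wess-Zumino term is Stokes' theorem for `dΛ = Ω` on the bulk (`integral_bulk_eq`), proved with
cut-offs whose contribution disappears by integrability.

For the Lax pair, both sides are reduced to the vanishing of the `𝔤₀`-valued expressions `eom`.
After multiplication by `ℓ^∞ R_+ R_-`, the Maurer-Cartan identity for the `j_±` cancels the double
poles of the curvature and leaves `∑_r 2 eom_r / (w - z_r)` (`curvature_eq`). On the Hamiltonian
side, the variation of the density at fixed momenta (`hasDerivAt_ham`), the Maurer-Cartan equation
and `dΛ = Ω` show that the defect in the momentum equation, paired with `u`, is `∑_r κ(eom_r, g⁻¹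
∂_u g)` (`momentumEq_iff`). -/

namespace CoupledPCM

/-! ### Partial fractions at the sites: `R_±`, the levels and the couplings -/

open Polynomial in
-- A polynomial of degree below the number of nodes is its own Lagrange interpolant; dividing by the
-- nodal polynomial gives the partial fractions. It serves with the sites as nodes and with the
-- zeros in `I_±` as nodes.
theorem eval_div_prod_eq_sum {ι : Type*} [DecidableEq ι] {s : Finset ι} {v : ι → ℂ}
    (hv : Set.InjOn v s) {f : ℂ[X]} (hf : f.degree < s.card) {x : ℂ} (hx : ∀ i ∈ s, x ≠ v i) :
    f.eval x / ∏ i ∈ s, (x - v i) =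
      ∑ i ∈ s, f.eval (v i) / (∏ j ∈ s.erase i, (v i - v j)) / (x - v i) := by
  have h0 : ∏ i ∈ s, (x - v i) ≠ 0 := Finset.prod_ne_zero_iff.2 fun i hi => sub_ne_zero.2 (hx i hi)
  have h := Lagrange.eval_interpolate_not_at_node (fun i => f.eval (v i)) hx
  rw [← Lagrange.eq_interpolate hv hf, Lagrange.eval_nodal] at h
  rw [h, mul_div_cancel_left₀ _ h0]
  refine Finset.sum_congr rfl fun i _ => ?_
  rw [Lagrange.nodalWeight, Finset.prod_inv_distrib]
  ring

namespace Params

variable {N : ℕ} (A : Params N)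

/-- The function `∏_{i ∈ I_±} (w - ζ_i) / ∏_t (w - z_t)`. -/
noncomputable def ratio (σ : ℤˣ) (w : ℂ) : ℂ :=
  (∏ i ∈ A.idx σ, (w - A.zeta i)) / ∏ t, (w - (A.z t : ℂ))

/-- The couplings `ρ_{sr}` (for `σ = 1`) or `ρ_{rs}` (for `σ = -1`). -/
noncomputable def rhoT (σ : ℤˣ) (s r : Fin N) : ℂ := if σ = 1 then A.rho s r else A.rho r s

theorem disjoint_idx (σ : ℤˣ) : Disjoint (A.idx σ) (A.idx (-σ)) := by
  refine Finset.disjoint_left.2 fun i hi hj => ?_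
  simp only [idx, Finset.mem_filter, Finset.mem_univ, true_and] at hi hj
  rw [hi] at hj
  exact units_ne_neg_self σ hj

theorem idx_union (σ : ℤˣ) : A.idx σ ∪ A.idx (-σ) = Finset.univ := by
  ext i
  simp only [idx, Finset.mem_union, Finset.mem_filter, Finset.mem_univ, true_and, iff_true]
  rcases Int.units_eq_one_or (A.eps i) with h | h <;> rcases Int.units_eq_one_or σ with h' | h' <;>
    simp [h, h']

variable {A} (hA : A.Admissible)
include hA

namespace Admissible

theorem card_idx (σ : ℤˣ) : (A.idx σ).card = N := by
  rcases Int.units_eq_one_or σ with h | h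
  · rw [h, hA.card_plus]
  · rw [h, hA.card_minus]

theorem zC_injective : Function.Injective fun r => (A.z r : ℂ) :=
  Complex.ofReal_injective.comp hA.z_injective

theorem zC_sub_ne {r s : Fin N} (h : r ≠ s) : (A.z r : ℂ) - A.z s ≠ 0 :=
  sub_ne_zero.2 fun e => h (hA.zC_injective e)

theorem ellInf_ne : (A.ellInf : ℂ) ≠ 0 := by exact_mod_cast hA.ellInf_ne_zero

omit hA in
theorem _root_.CoupledPCM.Params.phi_eq (σ : ℤˣ) (r : Fin N) {w : ℂ} (hw : w ≠ A.z r) :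
    A.phi σ r w = (w - A.z r) * A.ratio σ w := by
  have : w - (A.z r : ℂ) ≠ 0 := sub_ne_zero.2 hw
  rw [phi, ratio, ← Finset.mul_prod_erase _ _ (Finset.mem_univ r)]
  field_simp

/-- Numerator and denominator are both monic of degree `N`, because `|I_±| = N`, so their difference
has lower degree and the quotient minus `1` is a proper fraction. -/
theorem ratio_eq (σ : ℤˣ) {w : ℂ} (hw : ∀ r, w ≠ A.z r) :
    A.ratio σ w = 1 + ∑ r, A.phi σ r (A.z r) / (w - A.z r) := by
  set p := Lagrange.nodal (A.idx σ) A.zeta with hp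
  set d := Lagrange.nodal Finset.univ (fun r => (A.z r : ℂ)) with hd
  have hdeg : (p - d).degree < (Finset.univ : Finset (Fin N)).card := by
    have h := Polynomial.degree_sub_lt_left (p := p) (q := d)
      (by rw [Lagrange.degree_nodal, Lagrange.degree_nodal, hA.card_idx]; simp)
      Lagrange.nodal_ne_zero
      (by rw [Lagrange.nodal_monic.leadingCoeff, Lagrange.nodal_monic.leadingCoeff])
    rw [Lagrange.degree_nodal, hA.card_idx] at h
    simpa using h
  have h := eval_div_prod_eq_sum hA.zC_injective.injOn hdeg (x := w) fun i _ => hw i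
  have h0 : ∏ i, (w - (A.z i : ℂ)) ≠ 0 :=
    Finset.prod_ne_zero_iff.2 fun i _ => sub_ne_zero.2 (hw i)
  rw [Polynomial.eval_sub, hp, hd, Lagrange.eval_nodal, Lagrange.eval_nodal, sub_div,
    div_self h0, sub_eq_iff_eq_add'] at h
  rw [ratio, h]
  congr 1
  refine Finset.sum_congr rfl fun r _ => ?_
  rw [Polynomial.eval_sub, Lagrange.eval_nodal,
    Lagrange.eval_nodal_at_node (v := fun r => (A.z r : ℂ)) (Finset.mem_univ r), sub_zero, phi]

/-- Multiplying `ratio_eq` by `w - z_r` removes the pole at `z_r`. The resulting identity also holds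
at `z_r` itself, which is what differentiation there requires. -/
theorem phi_near (σ : ℤˣ) (r : Fin N) {w : ℂ} (hw : ∀ t ≠ r, w ≠ A.z t) :
    A.phi σ r w = A.phi σ r (A.z r) + (w - A.z r) *
      (1 + ∑ t ∈ Finset.univ.erase r, A.phi σ t (A.z t) / (w - A.z t)) := by
  by_cases h : w = A.z r
  · simp [h]
  · have hw' : ∀ t, w ≠ A.z t := fun t => if e : t = r then e ▸ h else hw t e
    have : w - (A.z r : ℂ) ≠ 0 := sub_ne_zero.2 h
    rw [phi_eq σ r h, hA.ratio_eq σ hw', ← Finset.add_sum_erase _ _ (Finset.mem_univ r)]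
    field_simp
    ring

theorem eventually_ne (r : Fin N) : ∀ᶠ w : ℂ in 𝓝 (A.z r : ℂ), ∀ t ≠ r, w ≠ A.z t := by
  refine Filter.eventually_all.2 fun t => ?_
  by_cases h : t = r
  · simp [h]
  · have : ∀ᶠ w : ℂ in 𝓝 (A.z r : ℂ), w ≠ A.z t :=
      isOpen_ne.mem_nhds (fun e => h (hA.zC_injective e).symm)
    filter_upwards [this] with w hw _ using hw

theorem eventually_zeta_ne (r : Fin N) : ∀ᶠ w : ℂ in 𝓝 (A.z r : ℂ), ∀ i, w ≠ A.zeta i := by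
  refine Filter.eventually_all.2 fun i => ?_
  exact isOpen_ne.mem_nhds (hA.zeta_ne_z i r).symm

theorem eventually_regular (r : Fin N) : ∀ᶠ w : ℂ in 𝓝[≠] (A.z r : ℂ), A.Regular w := by
  filter_upwards [nhdsWithin_le_nhds (hA.eventually_ne r),
    nhdsWithin_le_nhds (hA.eventually_zeta_ne r), self_mem_nhdsWithin] with w h1 h2 h3
  exact ⟨fun t => if e : t = r then e ▸ h3 else h1 t e, h2⟩

theorem hasDerivAt_phi (σ : ℤˣ) (r : Fin N) :
    HasDerivAt (A.phi σ r)
      (1 + ∑ t ∈ Finset.univ.erase r, A.phi σ t (A.z t) / ((A.z r : ℂ) - A.z t)) (A.z r) := by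
  have h : ContinuousAt (fun w : ℂ =>
      1 + ∑ t ∈ Finset.univ.erase r, A.phi σ t (A.z t) / (w - A.z t)) (A.z r) := by
    refine continuousAt_const.add (tendsto_finsetSum _ fun t ht => ?_)
    exact continuousAt_const.div (by fun_prop) (hA.zC_sub_ne (Finset.ne_of_mem_erase ht).symm)
  suffices h2 : HasDerivAt (fun w : ℂ => A.phi σ r (A.z r) +
      (w - A.z r) * (1 + ∑ t ∈ Finset.univ.erase r, A.phi σ t (A.z t) / (w - A.z t)))
      (1 + ∑ t ∈ Finset.univ.erase r, A.phi σ t (A.z t) / ((A.z r : ℂ) - A.z t)) (A.z r) by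
    refine h2.congr_of_eventuallyEq ?_
    filter_upwards [hA.eventually_ne r] with w hw using hA.phi_near σ r hw
  · refine hasDerivAt_iff_tendsto_slope.2 ((h.tendsto.mono_left nhdsWithin_le_nhds).congr' ?_)
    filter_upwards [self_mem_nhdsWithin] with w hw
    have : w - (A.z r : ℂ) ≠ 0 := sub_ne_zero.2 hw
    simp only [slope, vsub_eq_sub, sub_self, zero_mul, add_zero, smul_eq_mul, add_sub_cancel_left]
    field_simp

theorem deriv_phi (σ : ℤˣ) (r : Fin N) :
    deriv (A.phi σ r) (A.z r) =
      1 + ∑ t ∈ Finset.univ.erase r, A.phi σ t (A.z t) / ((A.z r : ℂ) - A.z t) :=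
  (hA.hasDerivAt_phi σ r).deriv

omit hA in
theorem _root_.CoupledPCM.Params.rhoT_self (σ : ℤˣ) (r : Fin N) :
    A.rhoT σ r r = (σ : ℤ) * (A.ellInf / 4 * (deriv (A.phi σ r) (A.z r) * A.phi (-σ) r (A.z r)
      - A.phi σ r (A.z r) * deriv (A.phi (-σ) r) (A.z r))) := by
  rcases Int.units_eq_one_or σ with h | h <;> simp [h, rhoT, rho]; ring

omit hA in
theorem _root_.CoupledPCM.Params.kOfZeros_eq (σ : ℤˣ) (r : Fin N) :
    A.kOfZeros r = A.ellInf / 2 * (A.phi σ r (A.z r) * deriv (A.phi (-σ) r) (A.z r)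
    + deriv (A.phi σ r) (A.z r) * A.phi (-σ) r (A.z r)) := by
  rcases Int.units_eq_one_or σ with h | h
  · simp [h, kOfZeros]
  · simp only [h, kOfZeros, neg_neg]
    ring

omit hA in
theorem _root_.CoupledPCM.Params.ellOfZeros_eq (σ : ℤˣ) (r : Fin N) :
    A.ellOfZeros r = -A.ellInf * A.phi σ r (A.z r) * A.phi (-σ) r (A.z r) := by
  rcases Int.units_eq_one_or σ with h | h <;> simp [h, ellOfZeros]; ring

theorem rhoT_of_ne (σ : ℤˣ) {s r : Fin N} (h : s ≠ r) :
    A.rhoT σ s r = (σ : ℤ) * (A.ellInf / 2 * (A.phi σ s (A.z s) * A.phi (-σ) r (A.z r))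
      / ((A.z s : ℂ) - A.z r)) := by
  have h1 := hA.zC_sub_ne h
  have h2 := hA.zC_sub_ne h.symm
  rcases Int.units_eq_one_or σ with e | e
  · simp [e, rhoT, rho, h]
  · simp only [e, rhoT, rho, h.symm, if_false, neg_neg]
    simp only [show ((-1 : ℤˣ) = 1) = False by decide, if_false]
    push_cast
    field_simp
    ring

/-- Partial fraction expansion of the coefficients of the Gaudin Lax matrix. -/
theorem ratio_mul_eq (σ : ℤˣ) (s : Fin N) {w : ℂ} (hw : ∀ r, w ≠ A.z r) :
    A.ellInf * (A.ratio (-σ) w * (A.phi σ s (A.z s) / (w - A.z s))) =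
      - A.ellOfZeros s / (w - A.z s) ^ 2 + A.kOfZeros s / (w - A.z s)
        - (σ : ℤ) * (2 * ∑ r, A.rhoT σ s r / (w - A.z r)) := by
  have hs : ∀ r, w - (A.z r : ℂ) ≠ 0 := fun r => sub_ne_zero.2 (hw r)
  have hσ : ((σ : ℤ) : ℂ) = 1 ∨ ((σ : ℤ) : ℂ) = -1 := by
    rcases Int.units_eq_one_or σ with e | e <;> simp [e]
  rw [hA.ratio_eq _ hw, ← Finset.add_sum_erase _ _ (Finset.mem_univ s),
    ← Finset.add_sum_erase _ (fun r => A.rhoT σ s r / (w - A.z r)) (Finset.mem_univ s),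
    rhoT_self, kOfZeros_eq σ, ellOfZeros_eq σ, hA.deriv_phi (-σ)]
  -- The off-diagonal coupling contains `1/(z_s - z_r)`, exactly the factor that splits `1/((w -
  -- z_r)(w - z_s))`. Of the two sums this produces, `S1` below enters the derivative of `φ^{(s)}`
  -- at `z_s` and `S2` is the off-diagonal part of `R_{-σ}`.
  have h1 : ∀ r ∈ Finset.univ.erase s, A.rhoT σ s r / (w - A.z r) =
      (σ : ℤ) * (A.ellInf / 2 * A.phi σ s (A.z s)) * (A.phi (-σ) r (A.z r) /
        ((A.z s : ℂ) - A.z r) / (w - A.z s) - A.phi (-σ) r (A.z r) / (w - A.z r) / (w - A.z s)) := by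
    intro r hr
    have hne := (Finset.ne_of_mem_erase hr).symm
    have := hA.zC_sub_ne hne
    rw [hA.rhoT_of_ne σ hne]
    have := hs r
    have := hs s
    field_simp
    ring
  rw [Finset.sum_congr rfl h1, ← Finset.mul_sum, Finset.sum_sub_distrib, ← Finset.sum_div,
    ← Finset.sum_div]
  set S1 := ∑ r ∈ Finset.univ.erase s, A.phi (-σ) r (A.z r) / ((A.z s : ℂ) - A.z r)
  set S2 := ∑ r ∈ Finset.univ.erase s, A.phi (-σ) r (A.z r) / (w - A.z r)
  have := hs s
  rcases hσ with e | e <;> rw [e] <;> field_simp <;> ring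

theorem tendsto_sub_mul_sum (n : ℕ) (hn : n ≠ 0) (a : Fin N → ℂ) (r : Fin N) :
    Filter.Tendsto (fun w : ℂ => (w - A.z r) ^ n * ∑ s, a s / (w - A.z s) ^ n)
      (𝓝[≠] (A.z r : ℂ)) (𝓝 (a r)) := by
  have h : ContinuousAt (fun w : ℂ => a r + (w - A.z r) ^ n *
      ∑ s ∈ Finset.univ.erase r, a s / (w - A.z s) ^ n) (A.z r) := by
    refine continuousAt_const.add (ContinuousAt.mul (by fun_prop)
      (tendsto_finsetSum _ fun t ht => ?_))
    exact continuousAt_const.div (by fun_prop)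
      (pow_ne_zero _ (hA.zC_sub_ne (Finset.ne_of_mem_erase ht).symm))
  have h2 := h.tendsto.mono_left (nhdsWithin_le_nhds (s := {(A.z r : ℂ)}ᶜ))
  simp only [sub_self, zero_pow hn, zero_mul, add_zero] at h2
  refine h2.congr' ?_
  filter_upwards [self_mem_nhdsWithin] with w hw
  have : w - (A.z r : ℂ) ≠ 0 := sub_ne_zero.2 hw
  rw [← Finset.add_sum_erase _ (fun s => a s / (w - A.z s) ^ n) (Finset.mem_univ r)]
  field_simp

/-- Multiply by `(w - z_r)²` and let `w` tend to `z_r` to isolate the double pole; once the `a s`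
are gone, multiply by `w - z_r`. Regular points suffice, as they fill a punctured neighbourhood of
`z_r`. -/
theorem eq_zero_of_sum_eq_zero (a b : Fin N → ℂ)
    (h : ∀ w, A.Regular w → ∑ s, (a s / (w - A.z s) ^ 2 + b s / (w - A.z s)) = 0) (r : Fin N) :
    a r = 0 ∧ b r = 0 := by
  have ha : ∀ r, a r = 0 := by
    intro r
    have h1 := (hA.tendsto_sub_mul_sum 2 two_ne_zero a r).add
      (((hA.tendsto_sub_mul_sum 1 one_ne_zero b r).mul
      (((continuous_id.sub continuous_const).tendsto' (A.z r : ℂ) 0 (sub_self _)).mono_left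
        nhdsWithin_le_nhds)))
    rw [mul_zero, add_zero] at h1
    refine tendsto_nhds_unique (h1.congr' (f₂ := fun _ => 0) ?_) tendsto_const_nhds
    filter_upwards [hA.eventually_regular r] with w hw
    have := h w hw
    rw [Finset.sum_add_distrib] at this
    simp only [pow_one, id, Pi.sub_apply]
    linear_combination (w - A.z r) ^ 2 * this
  refine ⟨ha r, ?_⟩
  refine tendsto_nhds_unique ((hA.tendsto_sub_mul_sum 1 one_ne_zero b r).congr'
    (f₂ := fun _ => 0) ?_) tendsto_const_nhds
  filter_upwards [hA.eventually_regular r] with w hw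
  have := h w hw
  simp only [ha, zero_div, zero_add] at this
  simp [this]

end Admissible
end Params
end CoupledPCM

/-! ### Factorisation of the twist function, reality, and the coefficients of the Lax matrix -/

namespace CoupledPCM

/-- The slope of `f` at `a` is `g` itself, so continuity of `g` replaces the differentiability that
a product rule would ask for. -/
theorem hasDerivAt_of_eventually_eq_sub_mul {f g : ℂ → ℂ} {a : ℂ} (hg : ContinuousAt g a)
    (h : ∀ᶠ w in 𝓝 a, f w = (w - a) * g w) : HasDerivAt f (g a) a := by
  refine hasDerivAt_iff_tendsto_slope.2 ((hg.tendsto.mono_left nhdsWithin_le_nhds).congr' ?_)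
  filter_upwards [nhdsWithin_le_nhds h, self_mem_nhdsWithin] with w hw hne
  have : w - a ≠ 0 := sub_ne_zero.2 hne
  simp only [slope, vsub_eq_sub, smul_eq_mul, hw, h.self_of_nhds]
  field_simp
  ring

namespace Params

variable {N : ℕ} {A : Params N}

namespace Admissible

variable (hA : A.Admissible)
include hA

open Polynomial in
/-- The factorised form of the twist function. -/
theorem twist_eq (σ : ℤˣ) {w : ℂ} (hw : ∀ r, w ≠ A.z r) :
    A.twist w = -A.ellInf * (A.ratio σ w * A.ratio (-σ) w) := by
  set v : Fin N → ℂ := fun r => (A.z r : ℂ) with hv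
  set d : ℂ[X] := Lagrange.nodal Finset.univ v with hd
  set q : ℂ[X] := Lagrange.nodal Finset.univ A.zeta with hq
  set e : Fin N → ℂ[X] := fun r => Lagrange.nodal (Finset.univ.erase r) v with he
  -- `R` is the numerator of `φ + ℓ^∞` over the common denominator `d²`; its degree is less than
  -- `2N`.
  set R : ℂ[X] := (∑ r, (C (A.ell r : ℂ) * e r ^ 2 -
    C (2 * (A.k r : ℂ)) * ((X - C (v r)) * e r ^ 2))) with hR
  have hde : ∀ r, d = (X - C (v r)) * e r := fun r =>
    Lagrange.nodal_eq_mul_nodal_erase (Finset.mem_univ r)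
  have hev : ∀ x : ℂ, (∀ r, x ≠ v r) →
      (R - C (A.ellInf : ℂ) * d ^ 2).eval x = A.twist x * d.eval x ^ 2 := by
    intro x hx
    simp only [hR, eval_sub, eval_finsetSum, eval_mul, eval_C, eval_pow, twist, sub_mul,
      Finset.sum_mul, eval_X]
    congr 1
    refine Finset.sum_congr rfl fun r _ => ?_
    have h1 : x - v r ≠ 0 := sub_ne_zero.2 (hx r)
    have h2 : x - (A.z r : ℂ) ≠ 0 := h1
    have := hde r
    rw [this]
    simp only [eval_mul, eval_sub, eval_X, eval_C, hv]
    field_simp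
  have hdegR : R ∈ degreeLT ℂ (2 * N) := by
    refine Submodule.sum_mem _ fun r _ => ?_
    have hN : 0 < N := r.pos
    have hde : (e r).natDegree = N - 1 := by
      simp only [he, Lagrange.natDegree_nodal, Finset.card_erase_of_mem (Finset.mem_univ r),
        Finset.card_univ, Fintype.card_fin]
    have hd2 : (e r ^ 2).natDegree = 2 * (N - 1) := by rw [natDegree_pow, hde]
    refine Submodule.sub_mem _ ?_ ?_
    · rw [← smul_eq_C_mul]
      refine Submodule.smul_mem _ _ (mem_degreeLT.2 ?_)
      refine degree_le_natDegree.trans_lt ?_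
      rw [hd2]
      exact_mod_cast (by omega : 2 * (N - 1) < 2 * N)
    · rw [← smul_eq_C_mul]
      refine Submodule.smul_mem _ _ (mem_degreeLT.2 ?_)
      refine degree_le_natDegree.trans_lt ?_
      have := natDegree_mul_le (p := X - C (v r)) (q := e r ^ 2)
      rw [hd2, natDegree_X_sub_C] at this
      exact_mod_cast (by omega : ((X - C (v r)) * e r ^ 2).natDegree < 2 * N)
  have hdq : q - d ^ 2 ∈ degreeLT ℂ (2 * N) := by
    have hm : (d ^ 2).Monic := (Lagrange.nodal_monic).pow 2
    have h := degree_sub_lt_left (p := q) (q := d ^ 2)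
      (by rw [hq, hd, degree_pow, Lagrange.degree_nodal, Lagrange.degree_nodal]; simp)
      Lagrange.nodal_ne_zero
      (by rw [Lagrange.nodal_monic.leadingCoeff, hm.leadingCoeff])
    rw [mem_degreeLT]
    refine h.trans_eq ?_
    rw [hq, Lagrange.degree_nodal]
    simp
  -- The monic polynomials `q` and `d²` both have degree `2N`, so their leading terms cancel and a
  -- polynomial of degree less than `2N` remains. It vanishes at the `2N` distinct points `ζ_i`.
  have hzero : R - C (A.ellInf : ℂ) * d ^ 2 + C (A.ellInf : ℂ) * q = 0 := by
    refine Polynomial.eq_zero_of_degree_lt_of_eval_index_eq_zero (s := Finset.univ)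
      hA.zeta_injective.injOn ?_ fun i _ => ?_
    · have : R - C (A.ellInf : ℂ) * d ^ 2 + C (A.ellInf : ℂ) * q =
        R + (A.ellInf : ℂ) • (q - d ^ 2) := by rw [smul_eq_C_mul]; ring
      rw [this]
      have h := mem_degreeLT.1 (Submodule.add_mem _ hdegR
        (Submodule.smul_mem _ (A.ellInf : ℂ) hdq))
      simpa using h
    · rw [eval_add, hev _ (hA.zeta_ne_z i), hA.twist_zeta, eval_mul, hq,
        Lagrange.eval_nodal_at_node (Finset.mem_univ i)]
      simp
  have h := congrArg (eval w) hzero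
  rw [eval_add, hev w hw, eval_mul, eval_C, hq, hd, Lagrange.eval_nodal, Lagrange.eval_nodal,
    eval_zero, ← A.idx_union σ, Finset.prod_union (A.disjoint_idx σ)] at h
  have h0 : ∏ i, (w - (A.z i : ℂ)) ≠ 0 :=
    Finset.prod_ne_zero_iff.2 fun i _ => sub_ne_zero.2 (hw i)
  simp only [ratio]
  simp only [hv] at h
  field_simp
  linear_combination h

/-- The sum `∑_{s ≠ r} φ_-^{(s)}(z_s)/(z_r - z_s)` is the derivative of `φ_-^{(r)}` at `z_r` minus
`1`, and this `-1` cancels the term `ℓ^∞ φ_+^{(r)}(z_r)`. It collects the simple pole at `z_r` in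
the expansion of `ℓ^∞ R_+ R_-`. -/
theorem ellInf_mul_phi_add (r : Fin N) :
    A.ellInf * A.phi 1 r (A.z r) + 2 * ∑ s, A.rhoT (-1) s r = A.kOfZeros r := by
  rw [← Finset.add_sum_erase _ _ (Finset.mem_univ r), rhoT_self]
  have h1 : ∀ s ∈ Finset.univ.erase r, A.rhoT (-1) s r =
      A.ellInf / 2 * A.phi 1 r (A.z r) * (A.phi (-1) s (A.z s) / ((A.z r : ℂ) - A.z s)) := by
    intro s hs
    have hne := Finset.ne_of_mem_erase hs
    have h1 := hA.zC_sub_ne hne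
    have h2 := hA.zC_sub_ne hne.symm
    rw [hA.rhoT_of_ne _ hne]
    simp only [neg_neg]
    push_cast
    field_simp
    ring
  rw [Finset.sum_congr rfl h1, ← Finset.mul_sum, kOfZeros]
  have := hA.deriv_phi (-1) r
  simp only [neg_neg]
  push_cast
  linear_combination (- A.ellInf * A.phi 1 r (A.z r)) * this

/-- Two expansions of `φ` at the sites are compared: its definition, and the product `-ℓ^∞ R_+ R_-`.
-/
theorem levels_eq (r : Fin N) :
    (A.ell r : ℂ) = A.ellOfZeros r ∧ (A.k r : ℂ) = A.kOfZeros r := by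
  have h := hA.eq_zero_of_sum_eq_zero (fun r => (A.ell r : ℂ) - A.ellOfZeros r)
    (fun r => -2 * (A.k r : ℂ) + 2 * A.kOfZeros r) (fun w hw => ?_) r
  · refine ⟨sub_eq_zero.1 h.1, ?_⟩
    linear_combination (-1 / 2 : ℂ) * h.2
  · have h1 := hA.twist_eq 1 hw.1
    have h2 : A.ellInf * (A.ratio 1 w * A.ratio (-1) w) = A.ellInf +
        ∑ s, (-A.ellOfZeros s / (w - A.z s) ^ 2 + 2 * A.kOfZeros s / (w - A.z s)) := by
      -- Only `R_-` is expanded here; each product of `R_+` with one of its poles is then the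
      -- left-hand side of `ratio_mul_eq`.
      have h3 : A.ellInf * (A.ratio 1 w * A.ratio (-1) w) = A.ellInf * A.ratio 1 w +
          ∑ s, A.ellInf * (A.ratio (- -1) w * (A.phi (-1) s (A.z s) / (w - A.z s))) := by
        rw [hA.ratio_eq (-1) hw.1, ← Finset.mul_sum, ← Finset.mul_sum, neg_neg]
        ring
      rw [h3, hA.ratio_eq 1 hw.1, mul_add, mul_one, add_assoc, Finset.mul_sum,
        Finset.sum_congr rfl fun s _ => hA.ratio_mul_eq (-1) s hw.1, Finset.sum_sub_distrib,
        ← Finset.mul_sum, ← Finset.mul_sum, ← Finset.mul_sum _ _ (2 : ℂ),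
        Finset.sum_comm (f := fun s r => A.rhoT (-1) s r / (w - A.z r))]
      have h4 : ∀ s : Fin N, -A.ellOfZeros s / (w - A.z s) ^ 2 + 2 * A.kOfZeros s / (w - A.z s) =
          A.ellInf * (A.phi 1 s (A.z s) / (w - A.z s)) +
          (-A.ellOfZeros s / (w - A.z s) ^ 2 + A.kOfZeros s / (w - A.z s)) +
          2 * ∑ r, A.rhoT (-1) r s / (w - A.z s) := by
        intro s
        rw [← Finset.sum_div]
        have := hA.ellInf_mul_phi_add s
        linear_combination (-1 / (w - A.z s)) * this
      rw [Finset.sum_congr rfl fun s _ => h4 s]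
      simp only [Finset.sum_add_distrib, ← Finset.mul_sum]
      push_cast
      ring
    have h5 : A.twist w = ∑ s, ((A.ell s : ℂ) / (w - A.z s) ^ 2 -
      2 * (A.k s : ℂ) / (w - A.z s)) - A.ellInf := rfl
    calc _ = ∑ s, (((A.ell s : ℂ) / (w - A.z s) ^ 2 - 2 * (A.k s : ℂ) / (w - A.z s)) +
          (-A.ellOfZeros s / (w - A.z s) ^ 2 + 2 * A.kOfZeros s / (w - A.z s))) :=
          Finset.sum_congr rfl fun s _ => by ring
      _ = 0 := by
        rw [Finset.sum_add_distrib]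
        linear_combination h1 - h5 - h2

/-- Conjugation permutes the zeros and preserves their signs, hence permutes the factors indexed by
`I_σ`; the positions `z_t` are real. -/
theorem conj_phi (σ : ℤˣ) (r : Fin N) :
    (starRingEnd ℂ) (A.phi σ r (A.z r)) = A.phi σ r (A.z r) := by
  choose c hc hc' using hA.eps_conj
  have hcc : ∀ i, c (c i) = i := fun i => hA.zeta_injective (by rw [hc, hc, Complex.conj_conj])
  simp only [phi, map_div₀, map_prod, map_sub, Complex.conj_ofReal]
  congr 1
  refine Finset.prod_bij' (fun i _ => c i) (fun i _ => c i) ?_ ?_ ?_ ?_ ?_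
  · intro i hi; simpa [idx, hc'] using hi
  · intro i hi; simpa [idx, hc'] using hi
  · intro i _; exact hcc i
  · intro i _; exact hcc i
  · intro i _; rw [hc]

theorem conj_deriv_phi (σ : ℤˣ) (r : Fin N) :
    (starRingEnd ℂ) (deriv (A.phi σ r) (A.z r)) = deriv (A.phi σ r) (A.z r) := by
  rw [hA.deriv_phi]
  simp [map_sum, hA.conj_phi]

theorem conj_rho (r s : Fin N) : (starRingEnd ℂ) (A.rho r s) = A.rho r s := by
  have h2 : (starRingEnd ℂ) 2 = 2 := Complex.conj_ofNat 2
  have h4 : (starRingEnd ℂ) 4 = 4 := Complex.conj_ofNat 4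
  by_cases h : r = s <;> simp [rho, h, hA.conj_phi, hA.conj_deriv_phi, h2, h4]

theorem rho_im (r s : Fin N) : (A.rho r s).im = 0 := Complex.conj_eq_iff_im.1 (hA.conj_rho r s)

theorem rho_re (r s : Fin N) : ((A.rho r s).re : ℂ) = A.rho r s :=
  Complex.conj_eq_iff_re.1 (hA.conj_rho r s)

end Admissible

variable (A) in
/-- The coefficient `φ_±^{(s)}(z_s) / φ_±^{(s)}(w)` of `j_±^{(s)}` in the Lax matrix. -/
noncomputable def laxCoeff (σ : ℤˣ) (s : Fin N) (w : ℂ) : ℂ :=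
  A.phi σ s (A.z s) * (∏ t ∈ Finset.univ.erase s, (w - (A.z t : ℂ))) /
    ∏ i ∈ A.idx σ, (w - A.zeta i)

variable (A) in
/-- The residue of `laxCoeff` at `ζ_i`, for `i ∈ I_±`. -/
noncomputable def laxRes (σ : ℤˣ) (s : Fin N) (i : Fin (2 * N)) : ℂ :=
  A.phi σ s (A.z s) * (∏ t ∈ Finset.univ.erase s, (A.zeta i - (A.z t : ℂ))) /
    ∏ j ∈ (A.idx σ).erase i, (A.zeta i - A.zeta j)

namespace Admissible

variable (hA : A.Admissible)
include hA

theorem laxCoeff_eq_sum (σ : ℤˣ) (s : Fin N) {w : ℂ} (hw : ∀ i, w ≠ A.zeta i) :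
    A.laxCoeff σ s w = ∑ i ∈ A.idx σ, A.laxRes σ s i / (w - A.zeta i) := by
  have hdeg : (Lagrange.nodal (Finset.univ.erase s) fun t => (A.z t : ℂ)).degree <
      (A.idx σ).card := by
    rw [hA.card_idx, Lagrange.degree_nodal, Finset.card_erase_of_mem (Finset.mem_univ s)]
    have := s.pos
    simp only [Finset.card_univ, Fintype.card_fin]
    exact_mod_cast (by omega : N - 1 < N)
  have h := eval_div_prod_eq_sum hA.zeta_injective.injOn hdeg (x := w) fun i _ => hw i
  simp only [Lagrange.eval_nodal] at h
  rw [laxCoeff, mul_div_assoc, h, Finset.mul_sum]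
  refine Finset.sum_congr rfl fun i _ => ?_
  rw [laxRes]
  ring

omit hA in
theorem _root_.CoupledPCM.Params.laxCoeff_mul_ratio (σ : ℤˣ) (s : Fin N) {w : ℂ}
    (hw : A.Regular w) : A.laxCoeff σ s w * A.ratio σ w = A.phi σ s (A.z s) / (w - A.z s) := by
  have h0 : ∏ t ∈ Finset.univ.erase s, (w - (A.z t : ℂ)) ≠ 0 :=
    Finset.prod_ne_zero_iff.2 fun i _ => sub_ne_zero.2 (hw.1 i)
  have h1 : ∏ i ∈ A.idx σ, (w - A.zeta i) ≠ 0 :=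
    Finset.prod_ne_zero_iff.2 fun i _ => sub_ne_zero.2 (hw.2 i)
  have h2 : w - (A.z s : ℂ) ≠ 0 := sub_ne_zero.2 (hw.1 s)
  rw [laxCoeff, ratio, ← Finset.mul_prod_erase _ _ (Finset.mem_univ s)]
  field_simp

omit hA in
theorem _root_.CoupledPCM.Params.laxCoeff_eq_div (σ : ℤˣ) (s : Fin N) (w : ℂ) :
    A.laxCoeff σ s w = A.phi σ s (A.z s) / A.phi σ s w := by
  rw [laxCoeff, phi, phi, div_div_eq_mul_div]

omit hA in
theorem _root_.CoupledPCM.Params.ratio_ne_zero (σ : ℤˣ) {w : ℂ} (hw : A.Regular w) :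
    A.ratio σ w ≠ 0 :=
  div_ne_zero (Finset.prod_ne_zero_iff.2 fun i _ => sub_ne_zero.2 (hw.2 i))
    (Finset.prod_ne_zero_iff.2 fun i _ => sub_ne_zero.2 (hw.1 i))

theorem ratio_zeta_ne_zero {σ : ℤˣ} {i : Fin (2 * N)} (hi : i ∈ A.idx σ) :
    A.ratio (-σ) (A.zeta i) ≠ 0 := by
  refine div_ne_zero (Finset.prod_ne_zero_iff.2 fun j hj => sub_ne_zero.2 fun e => ?_)
    (Finset.prod_ne_zero_iff.2 fun r _ => sub_ne_zero.2 (hA.zeta_ne_z i r))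
  rw [← hA.zeta_injective e] at hj
  exact Finset.disjoint_left.1 (A.disjoint_idx σ) hi hj

omit hA in
theorem _root_.CoupledPCM.Params.ratio_zeta {σ : ℤˣ} {i : Fin (2 * N)} (hi : i ∈ A.idx σ) :
    A.ratio σ (A.zeta i) = 0 := by
  rw [ratio, Finset.prod_eq_zero hi (sub_self _), zero_div]

omit hA in
theorem eventually_ne_z {w : ℂ} (hw : ∀ r, w ≠ A.z r) : ∀ᶠ x : ℂ in 𝓝 w, ∀ r, x ≠ A.z r :=
  Filter.eventually_all.2 fun r => isOpen_ne.mem_nhds (hw r)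

theorem hasDerivAt_twist {σ : ℤˣ} {i : Fin (2 * N)} (hi : i ∈ A.idx σ) :
    HasDerivAt A.twist (-A.ellInf * ((∏ j ∈ (A.idx σ).erase i, (A.zeta i - A.zeta j)) /
      (∏ t, (A.zeta i - (A.z t : ℂ))) * A.ratio (-σ) (A.zeta i))) (A.zeta i) := by
  have h0 : ∏ t, (A.zeta i - (A.z t : ℂ)) ≠ 0 :=
    Finset.prod_ne_zero_iff.2 fun r _ => sub_ne_zero.2 (hA.zeta_ne_z i r)
  refine hasDerivAt_of_eventually_eq_sub_mul (g := fun w =>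
    -A.ellInf * ((∏ j ∈ (A.idx σ).erase i, (w - A.zeta j)) /
      (∏ t, (w - (A.z t : ℂ))) * A.ratio (-σ) w)) ?_ ?_
  · refine continuousAt_const.mul (ContinuousAt.mul ?_ ?_)
    · exact ContinuousAt.div (by fun_prop) (by fun_prop) h0
    · exact ContinuousAt.div (by fun_prop) (by fun_prop) h0
  · filter_upwards [eventually_ne_z (hA.zeta_ne_z i)] with w hw
    rw [hA.twist_eq σ hw, ratio, ← Finset.mul_prod_erase _ _ hi]
    ring

theorem deriv_twist_ne_zero (i : Fin (2 * N)) : deriv A.twist (A.zeta i) ≠ 0 := by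
  have hi : i ∈ A.idx (A.eps i) := by simp [idx]
  rw [(hA.hasDerivAt_twist hi).deriv]
  refine mul_ne_zero (neg_ne_zero.2 hA.ellInf_ne) (mul_ne_zero (div_ne_zero ?_ ?_)
    (hA.ratio_zeta_ne_zero hi))
  · exact Finset.prod_ne_zero_iff.2 fun j hj => sub_ne_zero.2 fun e =>
      (Finset.ne_of_mem_erase hj) (hA.zeta_injective e).symm
  · exact Finset.prod_ne_zero_iff.2 fun r _ => sub_ne_zero.2 (hA.zeta_ne_z i r)

/-- At a zero of `R_σ` the derivative of `φ = -ℓ^∞ R_σ R_{-σ}` contains the factor `R_{-σ}(ζ_i)`,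
which cancels the one in the numerator. What is left involves the zeros in `I_σ` only. -/
theorem ratio_div_deriv_twist {σ : ℤˣ} {i : Fin (2 * N)} (hi : i ∈ A.idx σ) (s : Fin N) :
    A.ellInf * (A.ratio (-σ) (A.zeta i) * (A.phi σ s (A.z s) / (A.zeta i - A.z s))) /
      deriv A.twist (A.zeta i) = - A.laxRes σ s i := by
  rw [(hA.hasDerivAt_twist hi).deriv, laxRes, ← Finset.mul_prod_erase _ _ (Finset.mem_univ s)]
  have h1 := hA.ratio_zeta_ne_zero hi
  have h2 := hA.ellInf_ne
  have h3 : ∏ t ∈ Finset.univ.erase s, (A.zeta i - (A.z t : ℂ)) ≠ 0 :=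
    Finset.prod_ne_zero_iff.2 fun r _ => sub_ne_zero.2 (hA.zeta_ne_z i r)
  have h4 : A.zeta i - (A.z s : ℂ) ≠ 0 := sub_ne_zero.2 (hA.zeta_ne_z i s)
  have h5 : ∏ j ∈ (A.idx σ).erase i, (A.zeta i - A.zeta j) ≠ 0 :=
    Finset.prod_ne_zero_iff.2 fun j hj => sub_ne_zero.2 fun e =>
      (Finset.ne_of_mem_erase hj) (hA.zeta_injective e).symm
  field_simp

theorem phi_ne_zero (σ : ℤˣ) (r : Fin N) : A.phi σ r (A.z r) ≠ 0 :=
  div_ne_zero (Finset.prod_ne_zero_iff.2 fun i _ => sub_ne_zero.2 (hA.zeta_ne_z i r).symm)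
    (Finset.prod_ne_zero_iff.2 fun _ ht => hA.zC_sub_ne (Finset.ne_of_mem_erase ht).symm)

/-- The coefficients form an interpolation basis at the sites, because the numerator vanishes at
every site except `z_s`. -/
theorem laxCoeff_z (σ : ℤˣ) (s r : Fin N) :
    A.laxCoeff σ s (A.z r) = if r = s then 1 else 0 := by
  rw [laxCoeff_eq_div]
  split_ifs with h
  · rw [h, div_self (hA.phi_ne_zero σ s)]
  · rw [Params.phi, Params.phi, Finset.prod_eq_zero (f := fun t => (A.z r : ℂ) - A.z t) (i := r)
      (s := Finset.univ.erase s) (by simpa using h) (sub_self _), div_zero, div_zero]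

theorem hasDerivAt_laxCoeff (σ : ℤˣ) (s r : Fin N) :
    HasDerivAt (A.laxCoeff σ s) (-∑ i ∈ A.idx σ, A.laxRes σ s i / ((A.z r : ℂ) - A.zeta i) ^ 2)
      (A.z r) := by
  have h : HasDerivAt (fun w => ∑ i ∈ A.idx σ, A.laxRes σ s i / (w - A.zeta i))
      (∑ i ∈ A.idx σ, -(A.laxRes σ s i / ((A.z r : ℂ) - A.zeta i) ^ 2)) (A.z r) := by
    refine HasDerivAt.fun_sum fun i _ => ?_
    have h1 : (A.z r : ℂ) - A.zeta i ≠ 0 := sub_ne_zero.2 (hA.zeta_ne_z i r).symm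
    have := (((hasDerivAt_id (A.z r : ℂ)).sub_const (A.zeta i)).inv h1).const_mul (A.laxRes σ s i)
    refine this.congr_deriv ?_
    simp [div_eq_mul_inv]
  rw [Finset.sum_neg_distrib] at h
  refine h.congr_of_eventuallyEq ?_
  filter_upwards [hA.eventually_zeta_ne r] with w hw using hA.laxCoeff_eq_sum σ s hw

/-- The left-hand side is `ℓ_r` times the derivative of the coefficient at `z_r`. It is found by
differentiating `laxCoeff · φ^{(r)} · (w - z_s) = φ^{(s)}(z_s) (w - z_r)`, with no sum over zeros to
evaluate. This is how `ρ_{rs}` and `k_r` enter the momenta side of the equations of motion. -/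
theorem deriv_laxCoeff (σ : ℤˣ) (s r : Fin N) :
    -(A.ell r : ℂ) * ∑ i ∈ A.idx σ, A.laxRes σ s i / ((A.z r : ℂ) - A.zeta i) ^ 2 =
      2 * (σ : ℤ) * A.rhoT σ s r + if r = s then (A.k r : ℂ) else 0 := by
  have h := hA.hasDerivAt_laxCoeff σ s r
  have hp := hA.hasDerivAt_phi σ r
  rw [← hA.deriv_phi] at hp
  have hs := hA.phi_ne_zero σ r
  rw [(hA.levels_eq r).1, (hA.levels_eq r).2, ellOfZeros_eq σ]
  have hσ : ((σ : ℤ) : ℂ) * (σ : ℤ) = 1 := by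
    rcases Int.units_eq_one_or σ with e | e <;> simp [e]
  have hev : ∀ w : ℂ, w ≠ A.z s → (∀ i, w ≠ A.zeta i) → (∀ t ≠ r, w ≠ A.z t) →
      w ≠ A.z r → A.laxCoeff σ s w * A.phi σ r w * (w - A.z s) = 
        A.phi σ s (A.z s) * (w - A.z r) := by
    intro w hw h1 h2 h3
    have h4 : w - (A.z s : ℂ) ≠ 0 := sub_ne_zero.2 hw
    have := laxCoeff_mul_ratio σ s (w := w) ⟨fun t => if e : t = r then e ▸ h3 else h2 t e, h1⟩
    rw [phi_eq σ r h3, show A.laxCoeff σ s w * ((w - A.z r) * A.ratio σ w) * (w - A.z s) =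
      (A.laxCoeff σ s w * A.ratio σ w) * ((w - A.z r) * (w - A.z s)) by ring, this]
    field_simp
  by_cases e : r = s
  -- On the diagonal the factor `w - z_r` drops out: the product of the coefficient and `φ^{(r)}` is
  -- constant near `z_r`.
  · subst e
    rw [if_pos rfl, rhoT_self, kOfZeros_eq σ]
    have h1 := h.mul hp
    have h2 : HasDerivAt (A.laxCoeff σ r * A.phi σ r) 0 (A.z r) := by
      refine (hasDerivAt_const (A.z r : ℂ) (A.phi σ r (A.z r))).congr_of_eventuallyEq ?_
      filter_upwards [hA.eventually_ne r, hA.eventually_zeta_ne r] with w h3 h4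
      by_cases h5 : w = A.z r
      · simp [h5, hA.laxCoeff_z]
      · have h6 : w - (A.z r : ℂ) ≠ 0 := sub_ne_zero.2 h5
        exact mul_right_cancel₀ h6 (hev w h5 h4 h3 h5)
    have h3 := h1.unique h2
    rw [hA.laxCoeff_z, if_pos rfl] at h3
    linear_combination -A.ellInf * A.phi (-σ) r (A.z r) * h3 - A.ellInf / 2 * (deriv (A.phi σ r)
      (A.z r) * A.phi (-σ) r (A.z r) - A.phi σ r (A.z r) * deriv (A.phi (-σ) r) (A.z r)) * hσ
  · rw [if_neg e, hA.rhoT_of_ne σ (Ne.symm e)]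
    have h0 := hA.zC_sub_ne e
    have h0' := hA.zC_sub_ne (Ne.symm e)
    have h1 := (h.mul hp).mul ((hasDerivAt_id (A.z r : ℂ)).sub_const (A.z s : ℂ))
    have h2 : HasDerivAt (A.laxCoeff σ s * A.phi σ r * fun x : ℂ => id x - (A.z s : ℂ))
        (A.phi σ s (A.z s)) (A.z r : ℂ) := by
      have := ((hasDerivAt_id (A.z r : ℂ)).sub_const (A.z r : ℂ)).const_mul (A.phi σ s (A.z s))
      rw [mul_one] at this
      refine this.congr_of_eventuallyEq ?_
      filter_upwards [hA.eventually_ne r, hA.eventually_zeta_ne r] with w h3 h4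
      by_cases h5 : w = A.z r
      · simp [h5, hA.laxCoeff_z, e]
      · simpa using hev w (h3 s (Ne.symm e)) h4 h3 h5
    have h3 := h1.unique h2
    simp only [Pi.mul_apply, hA.laxCoeff_z, if_neg e, id] at h3
    field_simp
    linear_combination (A.ellInf * A.phi (-σ) r (A.z r)) * h3 -
      (A.ellInf * A.phi (-σ) r (A.z r) * A.phi σ s (A.z s)) * hσ

end Admissible
end Params
end CoupledPCM

/-! ### The Hamiltonian as a quadratic form, and its value on the solved currents -/

namespace CoupledPCM

variable {E G : Type*} [NormedAddCommGroup E] [NormedSpace ℝ E] [FiniteDimensional ℝ E]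
  [TopologicalSpace G] [ChartedSpace E G] [Group G] [LieGroup 𝓘(ℝ, E) ∞ G]

section Complexification

/-- The inclusion of `𝔤₀` in `𝔤`. -/
noncomputable def toCplx : RealAlg E G →ₗ[ℝ] CplxAlg E G := TensorProduct.mk ℝ ℂ (RealAlg E G) 1

omit [FiniteDimensional ℝ E] [LieGroup 𝓘(ℝ, E) ∞ G] in
theorem toCplx_apply (x : RealAlg E G) : toCplx x = (1 : ℂ) ⊗ₜ[ℝ] x := rfl

omit [FiniteDimensional ℝ E] [LieGroup 𝓘(ℝ, E) ∞ G] in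
theorem tmul_eq_smul (c : ℂ) (x : RealAlg E G) : (c ⊗ₜ[ℝ] x : CplxAlg E G) = c • toCplx x := by
  rw [toCplx_apply, TensorProduct.smul_tmul', smul_eq_mul, mul_one]

omit [FiniteDimensional ℝ E] [LieGroup 𝓘(ℝ, E) ∞ G] in
theorem toCplx_smul (a : ℝ) (x : RealAlg E G) : toCplx (a • x) = (a : ℂ) • toCplx x := by
  rw [map_smul]
  exact (algebraMap_smul ℂ a (toCplx x)).symm

theorem kappaC_toCplx (x y : RealAlg E G) :
    kappaC E G (toCplx x) (toCplx y) = (kappa E G x y : ℂ) := by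
  rw [toCplx_apply, toCplx_apply, kappaC_tmul]; simp

theorem kappa_comm (x y : RealAlg E G) : kappa E G x y = kappa E G y x := by
  simp only [kappa, LinearMap.neg_apply]
  rw [killingForm, LieModule.traceForm_comm]

theorem kappaC_comm (x y : CplxAlg E G) : kappaC E G x y = kappaC E G y x := by
  simp only [kappaC, LinearMap.neg_apply]
  rw [killingForm, LieModule.traceForm_comm]

theorem kappa_lie (x y z : RealAlg E G) : kappa E G ⁅x, y⁆ z = kappa E G x ⁅y, z⁆ := by
  simp only [kappa, LinearMap.neg_apply]
  rw [killingForm, LieModule.traceForm_apply_lie_apply]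

end Complexification

section Quadratic

variable {N : ℕ} (A : Params N)

/-- The Gaudin Lax matrix in terms of `j` and of the currents `J_{[0]}`. -/
noncomputable def gaudinAlg (x : (Fin N → RealAlg E G) × (Fin N → RealAlg E G)) (w : ℂ) :
    CplxAlg E G :=
  ∑ r, ((1 / (w - A.z r) ^ 2) ⊗ₜ[ℝ] (A.ell r • x.1 r) + (1 / (w - A.z r)) ⊗ₜ[ℝ] x.2 r)

omit [FiniteDimensional ℝ E] [LieGroup 𝓘(ℝ, E) ∞ G] in
theorem gaudinAlg_eq (x : (Fin N → RealAlg E G) × (Fin N → RealAlg E G)) (w : ℂ) :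
    gaudinAlg A x w = ∑ r, (((A.ell r : ℂ) / (w - A.z r) ^ 2) • toCplx (x.1 r) +
      (1 / (w - A.z r)) • toCplx (x.2 r)) := by
  refine Finset.sum_congr rfl fun r _ => ?_
  rw [tmul_eq_smul, tmul_eq_smul, toCplx_smul, smul_smul]
  congr 2
  ring

omit [FiniteDimensional ℝ E] [LieGroup 𝓘(ℝ, E) ∞ G] in
theorem gaudinAlg_add (x y : (Fin N → RealAlg E G) × (Fin N → RealAlg E G)) (w : ℂ) :
    gaudinAlg A (x + y) w = gaudinAlg A x w + gaudinAlg A y w := by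
  simp only [gaudinAlg_eq, ← Finset.sum_add_distrib]
  refine Finset.sum_congr rfl fun r _ => ?_
  simp only [Prod.fst_add, Prod.snd_add, Pi.add_apply, map_add]
  module

omit [FiniteDimensional ℝ E] [LieGroup 𝓘(ℝ, E) ∞ G] in
theorem gaudinAlg_smul (a : ℝ) (x : (Fin N → RealAlg E G) × (Fin N → RealAlg E G)) (w : ℂ) :
    gaudinAlg A (a • x) w = (a : ℂ) • gaudinAlg A x w := by
  simp only [gaudinAlg_eq, Finset.smul_sum]
  refine Finset.sum_congr rfl fun r _ => ?_
  simp only [Prod.smul_fst, Prod.smul_snd, Pi.smul_apply, toCplx_smul]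
  module

/-- The sign `ε_i` divided by `φ'(ζ_i)`. -/
noncomputable def weight (i : Fin (2 * N)) : ℂ :=
  (((A.eps i : ℤ) : ℝ) : ℂ) / deriv A.twist (A.zeta i)

/-- The polar form of twice the Hamiltonian density. -/
noncomputable def hamPolar : ((Fin N → RealAlg E G) × (Fin N → RealAlg E G)) →ₗ[ℝ]
    ((Fin N → RealAlg E G) × (Fin N → RealAlg E G)) →ₗ[ℝ] ℂ :=
  LinearMap.mk₂ ℝ (fun x y => -∑ i, weight A i *
      kappaC E G (gaudinAlg A x (A.zeta i)) (gaudinAlg A y (A.zeta i)))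
    (fun x y z => by
      simp only [gaudinAlg_add, map_add, LinearMap.add_apply, mul_add, Finset.sum_add_distrib,
        neg_add])
    (fun a x y => by
      simp only [gaudinAlg_smul, map_smul, LinearMap.smul_apply, smul_eq_mul, Complex.real_smul,
        mul_neg, Finset.mul_sum]
      congr 1
      exact Finset.sum_congr rfl fun i _ => by ring)
    (fun x y z => by
      simp only [gaudinAlg_add, map_add, mul_add, Finset.sum_add_distrib, neg_add])
    (fun a x y => by
      simp only [gaudinAlg_smul, map_smul, smul_eq_mul, Complex.real_smul,
        mul_neg, Finset.mul_sum]
      congr 1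
      exact Finset.sum_congr rfl fun i _ => by ring)

theorem hamPolar_apply (x y : (Fin N → RealAlg E G) × (Fin N → RealAlg E G)) :
    hamPolar A x y = -∑ i, weight A i *
      kappaC E G (gaudinAlg A x (A.zeta i)) (gaudinAlg A y (A.zeta i)) := rfl

theorem hamPolar_comm (x y : (Fin N → RealAlg E G) × (Fin N → RealAlg E G)) :
    hamPolar A x y = hamPolar A y x := by
  simp only [hamPolar_apply, kappaC_comm]

/-- The value of `ℳ` at `w`. -/
noncomputable def algM (x : (Fin N → RealAlg E G) × (Fin N → RealAlg E G)) (w : ℂ) :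
    CplxAlg E G :=
  ∑ i, (weight A i / (w - A.zeta i)) • gaudinAlg A x (A.zeta i)

/-- The value of `-ℳ'` at `w`. -/
noncomputable def algM' (x : (Fin N → RealAlg E G) × (Fin N → RealAlg E G)) (w : ℂ) :
    CplxAlg E G :=
  ∑ i, (weight A i / (w - A.zeta i) ^ 2) • gaudinAlg A x (A.zeta i)

/-- Expanding the second Gaudin matrix in its poles turns the sum over zeros into values of `ℳ` and
`-ℳ'` at the sites. The simple pole `1/(ζ_i - z_r)` changes sign when read as a pole in `z_r - ζ_i`
and the double one does not, whence the different signs. In particular `ℳ(z_r)` is the derivative of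
the density with respect to `J_{[0]}` at the site `r`. -/
theorem hamPolar_eq_sum (x y : (Fin N → RealAlg E G) × (Fin N → RealAlg E G)) :
    hamPolar A x y = ∑ r, (kappaC E G (-(A.ell r : ℂ) • algM' A x (A.z r)) (toCplx (y.1 r)) +
      kappaC E G (algM A x (A.z r)) (toCplx (y.2 r))) := by
  rw [hamPolar_apply, ← Finset.sum_neg_distrib]
  simp only [algM, algM', Finset.smul_sum, map_sum, LinearMap.sum_apply, ← Finset.sum_add_distrib]
  rw [Finset.sum_comm]
  refine Finset.sum_congr rfl fun i _ => ?_
  set Γ := gaudinAlg A x (A.zeta i)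
  rw [gaudinAlg_eq, map_sum, Finset.mul_sum, ← Finset.sum_neg_distrib]
  refine Finset.sum_congr rfl fun r _ => ?_
  simp only [map_add, map_smul, smul_eq_mul, smul_smul, LinearMap.smul_apply]
  have h : (A.zeta i - (A.z r : ℂ)) = -(A.z r - A.zeta i) := by ring
  rw [h, neg_sq, div_neg]
  ring

end Quadratic

section Solved

variable {N : ℕ} {A : Params N} (hA : A.Admissible) (cur : ℤˣ → Fin N → RealAlg E G)

variable (A) in
/-- The combination `∑_s ρ_{sr} j_+^{(s)}` (for `σ = 1`) or `∑_s ρ_{rs} j_-^{(s)}`. -/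
noncomputable def couplingSum (σ : ℤˣ) (r : Fin N) : RealAlg E G :=
  ∑ s, (A.rhoT σ s r).re • cur σ s

variable (A) in
/-- The currents `(j, J_{[0]})` in terms of the light-cone currents. -/
noncomputable def solved : (Fin N → RealAlg E G) × (Fin N → RealAlg E G) :=
  (fun r => (1 / 2 : ℝ) • (cur 1 r - cur (-1) r),
    fun r => couplingSum A cur 1 r + couplingSum A cur (-1) r -
      A.k r • ((1 / 2 : ℝ) • (cur 1 r - cur (-1) r)))

include hA

theorem Params.Admissible.rhoT_re (σ : ℤˣ) (s r : Fin N) :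
    ((A.rhoT σ s r).re : ℂ) = A.rhoT σ s r := by
  rw [Params.rhoT]
  split_ifs <;> rw [hA.rho_re]

omit [FiniteDimensional ℝ E] [LieGroup 𝓘(ℝ, E) ∞ G] in
theorem toCplx_couplingSum (σ : ℤˣ) (r : Fin N) :
    toCplx (couplingSum A cur σ r) = ∑ s, A.rhoT σ s r • toCplx (cur σ s) := by
  simp only [couplingSum, map_sum, toCplx_smul, hA.rhoT_re]

omit [FiniteDimensional ℝ E] [LieGroup 𝓘(ℝ, E) ∞ G] in
-- This is `ratio_mul_eq` read from right to left: the poles of the ansatz recombine into one family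
-- with the common factor `R_-` and one with the common factor `R_+`.
theorem gaudinAlg_solved {w : ℂ} (hw : ∀ r, w ≠ A.z r) :
    gaudinAlg A (solved A cur) w =
      -(∑ s, (1 / 2 * (A.ellInf * (A.ratio (-1) w * (A.phi 1 s (A.z s) / (w - A.z s))))) •
        toCplx (cur 1 s)) +
      ∑ s, (1 / 2 * (A.ellInf * (A.ratio 1 w * (A.phi (-1) s (A.z s) / (w - A.z s))))) •
        toCplx (cur (-1) s) := by
  have h1 := fun s => hA.ratio_mul_eq 1 s hw
  have h2 := fun s => hA.ratio_mul_eq (-1) s hw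
  simp only [neg_neg] at h2
  simp only [h1, h2]
  rw [gaudinAlg_eq]
  simp only [solved, map_sub, map_add, toCplx_couplingSum hA, toCplx_smul, smul_sub, smul_add,
    Finset.smul_sum, smul_smul, Finset.sum_add_distrib, Finset.sum_sub_distrib]
  rw [Finset.sum_comm (f := fun r s => (1 / (w - (A.z r : ℂ)) * A.rhoT 1 s r) •
    (toCplx (cur 1 s) : CplxAlg E G)),
    Finset.sum_comm (f := fun r s => (1 / (w - (A.z r : ℂ)) * A.rhoT (-1) s r) •
    (toCplx (cur (-1) s) : CplxAlg E G))]
  simp only [← Finset.sum_smul, ← Finset.sum_add_distrib, ← Finset.sum_sub_distrib,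
    ← Finset.sum_neg_distrib]
  refine Finset.sum_congr rfl fun s _ => ?_
  rw [← (hA.levels_eq s).1, ← (hA.levels_eq s).2]
  have e1 : ∑ r, A.rhoT 1 s r / (w - (A.z r : ℂ)) = ∑ r, 1 / (w - (A.z r : ℂ)) * A.rhoT 1 s r :=
    Finset.sum_congr rfl fun r _ => by ring
  have e2 : ∑ r, A.rhoT (-1) s r / (w - (A.z r : ℂ)) =
      ∑ r, 1 / (w - (A.z r : ℂ)) * A.rhoT (-1) s r :=
    Finset.sum_congr rfl fun r _ => by ring
  rw [e1, e2]
  push_cast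
  module

omit [FiniteDimensional ℝ E] [LieGroup 𝓘(ℝ, E) ∞ G] in
-- The vanishing of `R_σ` at `ζ_i` removes the currents of the opposite chirality, and the sign `ε_i
-- = σ` compensates the relative sign of the two families in `gaudinAlg_solved`.
theorem weight_smul_gaudinAlg {σ : ℤˣ} {i : Fin (2 * N)} (hi : i ∈ A.idx σ) :
    weight A i • gaudinAlg A (solved A cur) (A.zeta i) =
      (1 / 2 : ℂ) • ∑ s, A.laxRes σ s i • toCplx (cur σ s) := by
  have hε : A.eps i = σ := by simpa [Params.idx] using hi
  have h := fun s => hA.ratio_div_deriv_twist hi s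
  have h0 := hA.deriv_twist_ne_zero i
  have hz := Params.ratio_zeta hi
  rw [gaudinAlg_solved hA cur (hA.zeta_ne_z i), weight, hε]
  have h' : ∀ s, A.ellInf * (A.ratio (-σ) (A.zeta i) *
      (A.phi σ s (A.z s) / (A.zeta i - A.z s))) = - A.laxRes σ s i * deriv A.twist (A.zeta i) :=
    fun s => by rw [← h s, div_mul_cancel₀ _ h0]
  rcases Int.units_eq_one_or σ with e | e
  · subst e
    simp only [hz, h', zero_mul, mul_zero, zero_smul, Finset.sum_const_zero, add_zero,
      Finset.smul_sum, smul_neg, smul_smul, ← Finset.sum_neg_distrib]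
    refine Finset.sum_congr rfl fun s _ => ?_
    rw [← neg_smul]
    congr 1
    field_simp
    push_cast
    ring
  · subst e
    simp only [neg_neg] at h'
    simp only [hz, h', zero_mul, mul_zero, zero_smul, Finset.sum_const_zero, neg_zero, zero_add,
      Finset.smul_sum, smul_smul]
    refine Finset.sum_congr rfl fun s _ => ?_
    congr 1
    field_simp
    push_cast
    ring

omit [FiniteDimensional ℝ E] [LieGroup 𝓘(ℝ, E) ∞ G] in
-- The denominators are left arbitrary so that the same splitting by chirality applies to `ℳ`, with
-- `g i = w - ζ_i`, and to `-ℳ'`, with its square.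
theorem sum_weight_smul (g : Fin (2 * N) → ℂ) :
    ∑ i, (weight A i / g i) • gaudinAlg A (solved A cur) (A.zeta i) =
      (1 / 2 : ℂ) • ((∑ s, (∑ i ∈ A.idx 1, A.laxRes 1 s i / g i) • toCplx (cur 1 s)) +
        ∑ s, (∑ i ∈ A.idx (-1), A.laxRes (-1) s i / g i) • toCplx (cur (-1) s)) := by
  have key : ∀ σ : ℤˣ, ∑ i ∈ A.idx σ, (weight A i / g i) • gaudinAlg A (solved A cur) (A.zeta i) =
      (1 / 2 : ℂ) • (∑ s, (∑ i ∈ A.idx σ, A.laxRes σ s i / g i) • toCplx (cur σ s)) := by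
    intro σ
    simp only [Finset.sum_smul]
    rw [Finset.sum_comm, Finset.smul_sum]
    refine Finset.sum_congr rfl fun i hi => ?_
    rw [div_eq_inv_mul, ← smul_smul, weight_smul_gaudinAlg hA cur hi, smul_comm, Finset.smul_sum]
    congr 1
    refine Finset.sum_congr rfl fun s _ => ?_
    rw [smul_smul, div_eq_inv_mul]
  rw [← A.idx_union 1, Finset.sum_union (A.disjoint_idx 1), key, key, smul_add]

omit [FiniteDimensional ℝ E] [LieGroup 𝓘(ℝ, E) ∞ G] in
theorem algM_solved {w : ℂ} (hw : ∀ i, w ≠ A.zeta i) :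
    algM A (solved A cur) w =
      (1 / 2 : ℂ) • ((∑ s, A.laxCoeff 1 s w • toCplx (cur 1 s)) +
        ∑ s, A.laxCoeff (-1) s w • toCplx (cur (-1) s)) := by
  simp only [algM, sum_weight_smul hA, hA.laxCoeff_eq_sum _ _ hw]

omit [FiniteDimensional ℝ E] [LieGroup 𝓘(ℝ, E) ∞ G] in
-- By the interpolation property `laxCoeff_z`, only the currents of the site `r` contribute. For
-- light-cone currents the right-hand side is `g⁻¹ ∂_t g`, so this is the velocity relation in
-- disguise.
theorem algM_solved_z (r : Fin N) :
    algM A (solved A cur) (A.z r) = toCplx ((1 / 2 : ℝ) • (cur 1 r + cur (-1) r)) := by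
  rw [algM_solved hA cur fun i => (hA.zeta_ne_z i r).symm]
  simp only [hA.laxCoeff_z, ite_smul, one_smul, zero_smul, Finset.sum_ite_eq, Finset.mem_univ,
    if_true, toCplx_smul, map_add]
  push_cast
  rfl

omit [FiniteDimensional ℝ E] [LieGroup 𝓘(ℝ, E) ∞ G] in
theorem algM'_solved_z (r : Fin N) :
    -(A.ell r : ℂ) • algM' A (solved A cur) (A.z r) =
      toCplx (couplingSum A cur 1 r - couplingSum A cur (-1) r +
        A.k r • ((1 / 2 : ℝ) • (cur 1 r + cur (-1) r))) := by
  simp only [algM', sum_weight_smul hA, map_sub, map_add, toCplx_couplingSum hA, toCplx_smul]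
  rw [smul_comm, smul_add]
  simp only [Finset.smul_sum, smul_smul, hA.deriv_laxCoeff, add_smul, ite_smul, zero_smul,
    Finset.sum_add_distrib, Finset.sum_ite_eq, Finset.mem_univ, if_true, smul_add]
  simp only [← smul_smul, ← Finset.smul_sum]
  push_cast
  module

theorem hamPolar_solved (y : (Fin N → RealAlg E G) × (Fin N → RealAlg E G)) :
    hamPolar A (solved A cur) y = ((∑ r, (kappa E G (couplingSum A cur 1 r -
      couplingSum A cur (-1) r + A.k r • ((1 / 2 : ℝ) • (cur 1 r + cur (-1) r))) (y.1 r) +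
      kappa E G ((1 / 2 : ℝ) • (cur 1 r + cur (-1) r)) (y.2 r)) : ℝ) : ℂ) := by
  rw [hamPolar_eq_sum]
  push_cast
  simp only [algM'_solved_z hA, algM_solved_z hA, kappaC_toCplx]

/-- The energy density in terms of the light-cone currents. -/
theorem hamPolar_solved_self :
    (1 / 2 : ℂ) * hamPolar A (solved A cur) (solved A cur) =
      (((1 / 2 : ℝ) * ∑ r, (kappa E G (couplingSum A cur 1 r) (cur 1 r) +
        kappa E G (couplingSum A cur (-1) r) (cur (-1) r)) : ℝ) : ℂ) := by
  rw [hamPolar_solved hA]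
  push_cast
  congr 1
  refine Finset.sum_congr rfl fun r _ => ?_
  norm_cast
  simp only [solved]
  set a := cur 1 r
  set b := cur (-1) r
  set p := couplingSum A cur 1 r
  set m := couplingSum A cur (-1) r
  simp only [map_add, map_sub, map_smul, LinearMap.add_apply, LinearMap.sub_apply,
    LinearMap.smul_apply, smul_eq_mul]
  rw [kappa_comm a p, kappa_comm a m, kappa_comm b p, kappa_comm b m]
  ring

end Solved

end CoupledPCM

/-! ### The left-invariant form in a chart and the Maurer-Cartan equation -/

namespace CoupledPCM

section LeftForm

variable {E G : Type*} [NormedAddCommGroup E] [NormedSpace ℝ E]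
  [TopologicalSpace G] [ChartedSpace E G] [Group G]

/-- The left-invariant form with values in the model space of `G₀`. -/
noncomputable def leftFormE (c : OpenPartialHomeomorph G E) (q : E) : E →L[ℝ] E :=
  mfderiv 𝓘(ℝ, E) 𝓘(ℝ, E) (fun q' : E => (c.symm q)⁻¹ * c.symm q') q

/-- The differential at `h` of the left translation by `g`. -/
noncomputable def leftMulDeriv (g h : G) : E →L[ℝ] E :=
  mfderiv 𝓘(ℝ, E) 𝓘(ℝ, E) (fun x : G => g * x) h

/-- The differential at `q` of the inverse of a coordinate chart. -/
noncomputable def symmDeriv (c : OpenPartialHomeomorph G E) (q : E) : E →L[ℝ] E :=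
  mfderiv 𝓘(ℝ, E) 𝓘(ℝ, E) c.symm q

variable [LieGroup 𝓘(ℝ, E) ∞ G]

theorem isManifold_of_lieGroup : IsManifold 𝓘(ℝ, E) ∞ G :=
  (inferInstance : ContMDiffMul 𝓘(ℝ, E) ∞ G).toIsManifold

theorem mdifferentiableAt_mul_left (g h : G) :
    MDifferentiableAt 𝓘(ℝ, E) 𝓘(ℝ, E) (fun x : G => g * x) h :=
  (contMDiff_mul_left (I := 𝓘(ℝ, E)) (n := ∞)).contMDiffAt.mdifferentiableAt (by simp)

theorem leftMulDeriv_comp (g h k : G) :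
    (leftMulDeriv g (h * k) : E →L[ℝ] E).comp (leftMulDeriv h k) = leftMulDeriv (g * h) k := by
  have := mfderiv_comp (I := 𝓘(ℝ, E)) (I' := 𝓘(ℝ, E)) (I'' := 𝓘(ℝ, E)) (f := fun x : G => h * x)
    (g := fun x : G => g * x) k
    (mdifferentiableAt_mul_left g (h * k)) (mdifferentiableAt_mul_left h k)
  have e : (fun x : G => g * x) ∘ (fun x : G => h * x) = fun x => g * h * x := by
    ext x; simp [mul_assoc]
  rw [e] at this
  exact this.symm

omit [LieGroup 𝓘(ℝ, E) ∞ G] in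
theorem leftMulDeriv_one (k : G) :
    (leftMulDeriv 1 k : E →L[ℝ] E) = ContinuousLinearMap.id ℝ E := by
  have : (fun x : G => 1 * x) = id := by ext; simp
  rw [leftMulDeriv, this]
  exact mfderiv_id

variable {c : OpenPartialHomeomorph G E} (hc : c ∈ IsManifold.maximalAtlas 𝓘(ℝ, E) ∞ G)
  {q : E} (hq : q ∈ c.target)
include hc hq

omit [Group G] [LieGroup 𝓘(ℝ, E) ∞ G] in
theorem contMDiffAt_symm : ContMDiffAt 𝓘(ℝ, E) 𝓘(ℝ, E) ∞ c.symm q :=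
  contMDiffAt_symm_of_mem_maximalAtlas hc hq

omit [Group G] [LieGroup 𝓘(ℝ, E) ∞ G] in
theorem mdifferentiableAt_symm : MDifferentiableAt 𝓘(ℝ, E) 𝓘(ℝ, E) c.symm q :=
  (contMDiffAt_symm hc hq).mdifferentiableAt (by simp)

theorem leftFormE_eq :
    leftFormE c q = (leftMulDeriv (c.symm q)⁻¹ (c.symm q)).comp (symmDeriv c q) :=
  mfderiv_comp (I := 𝓘(ℝ, E)) (I' := 𝓘(ℝ, E)) (I'' := 𝓘(ℝ, E)) (f := c.symm)
    (g := fun x : G => (c.symm q)⁻¹ * x) q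
    (mdifferentiableAt_mul_left _ _) (mdifferentiableAt_symm hc hq)

omit [Group G] [LieGroup 𝓘(ℝ, E) ∞ G] in
theorem isInvertible_symmDeriv : (symmDeriv c q).IsInvertible := by
  have hs : c.symm q ∈ c.source := c.map_target hq
  have h1 : MDifferentiableAt 𝓘(ℝ, E) 𝓘(ℝ, E) c (c.symm q) :=
    (contMDiffAt_of_mem_maximalAtlas hc hs).mdifferentiableAt (by simp)
  have h2 := mdifferentiableAt_symm hc hq
  have h1' : MDifferentiableAt 𝓘(ℝ, E) 𝓘(ℝ, E) c.symm (c (c.symm q)) := by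
    rwa [c.right_inv hq]
  have e1 := mfderiv_comp (I := 𝓘(ℝ, E)) (I' := 𝓘(ℝ, E)) (I'' := 𝓘(ℝ, E)) (f := c.symm)
    (g := c) q h1 h2
  have e2 := mfderiv_comp (I := 𝓘(ℝ, E)) (I' := 𝓘(ℝ, E)) (I'' := 𝓘(ℝ, E)) (f := c)
    (g := c.symm) (c.symm q) h1' h1
  have f1 : mfderiv 𝓘(ℝ, E) 𝓘(ℝ, E) (c ∘ c.symm) q = ContinuousLinearMap.id ℝ E := by
    rw [Filter.EventuallyEq.mfderiv_eq (f := id) (f₁ := c ∘ c.symm)]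
    · exact mfderiv_id
    · filter_upwards [c.open_target.mem_nhds hq] with x hx using c.right_inv hx
  have f2 : mfderiv 𝓘(ℝ, E) 𝓘(ℝ, E) (c.symm ∘ c) (c.symm q) = ContinuousLinearMap.id ℝ E := by
    rw [Filter.EventuallyEq.mfderiv_eq (f := id) (f₁ := c.symm ∘ c)]
    · exact mfderiv_id
    · filter_upwards [c.open_source.mem_nhds hs] with x hx using c.left_inv hx
  rw [f1] at e1
  rw [f2, c.right_inv hq] at e2
  exact ContinuousLinearMap.IsInvertible.of_inverse (f := symmDeriv c q)
    (g := (mfderiv 𝓘(ℝ, E) 𝓘(ℝ, E) c (c.symm q) : E →L[ℝ] E)) e2.symm e1.symm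

/-- The form is the derivative of the inverse chart followed by that of the left translation by
`g⁻¹`; the latter is inverted by the translation by `g`. -/
theorem isInvertible_leftFormE : (leftFormE c q).IsInvertible := by
  rw [leftFormE_eq hc hq]
  refine ContinuousLinearMap.IsInvertible.comp ?_ (isInvertible_symmDeriv hc hq)
  refine ContinuousLinearMap.IsInvertible.of_inverse (g := leftMulDeriv (c.symm q) 1) ?_ ?_
  · have := leftMulDeriv_comp (E := E) (c.symm q)⁻¹ (c.symm q) 1
    rwa [mul_one, inv_mul_cancel, leftMulDeriv_one] at this
  · have := leftMulDeriv_comp (E := E) (c.symm q) (c.symm q)⁻¹ (c.symm q)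
    rwa [inv_mul_cancel, mul_inv_cancel, leftMulDeriv_one] at this

/-- The translation being differentiated itself depends on the point. The form is therefore seen as
the partial derivative in `b`, at `b = a`, of the jointly smooth `F a b`, the element `g(a)⁻¹ g(b)`
read in the chart at `1`. On the diagonal this element is `1`, so a single chart suffices for all
`a`. -/
theorem contDiffAt_leftFormE : ContDiffAt ℝ ∞ (leftFormE c) q := by
  have := isManifold_of_lieGroup (E := E) (G := G)
  set F : E → E → E := fun a b => extChartAt 𝓘(ℝ, E) (1 : G) ((c.symm a)⁻¹ * c.symm b) with hF
  have h1 : leftFormE c =ᶠ[𝓝 q] fun a => fderiv ℝ (F a) a := by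
    filter_upwards [c.open_target.mem_nhds hq] with a ha
    have hd : MDifferentiableAt 𝓘(ℝ, E) 𝓘(ℝ, E) (fun b : E => (c.symm a)⁻¹ * c.symm b) a :=
      (mdifferentiableAt_mul_left (c.symm a)⁻¹ (c.symm a)).comp a (mdifferentiableAt_symm hc ha)
    rw [leftFormE, hd.mfderiv]
    simp only [mfld_simps, writtenInExtChartAt, inv_mul_cancel, fderivWithin_univ, hF]
    rfl
  refine ContDiffAt.congr_of_eventuallyEq ?_ h1
  refine ContDiffAt.fderiv (n := ∞) (m := ∞) ?_ contDiffAt_id (by simp)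
  rw [← contMDiffAt_iff_contDiffAt]
  have hs := contMDiffAt_symm hc hq
  have a1 : ContMDiffAt 𝓘(ℝ, E × E) 𝓘(ℝ, E) ∞ (fun p : E × E => c.symm p.1) (q, q) :=
    ContMDiffAt.comp (q, q) (g := c.symm) (f := fun p : E × E => p.1) hs
      contDiff_fst.contMDiff.contMDiffAt
  have a2 : ContMDiffAt 𝓘(ℝ, E × E) 𝓘(ℝ, E) ∞ (fun p : E × E => c.symm p.2) (q, q) :=
    ContMDiffAt.comp (q, q) (g := c.symm) (f := fun p : E × E => p.2) hs
      contDiff_snd.contMDiff.contMDiffAt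
  have a3 := a1.inv.mul a2
  have a4 : ContMDiffAt 𝓘(ℝ, E) 𝓘(ℝ, E) ∞ (extChartAt 𝓘(ℝ, E) (1 : G))
      ((c.symm q)⁻¹ * c.symm q) := by
    rw [inv_mul_cancel]; exact contMDiffAt_extChartAt
  exact ContMDiffAt.comp (q, q) (g := extChartAt 𝓘(ℝ, E) (1 : G))
    (f := fun p : E × E => (c.symm p.1)⁻¹ * c.symm p.2) a4 a3

end LeftForm

section MaurerCartan

variable {E G : Type*} [NormedAddCommGroup E] [NormedSpace ℝ E] [FiniteDimensional ℝ E]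
  [TopologicalSpace G] [ChartedSpace E G] [Group G] [LieGroup 𝓘(ℝ, E) ∞ G]

/-- The identification of the model space with the Lie algebra. -/
def ofModel : E →ₗ[ℝ] RealAlg E G where
  toFun x := x
  map_add' _ _ := rfl
  map_smul' _ _ := rfl

omit [FiniteDimensional ℝ E] [LieGroup 𝓘(ℝ, E) ∞ G] in
theorem ofModel_surjective : Function.Surjective (ofModel : E → RealAlg E G) :=
  fun x => ⟨x, rfl⟩

omit [FiniteDimensional ℝ E] [LieGroup 𝓘(ℝ, E) ∞ G] in
theorem leftForm_apply (c : OpenPartialHomeomorph G E) (q u : E) :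
    leftForm c q u = ofModel (leftFormE c q u) := rfl

/-- The pullback to a chart of the left-invariant vector field with value `X` at the identity. -/
noncomputable def chartField (c : OpenPartialHomeomorph G E) (X : RealAlg E G) (q : E) : E :=
  VectorField.mpullback 𝓘(ℝ, E) 𝓘(ℝ, E) c.symm (mulInvariantVectorField X) q

variable {c : OpenPartialHomeomorph G E} (hc : c ∈ IsManifold.maximalAtlas 𝓘(ℝ, E) ∞ G)
  {q : E} (hq : q ∈ c.target)
include hc hq

omit [FiniteDimensional ℝ E] in
theorem leftFormE_chartField (X : E) :
    leftFormE c q (chartField (G := G) c (ofModel X) q) = X := by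
  have h1 : chartField (G := G) c (ofModel X) q = (symmDeriv c q).inverse
      ((leftMulDeriv (c.symm q) (1 : G) : E →L[ℝ] E) X) := by
    rfl
  obtain ⟨e, he⟩ := isInvertible_symmDeriv hc hq
  have h3 := leftMulDeriv_comp (E := E) (c.symm q)⁻¹ (c.symm q) 1
  rw [mul_one, inv_mul_cancel, leftMulDeriv_one] at h3
  rw [h1, leftFormE_eq hc hq, ← he, ContinuousLinearMap.inverse_equiv]
  simp only [ContinuousLinearMap.comp_apply, ContinuousLinearEquiv.coe_coe,
    ContinuousLinearEquiv.apply_symm_apply]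
  exact congrArg (fun f : E →L[ℝ] E => f X) h3

omit [FiniteDimensional ℝ E] in
theorem chartField_eq (X : E) :
    chartField (G := G) c (ofModel X) q = (leftFormE c q).inverse X := by
  rw [eq_comm, (isInvertible_leftFormE hc hq).inverse_apply_eq, leftFormE_chartField hc hq]

theorem differentiableAt_chartField (X : E) :
    DifferentiableAt ℝ (chartField (G := G) c (ofModel X)) q := by
  have h1 : chartField (G := G) c (ofModel X) =ᶠ[𝓝 q] fun a => (leftFormE c a).inverse X := by
    filter_upwards [c.open_target.mem_nhds hq] with a ha using chartField_eq hc ha X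
  refine DifferentiableAt.congr_of_eventuallyEq ?_ h1
  obtain ⟨e, he⟩ := isInvertible_leftFormE hc hq
  have h2 : ContDiffAt ℝ 1 ContinuousLinearMap.inverse (leftFormE c q) := by
    rw [← he]; exact contDiffAt_map_inverse e
  have h3 := (h2.differentiableAt (by simp)).comp q
    ((contDiffAt_leftFormE hc hq).differentiableAt (by simp))
  exact h3.clm_apply (differentiableAt_const _)

/-- Pull-back by the inverse chart commutes with brackets of vector fields, the bracket of `𝔤₀` is
that of left-invariant fields, and in the model space the bracket is the usual difference of
derivatives. -/
theorem lieBracket_chartField (X Y : RealAlg E G) :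
    chartField c ⁅X, Y⁆ q = fderiv ℝ (chartField c Y) q (chartField c X q) -
      fderiv ℝ (chartField c X) q (chartField c Y q) := by
  have : CompleteSpace E := FiniteDimensional.complete ℝ E
  have := isManifold_of_lieGroup (E := E) (G := G)
  have : IsManifold 𝓘(ℝ, E) (minSmoothness ℝ 3) G :=
    (inferInstance : ContMDiffMul 𝓘(ℝ, E) (minSmoothness ℝ 3) G).toIsManifold
  have h := VectorField.mpullback_mlieBracket (I := 𝓘(ℝ, E)) (I' := 𝓘(ℝ, E)) (f := c.symm)
    (V := mulInvariantVectorField X) (W := mulInvariantVectorField Y) (x₀ := q) (n := ∞)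
    (mdifferentiableAt_mulInvariantVectorField X) (mdifferentiableAt_mulInvariantVectorField Y)
    (contMDiffAt_symm hc hq) (by
      rw [minSmoothness_of_isRCLikeNormedField]; exact ENat.LEInfty.out)
  rw [← mulInvariantVector_mlieBracket] at h
  have h2 := VectorField.mlieBracketWithin_eq_lieBracketWithin (s := Set.univ)
    (V := VectorField.mpullback 𝓘(ℝ, E) 𝓘(ℝ, E) c.symm (mulInvariantVectorField X))
    (W := VectorField.mpullback 𝓘(ℝ, E) 𝓘(ℝ, E) c.symm (mulInvariantVectorField Y))
  have h4 := congrFun (VectorField.lieBracketWithin_univ (𝕜 := ℝ) (V := chartField c X)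
    (W := chartField c Y)) q
  exact h.trans ((congrFun VectorField.mlieBracketWithin_univ.symm q).trans
    ((congrFun h2 q).trans h4))

/-- The Maurer-Cartan equation. -/
theorem maurerCartan (u v : E) :
    (ofModel (fderiv ℝ (leftFormE c) q u v - fderiv ℝ (leftFormE c) q v u) : RealAlg E G) =
      -⁅leftForm c q u, leftForm c q v⁆ := by
  -- The left-invariant form takes the constant value `X` on the left-invariant field of `X`;
  -- differentiating this trades derivatives of the form for derivatives of the fields, which the
  -- bracket formula controls.
  have hd : ∀ X w : E, fderiv ℝ (leftFormE c) q w (chartField (G := G) c (ofModel X) q) +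
      leftFormE c q (fderiv ℝ (chartField (G := G) c (ofModel X)) q w) = 0 := by
    intro X w
    have h1 := (((contDiffAt_leftFormE hc hq).differentiableAt (by simp)).hasFDerivAt).clm_apply
      (differentiableAt_chartField hc hq X).hasFDerivAt
    have h2 : HasFDerivAt (fun a => leftFormE c a (chartField (G := G) c (ofModel X) a))
        (0 : E →L[ℝ] E) q := by
      refine (hasFDerivAt_const (𝕜 := ℝ) X q).congr_of_eventuallyEq ?_
      filter_upwards [c.open_target.mem_nhds hq] with a ha using leftFormE_chartField hc ha X
    have h3 := congrArg (fun f : E →L[ℝ] E => f w) (h1.unique h2)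
    simpa [add_comm] using h3
  have hinv : ∀ w : E, chartField (G := G) c (leftForm c q w) q = w := by
    intro w
    rw [leftForm_apply, chartField_eq hc hq, (isInvertible_leftFormE hc hq).inverse_apply_eq]
  have h1 := hd (leftFormE c q u) v
  have h2 := hd (leftFormE c q v) u
  have h3 := congrArg (leftFormE c q) (lieBracket_chartField hc hq
    (leftForm c q u) (leftForm c q v))
  obtain ⟨Z, hZ⟩ := ofModel_surjective ⁅leftForm c q u, leftForm c q v⁆
  rw [← leftForm_apply, hinv] at h1 h2
  rw [← hZ, leftFormE_chartField hc hq, hinv, hinv, map_sub,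
    eq_neg_of_add_eq_zero_right h1, eq_neg_of_add_eq_zero_right h2] at h3
  rw [← hZ, ← map_neg, h3]
  congr 1
  abel

end MaurerCartan
end CoupledPCM

/-! ### Legendre transform: momenta from velocities, uniqueness, Lagrangian density -/

namespace CoupledPCM

variable {E G : Type*} [NormedAddCommGroup E] [NormedSpace ℝ E] [FiniteDimensional ℝ E]
  [TopologicalSpace G] [ChartedSpace E G] [Group G] [LieGroup 𝓘(ℝ, E) ∞ G]

theorem Patch.isInvertible_leftForm (P : Patch E G) {q : E} (hq : q ∈ P.c.target) :
    (leftForm P.c q).IsInvertible :=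
  isInvertible_leftFormE P.mem_atlas hq

theorem Patch.surjective_leftForm (P : Patch E G) {q : E} (hq : q ∈ P.c.target) :
    Function.Surjective (leftForm P.c q) := by
  obtain ⟨e, he⟩ := P.isInvertible_leftForm hq
  rw [← he]
  exact e.surjective

variable [LieAlgebra.IsSimple ℂ (CplxAlg E G)]

theorem Patch.toAlg_add (P : Patch E G) (q : E) (α β : E →L[ℝ] ℝ) :
    P.toAlg q (α + β) = P.toAlg q α + P.toAlg q β := by
  simp only [Patch.toAlg, ← map_add]
  rfl

theorem Patch.toAlg_smul (P : Patch E G) (q : E) (a : ℝ) (α : E →L[ℝ] ℝ) :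
    P.toAlg q (a • α) = a • P.toAlg q α := by
  simp only [Patch.toAlg, ← map_smul]
  rfl

theorem Patch.toAlg_sub (P : Patch E G) (q : E) (α β : E →L[ℝ] ℝ) :
    P.toAlg q (α - β) = P.toAlg q α - P.toAlg q β := by
  simp only [Patch.toAlg, ← map_sub]
  rfl

theorem eq_of_forall_kappa {x y : RealAlg E G} (h : ∀ z, kappa E G x z = kappa E G y z) :
    x = y := by
  rw [← sub_eq_zero]
  refine (kappa_nondegenerate E G).1 _ fun z => ?_
  rw [map_sub, LinearMap.sub_apply, h, sub_self]

theorem Patch.toAlg_eq (P : Patch E G) {q : E} (hq : q ∈ P.c.target) {α : E →L[ℝ] ℝ}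
    {y : RealAlg E G} (h : ∀ u, α u = kappa E G y (leftForm P.c q u)) : P.toAlg q α = y := by
  refine eq_of_forall_kappa fun z => ?_
  obtain ⟨u, rfl⟩ := P.surjective_leftForm hq z
  rw [P.kappa_toAlg q α (P.isInvertible_leftForm hq), h]

section Ham

variable {N : ℕ} {A : Params N} (hA : A.Admissible) (P : Fin N → Patch E G)
  (q q' : Fin N → E) (p : Fin N → (E →L[ℝ] ℝ))

variable (A) in
/-- The currents `(j, J_{[0]})` of a point of phase space. -/
noncomputable def phaseCurrents : (Fin N → RealAlg E G) × (Fin N → RealAlg E G) :=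
  (fun r => leftForm (P r).c (q r) (q' r), takiffZero A P q q' p)

theorem gaudin_eq (w : ℂ) : gaudin A P q q' p w = gaudinAlg A (phaseCurrents A P q q' p) w := rfl

omit [LieAlgebra.IsSimple ℂ (CplxAlg E G)] in
theorem continuousAt_kappaC_gaudinAlg (x : (Fin N → RealAlg E G) × (Fin N → RealAlg E G)) {w : ℂ}
    (hw : ∀ r, w ≠ A.z r) :
    ContinuousAt (fun w => kappaC E G (gaudinAlg A x w) (gaudinAlg A x w)) w := by
  have h : ∀ r, w - (A.z r : ℂ) ≠ 0 := fun r => sub_ne_zero.2 (hw r)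
  have c1 : ∀ r, ContinuousAt (fun w : ℂ => (A.ell r : ℂ) / (w - A.z r) ^ 2) w := fun r =>
    ContinuousAt.div (by fun_prop) (by fun_prop) (pow_ne_zero _ (h r))
  have c2 : ∀ r, ContinuousAt (fun w : ℂ => 1 / (w - A.z r)) w := fun r =>
    ContinuousAt.div (by fun_prop) (by fun_prop) (h r)
  simp only [gaudinAlg_eq, map_sum, map_add, map_smul, LinearMap.sum_apply, LinearMap.add_apply,
    LinearMap.smul_apply, smul_eq_mul]
  refine tendsto_finsetSum _ fun r _ => ?_
  refine ContinuousAt.add (ContinuousAt.mul (c1 r) ?_) (ContinuousAt.mul (c2 r) ?_) <;>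
  · refine tendsto_finsetSum _ fun s _ => ?_
    exact ContinuousAt.add (ContinuousAt.mul (c1 s) continuousAt_const)
      (ContinuousAt.mul (c2 s) continuousAt_const)

include hA

/-- The zero `ζ_i` of `φ` is simple, so `(w - ζ_i)/φ(w)` tends to `1/φ'(ζ_i)`, while `κ(Γ, Γ)` is
continuous there. -/
theorem simpleResidue_quadDensity (i : Fin (2 * N)) :
    simpleResidue (quadDensity A P q q' p) (A.zeta i) =
      -(1 / (2 * deriv A.twist (A.zeta i))) *
        kappaC E G (gaudin A P q q' p (A.zeta i)) (gaudin A P q q' p (A.zeta i)) := by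
  refine Filter.Tendsto.limUnder_eq ?_
  have hi : i ∈ A.idx (A.eps i) := by simp [Params.idx]
  have h0 := hA.deriv_twist_ne_zero i
  have hd := (hA.hasDerivAt_twist hi).differentiableAt.hasDerivAt
  have h1 := (hasDerivAt_iff_tendsto_slope.1 hd).inv₀ h0
  have h2 := (continuousAt_kappaC_gaudinAlg (phaseCurrents A P q q' p)
    (hA.zeta_ne_z i)).tendsto.mono_left (nhdsWithin_le_nhds (s := {A.zeta i}ᶜ))
  have h3 := (h1.mul h2).const_mul (-(1 / 2) : ℂ)
  refine (h3.congr' ?_).trans_eq ?_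
  · filter_upwards [self_mem_nhdsWithin] with w hw
    rw [slope_def_field, hA.twist_zeta, sub_zero, quadDensity, gaudin_eq, inv_div]
    simp only [one_div, mul_inv]
    ring
  · simp only [gaudin_eq, one_div, mul_inv]
    congr 1
    ring

theorem ham_eq : ham A P q q' p =
    (1 / 2 : ℂ) * hamPolar A (phaseCurrents A P q q' p) (phaseCurrents A P q q' p) := by
  rw [ham, hamPolar_apply, ← Finset.sum_neg_distrib, Finset.mul_sum]
  refine Finset.sum_congr rfl fun i _ => ?_
  rw [simpleResidue_quadDensity hA, gaudin_eq, weight]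
  have := hA.deriv_twist_ne_zero i
  field_simp

omit hA in
theorem phaseCurrents_add_smul (t : ℝ) (δ : Fin N → (E →L[ℝ] ℝ)) :
    phaseCurrents A P q q' (p + t • δ) = phaseCurrents A P q q' p +
      t • ((0 : Fin N → RealAlg E G), fun r => (P r).toAlg (q r) (δ r)) := by
  refine Prod.ext ?_ ?_
  · simp [phaseCurrents]
  · funext r
    simp only [phaseCurrents, takiffZero, Pi.add_apply, Pi.smul_apply, Patch.toAlg_add,
      Patch.toAlg_smul, Prod.snd_add, Prod.smul_snd]
    abel

/-- Momenta enter only `J_{[0]}`, and affinely, so along a line the density is a polynomial of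
degree at most two in `t` whose linear coefficient is the polar form. -/
theorem hasLineDerivAt_ham (δ : Fin N → (E →L[ℝ] ℝ)) :
    HasLineDerivAt ℝ (fun p' => ham A P q q' p') (hamPolar A (phaseCurrents A P q q' p)
      ((0 : Fin N → RealAlg E G), fun r => (P r).toAlg (q r) (δ r))) p δ := by
  set x := phaseCurrents A P q q' p with hx
  set d : (Fin N → RealAlg E G) × (Fin N → RealAlg E G) :=
    ((0 : Fin N → RealAlg E G), fun r => (P r).toAlg (q r) (δ r)) with hd
  have h : ∀ t : ℝ, ham A P q q' (p + t • δ) = (1 / 2 : ℂ) * hamPolar A x x +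
      (t : ℂ) * hamPolar A x d + (t : ℂ) ^ 2 * ((1 / 2 : ℂ) * hamPolar A d d) := by
    intro t
    rw [ham_eq hA, phaseCurrents_add_smul, ← hx, ← hd]
    simp only [map_add, LinearMap.add_apply, map_smul, LinearMap.smul_apply, Complex.real_smul]
    rw [hamPolar_comm A d x]
    ring
  unfold HasLineDerivAt
  simp only [h]
  have ht : HasDerivAt (fun t : ℝ => (t : ℂ)) 1 0 := Complex.ofRealCLM.hasDerivAt
  have h2 := ((hasDerivAt_const (0 : ℝ) ((1 / 2 : ℂ) * hamPolar A x x)).add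
    (ht.mul_const (hamPolar A x d))).add ((ht.pow 2).mul_const ((1 / 2 : ℂ) * hamPolar A d d))
  refine h2.congr_deriv ?_
  simp

theorem velocityEq_iff (v : Fin N → E) : VelocityEq A P q q' p v ↔
    ∀ δ : Fin N → (E →L[ℝ] ℝ), hamPolar A (phaseCurrents A P q q' p)
      ((0 : Fin N → RealAlg E G), fun r => (P r).toAlg (q r) (δ r)) =
      ((∑ r, δ r (v r) : ℝ) : ℂ) := by
  refine forall_congr' fun δ => ⟨fun h => ?_, fun h => ?_⟩
  · exact HasDerivAt.unique (hasLineDerivAt_ham hA P q q' p δ) h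
  · rw [← h]
    exact hasLineDerivAt_ham hA P q q' p δ

omit hA in
/-- The momenta in terms of the velocities. -/
noncomputable def legendreMom (A : Params N) (v : Fin N → E) (r : Fin N) : E →L[ℝ] ℝ :=
  LinearMap.toContinuousLinearMap (kappa E G (couplingSum A (lightCurrent P q q' v) 1 r +
      couplingSum A (lightCurrent P q q' v) (-1) r) ∘ₗ (leftForm (P r).c (q r)).toLinearMap) +
    A.k r • (P r).lamLeft (q r) (q' r)

omit hA [LieAlgebra.IsSimple ℂ (CplxAlg E G)] in
theorem lamLeft_apply (P : Patch E G) (q u v : E) : P.lamLeft q u v = P.lam q ![u, v] := rfl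

omit hA [LieAlgebra.IsSimple ℂ (CplxAlg E G)] in
theorem legendreMom_apply (v : Fin N → E) (r : Fin N) (u : E) :
    legendreMom P q q' A v r u = kappa E G (couplingSum A (lightCurrent P q q' v) 1 r +
      couplingSum A (lightCurrent P q q' v) (-1) r) (leftForm (P r).c (q r) u) +
    A.k r * (P r).lam (q r) ![q' r, u] := rfl

omit hA [LieAlgebra.IsSimple ℂ (CplxAlg E G)] in
theorem lightCurrent_sub (v : Fin N → E) (r : Fin N) :
    (1 / 2 : ℝ) • (lightCurrent P q q' v 1 r - lightCurrent P q q' v (-1) r) =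
      leftForm (P r).c (q r) (q' r) := by
  simp only [lightCurrent]
  push_cast
  module

omit hA [LieAlgebra.IsSimple ℂ (CplxAlg E G)] in
theorem lightCurrent_add (v : Fin N → E) (r : Fin N) :
    (1 / 2 : ℝ) • (lightCurrent P q q' v 1 r + lightCurrent P q q' v (-1) r) =
      leftForm (P r).c (q r) (v r) := by
  simp only [lightCurrent]
  push_cast
  module

variable {P q}
variable (hq : ∀ r, q r ∈ (P r).c.target)
include hq

omit hA in
-- The two-form part of the momentum cancels the current `k_r W` in `J_{[0]}`, so that the two-form
-- disappears from the currents.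
theorem toAlg_legendreMom (v : Fin N → E) (r : Fin N) :
    (P r).toAlg (q r) (legendreMom P q q' A v r) - A.k r • (P r).toAlg (q r)
      ((P r).lamLeft (q r) (q' r)) = couplingSum A (lightCurrent P q q' v) 1 r +
      couplingSum A (lightCurrent P q q' v) (-1) r := by
  rw [← Patch.toAlg_smul, ← Patch.toAlg_sub]
  refine (P r).toAlg_eq (hq r) fun u => ?_
  rw [sub_apply, legendreMom_apply, smul_apply,
    lamLeft_apply, smul_eq_mul, add_sub_cancel_right]

omit hA in
theorem phaseCurrents_legendreMom (v : Fin N → E) :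
    phaseCurrents A P q q' (legendreMom P q q' A v) = solved A (lightCurrent P q q' v) := by
  refine Prod.ext ?_ ?_
  · funext r
    exact (lightCurrent_sub P q q' v r).symm
  · funext r
    have := toAlg_legendreMom (A := A) q' hq v r
    simp only [phaseCurrents, takiffZero, solved, lightCurrent_sub]
    rw [← this]
    abel

theorem velocityEq_legendreMom (v : Fin N → E) :
    VelocityEq A P q q' (legendreMom P q q' A v) v := by
  rw [velocityEq_iff hA, phaseCurrents_legendreMom q' hq]
  intro δ
  rw [hamPolar_solved hA]
  congr 1
  refine Finset.sum_congr rfl fun r _ => ?_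
  simp only [Pi.zero_apply, map_zero, zero_add]
  rw [lightCurrent_add, kappa_comm,
    (P r).kappa_toAlg _ _ ((P r).isInvertible_leftForm (hq r))]

/-- The difference `p' - p` lies in the radical of the polar form on momenta. Since every velocity
`u` is reached by some momenta, symmetry turns this into `∑_r (p' - p)_r (u_r) = 0` for every `u`.
No determinant of the couplings is needed. -/
theorem velocityEq_unique {v : Fin N → E} {p p' : Fin N → (E →L[ℝ] ℝ)}
    (h : VelocityEq A P q q' p v) (h' : VelocityEq A P q q' p' v) : p' = p := by
  set D : (Fin N → (E →L[ℝ] ℝ)) → (Fin N → RealAlg E G) × (Fin N → RealAlg E G) :=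
    fun δ => ((0 : Fin N → RealAlg E G), fun r => (P r).toAlg (q r) (δ r)) with hD
  have key : ∀ p₁ p₂ δ, hamPolar A (phaseCurrents A P q q' p₁) (D δ) -
      hamPolar A (phaseCurrents A P q q' p₂) (D δ) = hamPolar A (D (p₁ - p₂)) (D δ) := by
    intro p₁ p₂ δ
    have := phaseCurrents_add_smul (A := A) P q q' p₂ 1 (p₁ - p₂)
    rw [one_smul, one_smul, add_sub_cancel] at this
    rw [this, map_add, LinearMap.add_apply, add_sub_cancel_left]
  rw [velocityEq_iff hA] at h h'
  have h0 : ∀ δ, hamPolar A (D (p' - p)) (D δ) = 0 := by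
    intro δ
    rw [← key, h, h', sub_self]
  have hz : ∀ u : Fin N → E, ∑ r, (p' - p) r (u r) = 0 := by
    intro u
    have h1 := (velocityEq_iff hA _ _ _ _ _).1 (velocityEq_legendreMom hA q' hq u) (p' - p)
    have h2 := (velocityEq_iff hA _ _ _ _ _).1 (velocityEq_legendreMom hA q' hq 0) (p' - p)
    have h3 := key (legendreMom P q q' A u) (legendreMom P q q' A 0) (p' - p)
    rw [hamPolar_comm A (D (legendreMom P q q' A u - legendreMom P q q' A 0)), h0, h1, h2] at h3
    simp only [Pi.zero_apply, map_zero, Finset.sum_const_zero, Complex.ofReal_zero, sub_zero] at h3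
    exact_mod_cast h3
  rw [← sub_eq_zero]
  funext r
  ext u
  have := hz (Pi.single r u)
  rwa [Finset.sum_eq_single r (fun s _ hs => by rw [Pi.single_eq_of_ne hs, map_zero])
    (fun h => (h (Finset.mem_univ r)).elim), Pi.single_eq_same] at this

theorem ham_legendreMom (v : Fin N → E) : ham A P q q' (legendreMom P q q' A v) =
    (((1 / 2 : ℝ) * ∑ r, (kappa E G (couplingSum A (lightCurrent P q q' v) 1 r)
      (lightCurrent P q q' v 1 r) + kappa E G (couplingSum A (lightCurrent P q q' v) (-1) r)
      (lightCurrent P q q' v (-1) r)) : ℝ) : ℂ) := by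
  rw [ham_eq hA, phaseCurrents_legendreMom q' hq, hamPolar_solved_self hA]

/-- With `g⁻¹ ∂_t g = (j_+ + j_-)/2`, the pairing of momenta and velocities contains the couplings
of like and of opposite chiralities. The Hamiltonian removes the former, and the two families of the
latter sum to the same double sum in `ρ_{rs}`. -/
theorem lagrangian_eq (v : Fin N → E) :
    ((∑ r, legendreMom P q q' A v r (v r) : ℝ) : ℂ) - ham A P q q' (legendreMom P q q' A v) =
      ∑ r, ∑ s, A.rho r s *
        (kappa E G (lightCurrent P q q' v 1 r) (lightCurrent P q q' v (-1) s) : ℂ)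
      + ∑ r, A.kOfZeros r * ((P r).lam (q r) ![q' r, v r] : ℂ) := by
  rw [ham_legendreMom hA q' hq]
  suffices h : (∑ r, legendreMom P q q' A v r (v r)) - (1 / 2 : ℝ) * ∑ r,
      (kappa E G (couplingSum A (lightCurrent P q q' v) 1 r) (lightCurrent P q q' v 1 r) +
        kappa E G (couplingSum A (lightCurrent P q q' v) (-1) r) (lightCurrent P q q' v (-1) r)) =
      ∑ r, ∑ s, (A.rho r s).re *
        kappa E G (lightCurrent P q q' v 1 r) (lightCurrent P q q' v (-1) s)
      + ∑ r, A.k r * (P r).lam (q r) ![q' r, v r] by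
    rw [← Complex.ofReal_sub, h]
    push_cast
    simp only [(hA.levels_eq _).2, hA.rho_re]
  simp only [legendreMom_apply]
  set a := lightCurrent P q q' v 1
  set b := lightCurrent P q q' v (-1)
  set c := lightCurrent P q q' v
  have e1 : ∑ r, kappa E G (couplingSum A c 1 r) (b r) =
      ∑ r, ∑ s, (A.rho r s).re * kappa E G (a r) (b s) := by
    rw [Finset.sum_comm]
    refine Finset.sum_congr rfl fun r _ => ?_
    rw [couplingSum, map_sum, LinearMap.sum_apply]
    refine Finset.sum_congr rfl fun s _ => ?_
    rw [map_smul, LinearMap.smul_apply, smul_eq_mul]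
    rfl
  have e2 : ∑ r, kappa E G (couplingSum A c (-1) r) (a r) =
      ∑ r, ∑ s, (A.rho r s).re * kappa E G (a r) (b s) := by
    refine Finset.sum_congr rfl fun r _ => ?_
    rw [couplingSum, map_sum, LinearMap.sum_apply]
    refine Finset.sum_congr rfl fun s _ => ?_
    rw [map_smul, LinearMap.smul_apply, smul_eq_mul, kappa_comm]
    rfl
  have e3 : ∑ r, ∑ s, (A.rho r s).re * kappa E G (a r) (b s) = (1 / 2 : ℝ) *
    ((∑ r, kappa E G (couplingSum A c 1 r) (b r)) +
      ∑ r, kappa E G (couplingSum A c (-1) r) (a r)) := by rw [e1, e2]; ring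
  rw [e3, Finset.sum_add_distrib, add_sub_right_comm]
  congr 1
  rw [← Finset.sum_add_distrib, Finset.mul_sum, Finset.mul_sum, ← Finset.sum_sub_distrib]
  refine Finset.sum_congr rfl fun r _ => ?_
  rw [← lightCurrent_add P q q' v r]
  simp only [map_add, map_smul, LinearMap.add_apply, smul_eq_mul]
  ring

end Ham

end CoupledPCM

/-! ### Cut-off functions and integration over the bulk -/

namespace CoupledPCM

section Cutoff

/-- A smooth cut-off function on the line, equal to zero outside of `[-R, R]`. -/
structure IsCutoff (R : ℝ) (τ : ℝ → ℝ) : Prop where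
  contDiff : ContDiff ℝ 1 τ
  zero : ∀ s, R < |s| → τ s = 0
  deriv_zero : ∀ s, R < |s| → deriv τ s = 0

/-- Take the dilations `η(s/(n+1))` of one bump function: they tend to `η(0) = 1`, and their
derivatives are bounded by `sup |η'| / (n+1)`. -/
theorem exists_cutoff : ∃ (τ : ℕ → ℝ → ℝ) (C : ℝ), (∀ n, ∃ R, IsCutoff R (τ n)) ∧
    (∀ n s, |τ n s| ≤ 1) ∧ (∀ n s, |deriv (τ n) s| ≤ C) ∧
    (∀ s, Filter.Tendsto (fun n => τ n s) Filter.atTop (𝓝 1)) ∧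
    ∀ s, Filter.Tendsto (fun n => deriv (τ n) s) Filter.atTop (𝓝 0) := by
  let η : ContDiffBump (0 : ℝ) := ⟨1, 2, one_pos, one_lt_two⟩
  have hη : ContDiff ℝ 1 (η : ℝ → ℝ) := η.contDiff
  have hd : Continuous (deriv (η : ℝ → ℝ)) := hη.continuous_deriv_one
  have hz : ∀ s, 2 < |s| → deriv (η : ℝ → ℝ) s = 0 := by
    intro s hs
    have : (η : ℝ → ℝ) =ᶠ[𝓝 s] fun _ => 0 := by
      filter_upwards [(isOpen_lt continuous_const continuous_abs).mem_nhds hs] with x hx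
      refine η.zero_of_le_dist ?_
      rw [Real.dist_0_eq_abs]
      exact le_of_lt hx
    rw [this.deriv_eq]
    exact deriv_const s 0
  obtain ⟨C, hC⟩ := (isCompact_Icc (a := (-2 : ℝ)) (b := 2)).exists_bound_of_continuousOn
    hd.continuousOn
  have hC0 : 0 ≤ C := (norm_nonneg _).trans (hC 0 (by norm_num))
  have hC' : ∀ s, |deriv (η : ℝ → ℝ) s| ≤ C := by
    intro s
    by_cases h : 2 < |s|
    · rw [hz s h, abs_zero]; exact hC0
    · exact hC s (abs_le.1 (not_lt.1 h))
  have hn : ∀ n : ℕ, (0 : ℝ) < n + 1 := fun n => by positivity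
  have hderiv : ∀ (n : ℕ) (s : ℝ), HasDerivAt (fun s : ℝ => η (s / (n + 1)))
      (deriv (η : ℝ → ℝ) (s / (n + 1)) * (1 / (n + 1))) s := fun n s =>
    HasDerivAt.comp s (h₂ := (η : ℝ → ℝ)) (h := fun s : ℝ => s / (n + 1))
      ((hη.differentiable one_ne_zero) _).hasDerivAt ((hasDerivAt_id s).div_const _)
  have habs : ∀ (n : ℕ) (s : ℝ), 2 * (n + 1) < |s| → 2 < |s / (n + 1)| := by
    intro n s hs
    rw [abs_div, abs_of_pos (hn n), lt_div_iff₀ (hn n)]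
    exact hs
  refine ⟨fun n s => η (s / (n + 1)), C, fun n => ⟨2 * (n + 1), ?_, ?_, ?_⟩, ?_, ?_, ?_, ?_⟩
  · exact hη.comp (contDiff_id.div_const _)
  · intro s hs
    refine η.zero_of_le_dist ?_
    rw [Real.dist_0_eq_abs]
    exact le_of_lt (habs n s hs)
  · intro s hs
    rw [(hderiv n s).deriv, hz _ (habs n s hs), zero_mul]
  · intro n s
    rw [abs_of_nonneg η.nonneg]
    exact η.le_one
  · intro n s
    rw [(hderiv n s).deriv, abs_mul, abs_of_pos (one_div_pos.2 (hn n))]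
    refine (mul_le_mul (hC' _) ?_ (by positivity) hC0).trans_eq (mul_one C)
    rw [div_le_one (hn n)]
    linarith [(Nat.cast_nonneg n : (0 : ℝ) ≤ n)]
  · intro s
    have h1 : Filter.Tendsto (fun n : ℕ => s / ((n : ℝ) + 1)) Filter.atTop (𝓝 0) :=
      (tendsto_const_div_atTop_nhds_zero_nat s).comp (Filter.tendsto_add_atTop_nat 1) |>.congr
        fun n => by simp
    have h2 := (η.continuous.tendsto 0).comp h1
    rwa [η.one_of_mem_closedBall (by simp [η])] at h2
  · intro s
    have h1 : Filter.Tendsto (fun n : ℕ => C * (1 / ((n : ℝ) + 1))) Filter.atTop (𝓝 0) := by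
      have := (tendsto_one_div_add_atTop_nhds_zero_nat (𝕜 := ℝ)).const_mul C
      rwa [mul_zero] at this
    refine squeeze_zero_norm (fun n => ?_) h1
    rw [(hderiv n s).deriv, Real.norm_eq_abs, abs_mul, abs_of_pos (one_div_pos.2 (hn n))]
    exact mul_le_mul_of_nonneg_right (hC' _) (by positivity)

end Cutoff

section Fubini

variable {α β γ : Type*} [MeasurableSpace α] [MeasurableSpace β] [MeasurableSpace γ]
  {μ : Measure α} {ν : Measure β} {ρ : Measure γ} [SFinite μ] [SFinite ν] [SFinite ρ]
  {g : α × β × γ → ℝ}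

theorem integral_prod_eq_zero_last (hg : Integrable g (μ.prod (ν.prod ρ)))
    (h : ∀ᵐ a ∂μ, ∀ b, ∫ c, g (a, b, c) ∂ρ = 0) : ∫ y, g y ∂μ.prod (ν.prod ρ) = 0 := by
  rw [integral_prod _ hg, ← integral_zero α ℝ (μ := μ)]
  refine integral_congr_ae ?_
  filter_upwards [hg.prod_right_ae, h] with a ha h'
  rw [integral_prod _ ha]
  simp [h']

theorem integral_prod_eq_zero_mid (hg : Integrable g (μ.prod (ν.prod ρ)))
    (h : ∀ᵐ a ∂μ, ∀ c, ∫ b, g (a, b, c) ∂ν = 0) : ∫ y, g y ∂μ.prod (ν.prod ρ) = 0 := by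
  rw [integral_prod _ hg, ← integral_zero α ℝ (μ := μ)]
  refine integral_congr_ae ?_
  filter_upwards [hg.prod_right_ae, h] with a ha h'
  rw [integral_prod_symm _ ha]
  simp [h']

end Fubini

theorem Space.measurableSet_dom (D : Space) : MeasurableSet D.dom := by
  cases D
  · exact MeasurableSet.univ
  · exact measurableSet_Ioc

theorem Space.measurableSet_bulk (D : Space) : MeasurableSet D.bulk :=
  measurableSet_Icc.prod (MeasurableSet.univ.prod D.measurableSet_dom)

theorem Space.restrict_bulk (D : Space) : (volume : Measure (ℝ × ℝ × ℝ)).restrict D.bulk =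
    (volume.restrict (Set.Icc (0 : ℝ) 1)).prod ((volume : Measure ℝ).prod
      (volume.restrict D.dom)) := by
  rw [Space.bulk, Measure.volume_eq_prod, ← Measure.prod_restrict, Measure.volume_eq_prod,
    ← Measure.prod_restrict, Measure.restrict_univ]

theorem Space.restrict_world (D : Space) : (volume : Measure (ℝ × ℝ)).restrict D.world =
    (volume : Measure ℝ).prod (volume.restrict D.dom) := by
  rw [Space.world, Measure.volume_eq_prod, ← Measure.prod_restrict, Measure.restrict_univ]

/-- The region `[0,1] × ℝ × ℝ`. -/
def slab : Set (ℝ × ℝ × ℝ) := Set.Icc 0 1 ×ˢ Set.univ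

theorem Space.bulk_subset_slab (D : Space) : D.bulk ⊆ slab :=
  Set.prod_mono le_rfl (Set.subset_univ _)

/-- A cut-off function in space: trivial on the circle. -/
def IsSpaceCutoff (D : Space) (θ : ℝ → ℝ) : Prop :=
  match D with
  | .line => ∃ R, IsCutoff R θ
  | .circle => θ = fun _ => 1

theorem IsSpaceCutoff.contDiff {D : Space} {θ : ℝ → ℝ} (h : IsSpaceCutoff D θ) :
    ContDiff ℝ 1 θ := by
  cases D
  · obtain ⟨R, hR⟩ := h
    exact hR.contDiff
  · rw [show θ = fun _ => 1 from h]
    exact contDiff_const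

theorem IsSpaceCutoff.exists_bound {D : Space} {θ : ℝ → ℝ} (h : IsSpaceCutoff D θ) :
    ∃ R, ∀ x ∈ D.dom, R < |x| → θ x = 0 ∧ deriv θ x = 0 := by
  cases D
  · obtain ⟨R, hR⟩ := h
    exact ⟨R, fun x _ hx => ⟨hR.zero x hx, hR.deriv_zero x hx⟩⟩
  -- On the circle nothing is cut off: the condition is void, since the fundamental domain lies in
  -- `|x| ≤ 2π`.
  · refine ⟨2 * Real.pi, fun x hx hx' => ?_⟩
    rw [abs_of_pos hx.1] at hx'
    exact absurd hx.2 (not_le.2 hx')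

theorem exists_spaceCutoff (D : Space) : ∃ (θ : ℕ → ℝ → ℝ) (C : ℝ),
    (∀ n, IsSpaceCutoff D (θ n)) ∧ (∀ n s, |θ n s| ≤ 1) ∧ (∀ n s, |deriv (θ n) s| ≤ C) ∧
    (∀ s, Filter.Tendsto (fun n => θ n s) Filter.atTop (𝓝 1)) ∧
    ∀ s, Filter.Tendsto (fun n => deriv (θ n) s) Filter.atTop (𝓝 0) := by
  cases D
  · exact exists_cutoff
  · refine ⟨fun _ _ => 1, 0, fun n => rfl, by simp, by simp, ?_, ?_⟩ <;> intro s <;> simp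

/-- Integrability on the bulk of a continuous function with bounded support. -/
theorem integrableOn_bulk_of_cutoff {D : Space} {R R' : ℝ} {g : ℝ × ℝ × ℝ → ℝ}
    (hg : ContinuousOn g slab)
    (h : ∀ ξ t x, x ∈ D.dom → R < |t| ∨ R' < |x| → g (ξ, t, x) = 0) : IntegrableOn g D.bulk := by
  have hK : IsCompact ((Set.Icc (0 : ℝ) 1) ×ˢ ((Set.Icc (-R) R) ×ˢ (Set.Icc (-R') R'))) :=
    isCompact_Icc.prod (isCompact_Icc.prod isCompact_Icc)
  have h1 := (hg.mono (Set.prod_mono le_rfl (Set.subset_univ _))).integrableOn_compact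
    (μ := volume) hK
  refine h1.of_forall_sdiff_eq_zero D.measurableSet_bulk ?_
  rintro ⟨ξ, t, x⟩ ⟨h2, h3⟩
  refine h ξ t x h2.2.2 ?_
  by_contra hc
  push Not at hc
  exact h3 ⟨h2.1, abs_le.1 hc.1, abs_le.1 hc.2⟩

/-- The integrand is the derivative of `θ f`, which is compactly supported on the line and, as `θ =
1` there, periodic on the circle. -/
theorem IsSpaceCutoff.integral_deriv_eq_zero {D : Space} {θ : ℝ → ℝ} (hθ : IsSpaceCutoff D θ)
    {f f' : ℝ → ℝ} (hf : ∀ x, HasDerivAt f (f' x) x) (hf' : Continuous f')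
    (hper : D = .circle → ∀ x, f (x + 2 * Real.pi) = f x) :
    ∫ x in D.dom, (deriv θ x * f x + θ x * f' x) = 0 := by
  have hfc : Continuous f := continuous_iff_continuousAt.2 fun x => (hf x).continuousAt
  have hθ1 := hθ.contDiff
  have hdθ : Continuous (deriv θ) := hθ1.continuous_deriv_one
  have hd : ∀ x, HasDerivAt (fun x => θ x * f x) (deriv θ x * f x + θ x * f' x) x := fun x =>
    ((hθ1.differentiable one_ne_zero) x).hasDerivAt.mul (hf x)
  have hcont : Continuous fun x => deriv θ x * f x + θ x * f' x := by
    have := hθ1.continuous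
    fun_prop
  cases D
  · obtain ⟨R, hR⟩ := hθ
    have hsupp : ∀ g : ℝ → ℝ, Continuous g → (∀ x, R < |x| → g x = 0) → Integrable g := by
      intro g hg h0
      refine hg.integrable_of_hasCompactSupport ?_
      refine HasCompactSupport.intro (isCompact_Icc (a := -R) (b := R)) fun x hx => h0 x ?_
      by_contra hc
      exact hx (abs_le.1 (not_lt.1 hc))
    rw [Space.dom, setIntegral_univ]
    refine integral_eq_zero_of_hasDerivAt_of_integrable hd (hsupp _ hcont fun x hx => ?_)
      (hsupp _ (hθ1.continuous.mul hfc) fun x hx => ?_)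
    · rw [hR.zero x hx, hR.deriv_zero x hx]; ring
    · rw [hR.zero x hx, zero_mul]
  · have e : θ = fun _ => 1 := hθ
    rw [Space.dom, ← intervalIntegral.integral_of_le Real.two_pi_pos.le,
      intervalIntegral.integral_eq_sub_of_hasDerivAt (fun x _ => hd x)
      (hcont.intervalIntegrable _ _)]
    have := hper rfl 0
    rw [zero_add] at this
    simp [e, this]

end CoupledPCM

/-! ### Stokes' theorem on the bulk -/

namespace CoupledPCM

section Stokes

variable {D : Space} {a b c F : ℝ × ℝ × ℝ → ℝ}

theorem hasDerivAt_slice_xi {f : ℝ × ℝ × ℝ → ℝ} {ξ t x : ℝ} (h : DifferentiableAt ℝ f (ξ, t, x)) :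
    HasDerivAt (fun s => f (s, t, x)) (fderiv ℝ f (ξ, t, x) (1, 0, 0)) ξ :=
  h.hasFDerivAt.comp_hasDerivAt (f := fun s : ℝ => (s, t, x)) ξ
    ((hasDerivAt_id ξ).prodMk ((hasDerivAt_const ξ t).prodMk (hasDerivAt_const ξ x)))

theorem hasDerivAt_slice_t {f : ℝ × ℝ × ℝ → ℝ} {ξ t x : ℝ} (h : DifferentiableAt ℝ f (ξ, t, x)) :
    HasDerivAt (fun s => f (ξ, s, x)) (fderiv ℝ f (ξ, t, x) (0, 1, 0)) t :=
  h.hasFDerivAt.comp_hasDerivAt (f := fun s : ℝ => (ξ, s, x)) t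
    ((hasDerivAt_const t ξ).prodMk ((hasDerivAt_id t).prodMk (hasDerivAt_const t x)))

theorem hasDerivAt_slice_x {f : ℝ × ℝ × ℝ → ℝ} {ξ t x : ℝ} (h : DifferentiableAt ℝ f (ξ, t, x)) :
    HasDerivAt (fun s => f (ξ, t, s)) (fderiv ℝ f (ξ, t, x) (0, 0, 1)) x :=
  h.hasFDerivAt.comp_hasDerivAt (f := fun s : ℝ => (ξ, t, s)) x
    ((hasDerivAt_const x ξ).prodMk ((hasDerivAt_const x t).prodMk (hasDerivAt_id x)))

theorem continuousOn_fderiv_slab {f : ℝ × ℝ × ℝ → ℝ} (hf : ∀ y ∈ slab, ContDiffAt ℝ 1 f y)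
    (e : ℝ × ℝ × ℝ) : ContinuousOn (fun y => fderiv ℝ f y e) slab := fun y hy =>
  (((hf y hy).continuousAt_fderiv one_ne_zero).clm_apply continuousAt_const).continuousWithinAt

theorem mem_slab {ξ t x : ℝ} : (ξ, t, x) ∈ slab ↔ ξ ∈ Set.Icc (0 : ℝ) 1 := by
  simp [slab]

variable (ha : ∀ y ∈ slab, ContDiffAt ℝ 1 a y) (hb : ∀ y ∈ slab, ContDiffAt ℝ 1 b y)
  (hc : ∀ y ∈ slab, ContDiffAt ℝ 1 c y)
  (hF : ∀ y ∈ slab, F y = fderiv ℝ c y (1, 0, 0) - fderiv ℝ a y (0, 0, 1) +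
    fderiv ℝ b y (0, 1, 0))
  (hper : D = .circle → ∀ ξ ∈ Set.Icc (0 : ℝ) 1, ∀ t x, a (ξ, t, x + 2 * Real.pi) = a (ξ, t, x))
  (hc0 : ∀ t x, c (0, t, x) = 0)

include ha hb hc hF hper hc0

/-- The cut-offs make each term integrable separately, so Fubini and one-variable calculus apply.
The `ξ`-derivative gives the face `ξ = 1`, as `c` vanishes at `ξ = 0`; integrating by parts in `x`
and in `t` puts the derivative on a cut-off. -/
theorem integral_bulk_cutoff {R : ℝ} {τ θ : ℝ → ℝ} (hτ : IsCutoff R τ) (hθ : IsSpaceCutoff D θ) :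
    ∫ y in D.bulk, τ y.2.1 * θ y.2.2 * F y =
      (∫ p in D.world, τ p.1 * θ p.2 * c (1, p)) + (∫ y in D.bulk, τ y.2.1 * deriv θ y.2.2 * a y) -
        ∫ y in D.bulk, deriv τ y.2.1 * θ y.2.2 * b y := by
  obtain ⟨R', hR'⟩ := hθ.exists_bound
  have cτ := hτ.contDiff.continuous
  have cdτ : Continuous (deriv τ) := hτ.contDiff.continuous_deriv_one
  have cθ := hθ.contDiff.continuous
  have cdθ : Continuous (deriv θ) := hθ.contDiff.continuous_deriv_one
  have ca : ContinuousOn a slab := fun y hy => (ha y hy).continuousAt.continuousWithinAt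
  have cb : ContinuousOn b slab := fun y hy => (hb y hy).continuousAt.continuousWithinAt
  have cda := continuousOn_fderiv_slab ha (0, 0, 1)
  have cdb := continuousOn_fderiv_slab hb (0, 1, 0)
  have cdc := continuousOn_fderiv_slab hc (1, 0, 0)
  have k1 : ContinuousOn (fun y : ℝ × ℝ × ℝ => τ y.2.1) slab :=
    (show Continuous fun y : ℝ × ℝ × ℝ => τ y.2.1 by fun_prop).continuousOn
  have k2 : ContinuousOn (fun y : ℝ × ℝ × ℝ => θ y.2.2) slab :=
    (show Continuous fun y : ℝ × ℝ × ℝ => θ y.2.2 by fun_prop).continuousOn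
  have k3 : ContinuousOn (fun y : ℝ × ℝ × ℝ => deriv τ y.2.1) slab :=
    (show Continuous fun y : ℝ × ℝ × ℝ => deriv τ y.2.1 by fun_prop).continuousOn
  have k4 : ContinuousOn (fun y : ℝ × ℝ × ℝ => deriv θ y.2.2) slab :=
    (show Continuous fun y : ℝ × ℝ × ℝ => deriv θ y.2.2 by fun_prop).continuousOn
  have i1 : IntegrableOn (fun y => τ y.2.1 * θ y.2.2 * fderiv ℝ c y (1, 0, 0)) D.bulk := by
    refine integrableOn_bulk_of_cutoff (R := R) (R' := R') ((k1.mul k2).mul cdc) ?_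
    rintro ξ t x hx (h | h)
    · simp [hτ.zero t h]
    · simp [(hR' x hx h).1]
  have i2 : IntegrableOn (fun y => τ y.2.1 * deriv θ y.2.2 * a y) D.bulk := by
    refine integrableOn_bulk_of_cutoff (R := R) (R' := R') ((k1.mul k4).mul ca) ?_
    rintro ξ t x hx (h | h)
    · simp [hτ.zero t h]
    · simp [(hR' x hx h).2]
  have i3 : IntegrableOn (fun y => τ y.2.1 * θ y.2.2 * fderiv ℝ a y (0, 0, 1)) D.bulk := by
    refine integrableOn_bulk_of_cutoff (R := R) (R' := R') ((k1.mul k2).mul cda) ?_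
    rintro ξ t x hx (h | h)
    · simp [hτ.zero t h]
    · simp [(hR' x hx h).1]
  have i4 : IntegrableOn (fun y => deriv τ y.2.1 * θ y.2.2 * b y) D.bulk := by
    refine integrableOn_bulk_of_cutoff (R := R) (R' := R') ((k3.mul k2).mul cb) ?_
    rintro ξ t x hx (h | h)
    · simp [hτ.deriv_zero t h]
    · simp [(hR' x hx h).1]
  have i5 : IntegrableOn (fun y => τ y.2.1 * θ y.2.2 * fderiv ℝ b y (0, 1, 0)) D.bulk := by
    refine integrableOn_bulk_of_cutoff (R := R) (R' := R') ((k1.mul k2).mul cdb) ?_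
    rintro ξ t x hx (h | h)
    · simp [hτ.zero t h]
    · simp [(hR' x hx h).1]
  have e1 : ∫ y in D.bulk, τ y.2.1 * θ y.2.2 * fderiv ℝ c y (1, 0, 0) =
      ∫ p in D.world, τ p.1 * θ p.2 * c (1, p) := by
    have i1' := i1
    rw [IntegrableOn, D.restrict_bulk] at i1'
    rw [D.restrict_bulk, integral_prod_symm _ i1', ← D.restrict_world]
    refine integral_congr_ae (Filter.Eventually.of_forall fun p => ?_)
    obtain ⟨t, x⟩ := p
    simp only
    rw [integral_const_mul, integral_Icc_eq_integral_Ioc,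
      ← intervalIntegral.integral_of_le zero_le_one,
      intervalIntegral.integral_eq_sub_of_hasDerivAt (f := fun s => c (s, t, x)), hc0, sub_zero]
    · intro s hs
      rw [Set.uIcc_of_le zero_le_one] at hs
      exact hasDerivAt_slice_xi ((hc _ (mem_slab.2 hs)).differentiableAt one_ne_zero)
    · refine ContinuousOn.intervalIntegrable ?_
      rw [Set.uIcc_of_le zero_le_one]
      exact cdc.comp (f := fun s : ℝ => (s, t, x)) (by fun_prop) fun s hs => mem_slab.2 hs
  have e2 : ∫ y in D.bulk, (τ y.2.1 * deriv θ y.2.2 * a y +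
      τ y.2.1 * θ y.2.2 * fderiv ℝ a y (0, 0, 1)) = 0 := by
    have i := i2.add i3
    rw [IntegrableOn, D.restrict_bulk] at i
    rw [D.restrict_bulk]
    refine integral_prod_eq_zero_last i ?_
    filter_upwards [ae_restrict_mem measurableSet_Icc] with ξ hξ t
    have := hθ.integral_deriv_eq_zero (f := fun x => a (ξ, t, x))
      (f' := fun x => fderiv ℝ a (ξ, t, x) (0, 0, 1))
      (fun x => hasDerivAt_slice_x ((ha _ (mem_slab.2 hξ)).differentiableAt one_ne_zero))
      (cda.comp_continuous (f := fun s : ℝ => (ξ, t, s)) (by fun_prop) fun s => mem_slab.2 hξ)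
      (fun hD x => hper hD ξ hξ t x)
    refine Eq.trans ?_ ((congrArg (τ t * ·) this).trans (mul_zero _))
    simp only [← integral_const_mul]
    refine integral_congr_ae (Filter.Eventually.of_forall fun x => ?_)
    simp only
    ring
  have e3 : ∫ y in D.bulk, (deriv τ y.2.1 * θ y.2.2 * b y +
      τ y.2.1 * θ y.2.2 * fderiv ℝ b y (0, 1, 0)) = 0 := by
    have i := i4.add i5
    rw [IntegrableOn, D.restrict_bulk] at i
    rw [D.restrict_bulk]
    refine integral_prod_eq_zero_mid i ?_
    filter_upwards [ae_restrict_mem measurableSet_Icc] with ξ hξ x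
    -- Time always runs over the whole line, so the time integral is treated as a space integral on
    -- `.line`.
    have hτ' : IsSpaceCutoff .line τ := ⟨R, hτ⟩
    have := hτ'.integral_deriv_eq_zero (f := fun t => b (ξ, t, x))
      (f' := fun t => fderiv ℝ b (ξ, t, x) (0, 1, 0))
      (fun t => hasDerivAt_slice_t ((hb _ (mem_slab.2 hξ)).differentiableAt one_ne_zero))
      (cdb.comp_continuous (f := fun s : ℝ => (ξ, s, x)) (by fun_prop) fun s => mem_slab.2 hξ)
      (fun hD => by cases hD)
    rw [Space.dom, setIntegral_univ] at this
    refine Eq.trans ?_ ((congrArg (θ x * ·) this).trans (mul_zero _))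
    simp only [← integral_const_mul]
    refine integral_congr_ae (Filter.Eventually.of_forall fun t => ?_)
    simp only
    ring
  rw [integral_add i2 i3] at e2
  rw [integral_add i4 i5] at e3
  have e4 : ∫ y in D.bulk, τ y.2.1 * θ y.2.2 * F y =
      ∫ y in D.bulk, (τ y.2.1 * θ y.2.2 * fderiv ℝ c y (1, 0, 0) -
        τ y.2.1 * θ y.2.2 * fderiv ℝ a y (0, 0, 1) +
        τ y.2.1 * θ y.2.2 * fderiv ℝ b y (0, 1, 0)) := by
    refine setIntegral_congr_fun D.measurableSet_bulk fun y hy => ?_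
    simp only [hF y (D.bulk_subset_slab hy)]
    ring
  have i6 : IntegrableOn (fun y => τ y.2.1 * θ y.2.2 * fderiv ℝ c y (1, 0, 0) -
      τ y.2.1 * θ y.2.2 * fderiv ℝ a y (0, 0, 1)) D.bulk := i1.sub i3
  rw [e4, integral_add i6 i5, integral_sub i1 i3, e1]
  linarith

/-- Stokes' theorem on the bulk, without boundary at infinity. -/
theorem integral_bulk_eq (ia : IntegrableOn a D.bulk) (ib : IntegrableOn b D.bulk)
    (iF : IntegrableOn F D.bulk) (ic : IntegrableOn (fun p => c (1, p)) D.world) :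
    ∫ y in D.bulk, F y = ∫ p in D.world, c (1, p) := by
  obtain ⟨τ, C, hτ, hτ1, hτC, hτl, hτl'⟩ := exists_cutoff
  obtain ⟨θ, C', hθ, hθ1, hθC, hθl, hθl'⟩ := exists_spaceCutoff D
  choose R hR using hτ
  have cτ := fun n => (hR n).contDiff.continuous
  have cdτ := fun n => ((hR n).contDiff.continuous_deriv_one : Continuous (deriv (τ n)))
  have cθ := fun n => (hθ n).contDiff.continuous
  have cdθ := fun n => ((hθ n).contDiff.continuous_deriv_one : Continuous (deriv (θ n)))
  have hC0 : 0 ≤ C := (abs_nonneg _).trans (hτC 0 0)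
  have hb1 : ∀ (u v w U V : ℝ), |u| ≤ U → |v| ≤ V → 0 ≤ U → ‖u * v * w‖ ≤ U * V * ‖w‖ := by
    intro u v w U V hu hv hU
    rw [norm_mul, norm_mul]
    exact mul_le_mul_of_nonneg_right (mul_le_mul hu hv (abs_nonneg _) hU) (norm_nonneg _)
  have t1 : Filter.Tendsto (fun n => ∫ y in D.bulk, τ n y.2.1 * θ n y.2.2 * F y) Filter.atTop
      (𝓝 (∫ y in D.bulk, F y)) := by
    refine tendsto_integral_of_dominated_convergence (fun y => 1 * 1 * ‖F y‖) (fun n => ?_)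
      (iF.norm.const_mul _) (fun n => ?_) ?_
    · refine AEStronglyMeasurable.mul ?_ iF.aestronglyMeasurable
      have := cτ n
      have := cθ n
      exact Continuous.aestronglyMeasurable (by fun_prop)
    · exact Filter.Eventually.of_forall fun y => hb1 _ _ _ _ _ (hτ1 n _) (hθ1 n _) zero_le_one
    · refine Filter.Eventually.of_forall fun y => ?_
      simpa using ((hτl y.2.1).mul (hθl y.2.2)).mul_const (F y)
  have t2 : Filter.Tendsto (fun n => ∫ p in D.world, τ n p.1 * θ n p.2 * c (1, p)) Filter.atTop
      (𝓝 (∫ p in D.world, c (1, p))) := by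
    refine tendsto_integral_of_dominated_convergence (fun p => 1 * 1 * ‖c (1, p)‖) (fun n => ?_)
      (ic.norm.const_mul _) (fun n => ?_) ?_
    · refine AEStronglyMeasurable.mul ?_ ic.aestronglyMeasurable
      have := cτ n
      have := cθ n
      exact Continuous.aestronglyMeasurable (by fun_prop)
    · exact Filter.Eventually.of_forall fun y => hb1 _ _ _ _ _ (hτ1 n _) (hθ1 n _) zero_le_one
    · refine Filter.Eventually.of_forall fun p => ?_
      simpa using ((hτl p.1).mul (hθl p.2)).mul_const (c (1, p))
  -- The absence of a boundary at infinity: derivatives of the cut-offs are uniformly bounded and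
  -- tend to zero pointwise, and integrability of `a`, and of `b` in `t4`, supplies the majorant.
  have t3 : Filter.Tendsto (fun n => ∫ y in D.bulk, τ n y.2.1 * deriv (θ n) y.2.2 * a y)
      Filter.atTop (𝓝 (∫ y in D.bulk, (0 : ℝ))) := by
    refine tendsto_integral_of_dominated_convergence (fun y => 1 * C' * ‖a y‖) (fun n => ?_)
      (ia.norm.const_mul _) (fun n => ?_) ?_
    · refine AEStronglyMeasurable.mul ?_ ia.aestronglyMeasurable
      have := cτ n
      have := cdθ n
      exact Continuous.aestronglyMeasurable (by fun_prop)
    · exact Filter.Eventually.of_forall fun y => hb1 _ _ _ _ _ (hτ1 n _) (hθC n _) zero_le_one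
    · refine Filter.Eventually.of_forall fun y => ?_
      simpa using ((hτl y.2.1).mul (hθl' y.2.2)).mul_const (a y)
  have t4 : Filter.Tendsto (fun n => ∫ y in D.bulk, deriv (τ n) y.2.1 * θ n y.2.2 * b y)
      Filter.atTop (𝓝 (∫ y in D.bulk, (0 : ℝ))) := by
    refine tendsto_integral_of_dominated_convergence (fun y => C * 1 * ‖b y‖) (fun n => ?_)
      (ib.norm.const_mul _) (fun n => ?_) ?_
    · refine AEStronglyMeasurable.mul ?_ ib.aestronglyMeasurable
      have := cdτ n
      have := cθ n
      exact Continuous.aestronglyMeasurable (by fun_prop)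
    · exact Filter.Eventually.of_forall fun y => hb1 _ _ _ _ _ (hτC n _) (hθ1 n _) hC0
    · refine Filter.Eventually.of_forall fun y => ?_
      simpa using ((hτl' y.2.1).mul (hθl y.2.2)).mul_const (b y)
  have h := (t2.add t3).sub t4
  simp only [integral_zero, add_zero, sub_zero] at h
  refine tendsto_nhds_unique t1 (h.congr fun n => ?_)
  exact (integral_bulk_cutoff ha hb hc hF hper hc0 (hR n) (hθ n)).symm

end Stokes

end CoupledPCM

/-! ### The two-form of the patch and the Wess-Zumino term -/

namespace CoupledPCM

section TwoForm

variable {E : Type*} [NormedAddCommGroup E] [NormedSpace ℝ E]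

variable (E) in
/-- Two-forms as bilinear forms. -/
noncomputable def twoFormCLM : (E [⋀^Fin 2]→L[ℝ] ℝ) →L[ℝ] E →L[ℝ] E →L[ℝ] ℝ :=
  (ContinuousLinearMap.compL ℝ E (E [⋀^Fin 1]→L[ℝ] ℝ) (E →L[ℝ] ℝ)
    ((ContinuousAlternatingMap.ofSubsingletonLIE (𝕜 := ℝ) (E := E) (F := ℝ)
      (0 : Fin 1)).symm.toContinuousLinearEquiv : (E [⋀^Fin 1]→L[ℝ] ℝ) →L[ℝ] (E →L[ℝ] ℝ))).comp
  (ContinuousAlternatingMap.curryLeftLI (𝕜 := ℝ) (E := E) (F := ℝ)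
    (n := 1)).toContinuousLinearMap

theorem twoFormCLM_apply (f : E [⋀^Fin 2]→L[ℝ] ℝ) (u v : E) : twoFormCLM E f u v = f ![u, v] := by
  have : (![u, v] : Fin 2 → E) = Matrix.vecCons u fun _ : Fin 1 => v := by
    ext i; fin_cases i <;> rfl
  rw [this]
  rfl

theorem twoFormCLM_swap (f : E [⋀^Fin 2]→L[ℝ] ℝ) (u v : E) :
    twoFormCLM E f u v = -twoFormCLM E f v u := by
  rw [twoFormCLM_apply, twoFormCLM_apply]
  refine Eq.trans (congrArg f ?_) (f.map_swap ![v, u] (i := 0) (j := 1) (by decide))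
  ext i; fin_cases i <;> rfl

end TwoForm

section

variable {E G : Type*} [NormedAddCommGroup E] [NormedSpace ℝ E] [FiniteDimensional ℝ E]
  [TopologicalSpace G] [ChartedSpace E G] [Group G] [LieGroup 𝓘(ℝ, E) ∞ G]
  (P : Patch E G)

/-- The two-form of the patch as a field of bilinear forms. -/
noncomputable def Patch.form (q : E) : E →L[ℝ] E →L[ℝ] ℝ := twoFormCLM E (P.lam q)

theorem Patch.lam_apply (q u v : E) : P.lam q ![u, v] = P.form q u v :=
  (twoFormCLM_apply _ u v).symm

theorem Patch.form_swap (q u v : E) : P.form q u v = -P.form q v u := twoFormCLM_swap _ u v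

variable {P} {q : E}

theorem Patch.contDiffAt_form (hq : q ∈ P.c.target) : ContDiffAt ℝ ∞ P.form q :=
  have h : ContDiff ℝ ∞ (fun f => twoFormCLM E f) :=
    by fun_prop
  ContDiffAt.comp (g := twoFormCLM E) (f := P.lam) q h.contDiffAt
    (P.smooth_lam.contDiffAt (P.c.open_target.mem_nhds hq))

theorem Patch.differentiableAt_form (hq : q ∈ P.c.target) : DifferentiableAt ℝ P.form q :=
  (P.contDiffAt_form hq).differentiableAt (by simp)

theorem Patch.fderiv_form_swap (hq : q ∈ P.c.target) (u v w : E) :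
    fderiv ℝ P.form q u v w = -fderiv ℝ P.form q u w v := by
  have h := (P.differentiableAt_form hq).hasFDerivAt
  have h1 : HasFDerivAt (fun q => P.form q v w) _ q :=
    (h.clm_apply (hasFDerivAt_const v q)).clm_apply (hasFDerivAt_const w q)
  have h2 : HasFDerivAt (fun q => P.form q w v) _ q :=
    (h.clm_apply (hasFDerivAt_const w q)).clm_apply (hasFDerivAt_const v q)
  have h3 : (fun q => P.form q v w) = fun q => -P.form q w v :=
    funext fun q => P.form_swap q v w
  rw [h3] at h1
  have := DFunLike.congr_fun (h1.unique h2.neg) u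
  simpa using this

/-- The exterior derivative is an alternating sum; antisymmetry in the last two slots turns its
middle term into the cyclic one. -/
theorem Patch.fderiv_form_cyclic (hq : q ∈ P.c.target) (u v w : E) :
    fderiv ℝ P.form q u v w + fderiv ℝ P.form q v w u + fderiv ℝ P.form q w u v =
      kappa E G (leftForm P.c q u) ⁅leftForm P.c q v, leftForm P.c q w⁆ := by
  have hd : DifferentiableAt ℝ P.lam q :=
    (P.smooth_lam.contDiffAt (P.c.open_target.mem_nhds hq)).differentiableAt (by simp)
  have h : fderiv ℝ P.form q = (twoFormCLM E).comp (fderiv ℝ P.lam q) :=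
    (HasFDerivAt.comp (g := twoFormCLM E) (f := P.lam) q
      (ContinuousLinearMap.hasFDerivAt (F := E →L[ℝ] E →L[ℝ] ℝ) (twoFormCLM E))
      hd.hasFDerivAt).fderiv
  rw [← P.extDeriv_lam q hq, extDeriv, ContinuousAlternatingMap.alternatizeUncurryFin_apply,
    Fin.sum_univ_three, P.fderiv_form_swap hq v w u, h]
  simp only [ContinuousLinearMap.comp_apply, twoFormCLM_apply]
  have e0 : Fin.removeNth 0 ![u, v, w] = ![v, w] := by ext i; fin_cases i <;> rfl
  have e1 : Fin.removeNth 1 ![u, v, w] = ![u, w] := by ext i; fin_cases i <;> rfl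
  have e2 : Fin.removeNth 2 ![u, v, w] = ![u, v] := by ext i; fin_cases i <;> rfl
  rw [e0, e1, e2]
  simp

/-- The pull-back of the two-form of the patch along a map. -/
theorem Patch.fderiv_pullback {V : Type*} [NormedAddCommGroup V] [NormedSpace ℝ V] {Φ : V → E}
    {y : V} (hΦ : ContDiffAt ℝ ∞ Φ y) (hq : Φ y ∈ P.c.target) (d e f : V) :
    fderiv ℝ (fun y => P.form (Φ y) (fderiv ℝ Φ y e) (fderiv ℝ Φ y f)) y d =
      fderiv ℝ P.form (Φ y) (fderiv ℝ Φ y d) (fderiv ℝ Φ y e) (fderiv ℝ Φ y f) +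
      P.form (Φ y) (fderiv ℝ (fderiv ℝ Φ) y d e) (fderiv ℝ Φ y f) +
      P.form (Φ y) (fderiv ℝ Φ y e) (fderiv ℝ (fderiv ℝ Φ) y d f) := by
  have h1 : HasFDerivAt (fun y => P.form (Φ y)) _ y :=
    HasFDerivAt.comp (g := P.form) (f := Φ) y (P.differentiableAt_form hq).hasFDerivAt (hΦ.differentiableAt (by simp)).hasFDerivAt
  have h2 : HasFDerivAt (fderiv ℝ Φ) _ y :=
    ((hΦ.fderiv_right (m := 1) (by norm_cast)).differentiableAt one_ne_zero).hasFDerivAt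
  have h3 := (h1.clm_apply (h2.clm_apply (hasFDerivAt_const e y))).clm_apply
    (h2.clm_apply (hasFDerivAt_const f y))
  rw [h3.fderiv]
  simp
  ring

theorem Patch.contDiffAt_pullback {V : Type*} [NormedAddCommGroup V] [NormedSpace ℝ V] {Φ : V → E}
    {y : V} (hΦ : ContDiffAt ℝ ∞ Φ y) (hq : Φ y ∈ P.c.target) (e f : V) :
    ContDiffAt ℝ 1 (fun y => P.form (Φ y) (fderiv ℝ Φ y e) (fderiv ℝ Φ y f)) y := by
  have h1 : ContDiffAt ℝ 1 (fun y => P.form (Φ y)) y :=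
    ((P.contDiffAt_form hq).of_le (by norm_cast)).comp y (hΦ.of_le (by norm_cast))
  have h2 : ContDiffAt ℝ 1 (fderiv ℝ Φ) y := hΦ.fderiv_right (m := 1) (by norm_cast)
  exact (h1.clm_apply (h2.clm_apply contDiffAt_const)).clm_apply (h2.clm_apply contDiffAt_const)

/-- The Wess-Zumino term as an integral over space-time. -/
theorem wzTerm_eq {D : Space} {φ : ℝ × ℝ → E} {Φ : ℝ × ℝ × ℝ → E} (hΦ : IsExtension D P φ Φ)
    (hφ : IntegrableOn (fun y => P.lam (φ y) ![dx φ y, dt φ y]) D.world) :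
    wzTerm D P Φ = ∫ y in D.world, P.lam (φ y) ![dx φ y, dt φ y] := by
  have hs : ∀ y, ContDiffAt ℝ ∞ Φ y := fun y => hΦ.smooth.contDiffAt
  have hd : ∀ y, DifferentiableAt ℝ Φ y := fun y => (hs y).differentiableAt (by simp)
  have hm : ∀ y ∈ slab, Φ y ∈ P.c.target := by
    rintro ⟨ξ, t, x⟩ hy
    exact hΦ.mem ξ (mem_slab.1 hy) t x
  have htop : (fun p : ℝ × ℝ => Φ (1, p)) = φ := funext fun p => hΦ.top p.1 p.2
  have hin : ∀ (ξ : ℝ) (p : ℝ × ℝ), HasFDerivAt (fun p : ℝ × ℝ => Φ (ξ, p))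
      ((fderiv ℝ Φ (ξ, p)).comp (ContinuousLinearMap.inr ℝ ℝ (ℝ × ℝ))) p := fun ξ p =>
    (hd (ξ, p)).hasFDerivAt.comp p ((hasFDerivAt_prodMk_right ξ p))
  have hc : ∀ p : ℝ × ℝ, P.form (Φ (1, p)) (fderiv ℝ Φ (1, p) (0, 0, 1))
      (fderiv ℝ Φ (1, p) (0, 1, 0)) = P.lam (φ p) ![dx φ p, dt φ p] := by
    intro p
    rw [P.lam_apply, dx, dt, ← htop, (hin 1 p).fderiv]
    rfl
  simp only [← hc] at hφ ⊢
  have ia := hΦ.integrable_t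
  have ib := hΦ.integrable_x
  simp only [P.lam_apply] at ia ib
  -- The components of the pulled-back two-form are `a = Λ(∂_ξ, ∂_t)`, `b = Λ(∂_ξ, ∂_x)` and `c =
  -- Λ(∂_x, ∂_t)`, with signs such that `∂_ξ c - ∂_x a + ∂_t b` is the component `(ξ, x, t)` of
  -- `dΛ`.
  refine integral_bulk_eq (c := fun y => P.form (Φ y) (fderiv ℝ Φ y (0, 0, 1))
    (fderiv ℝ Φ y (0, 1, 0))) (fun y hy => P.contDiffAt_pullback (hs y) (hm y hy) _ _)
    (fun y hy => P.contDiffAt_pullback (hs y) (hm y hy) _ _)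
    (fun y hy => P.contDiffAt_pullback (hs y) (hm y hy) _ _) ?_ ?_ ?_ ia ib hΦ.integrable_wz hφ
  · intro y hy
    -- All terms with second derivatives of `Φ` cancel in pairs by their symmetry, which leaves the
    -- pull-back of `dΛ`.
    have hsym : ∀ d e, fderiv ℝ (fderiv ℝ Φ) y d e = fderiv ℝ (fderiv ℝ Φ) y e d := fun d e =>
      ((hs y).isSymmSndFDerivAt (by
        rw [minSmoothness_of_isRCLikeNormedField]; exact ENat.LEInfty.out)).eq d e
    rw [P.fderiv_pullback (hs y) (hm y hy), P.fderiv_pullback (hs y) (hm y hy),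
      P.fderiv_pullback (hs y) (hm y hy), wzDensity, bulkCurrent, bulkCurrent, bulkCurrent,
      ← P.fderiv_form_cyclic (hm y hy), hsym (1, 0, 0) (0, 0, 1), hsym (1, 0, 0) (0, 1, 0),
      hsym (0, 0, 1) (0, 1, 0), P.fderiv_form_swap (hm y hy) (fderiv ℝ Φ y (0, 0, 1)),
      P.form_swap _ (fderiv ℝ (fderiv ℝ Φ) y (0, 0, 1) (1, 0, 0)),
      P.form_swap _ (fderiv ℝ (fderiv ℝ Φ) y (0, 1, 0) (1, 0, 0))]
    rw [P.form_swap _ (fderiv ℝ Φ y (0, 1, 0))]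
    ring
  · intro hD ξ _ t x
    have h1 : (fun y : ℝ × ℝ × ℝ => Φ (y + (0, 0, 2 * Real.pi))) = Φ := by
      funext y
      have := hΦ.periodic hD y.1 y.2.1 y.2.2
      simpa [Prod.add_def] using this
    have h2 : fderiv ℝ Φ (ξ, t, x + 2 * Real.pi) = fderiv ℝ Φ (ξ, t, x) := by
      conv_rhs => rw [← h1]
      rw [fderiv_comp_add_right]
      simp
    simp only [h2, hΦ.periodic hD]
  · intro t x
    -- At `ξ = 0` the extension does not depend on `x`, so `∂_x Φ = 0` and the bottom face
    -- contributes nothing.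
    have h1 : HasDerivAt (fun s => Φ (0, t, s)) (fderiv ℝ Φ (0, t, x) (0, 0, 1)) x :=
      (hd (0, t, x)).hasFDerivAt.comp_hasDerivAt (f := fun s : ℝ => ((0 : ℝ), t, s)) x
        ((hasDerivAt_const x 0).prodMk ((hasDerivAt_const x t).prodMk (hasDerivAt_id x)))
    have h2 : (fun s => Φ (0, t, s)) = fun _ => Φ (0, t, 0) := funext fun s => hΦ.bot t s
    rw [h2] at h1
    simp only [h1.unique (hasDerivAt_const x _), map_zero, zero_apply]

end

end CoupledPCM

/-! ### Zero curvature and equations of motion as an algebraic equivalence -/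

namespace CoupledPCM

variable {E G : Type*} [NormedAddCommGroup E] [NormedSpace ℝ E] [FiniteDimensional ℝ E]
  [TopologicalSpace G] [ChartedSpace E G] [Group G] [LieGroup 𝓘(ℝ, E) ∞ G]

theorem toCplx_lie (x y : RealAlg E G) : toCplx ⁅x, y⁆ = ⁅toCplx x, toCplx y⁆ := by
  simp only [toCplx_apply, LieAlgebra.ExtendScalars.bracket_tmul, mul_one]

omit [FiniteDimensional ℝ E] [LieGroup 𝓘(ℝ, E) ∞ G] in
theorem toCplx_injective : Function.Injective (toCplx : RealAlg E G → CplxAlg E G) := by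
  rw [← LinearMap.ker_eq_bot, LinearMap.ker_eq_bot']
  exact fun x hx =>
    (Module.FaithfullyFlat.one_tmul_eq_zero_iff (R := ℝ) (M := RealAlg E G) (A := ℂ) x).mp hx

variable {N : ℕ} {A : Params N} (hA : A.Admissible) (cur d : ℤˣ → Fin N → RealAlg E G)

variable (A) in
/-- The curvature of the Lax pair with currents `j_±`, where `d σ` stands for `∂_∓ j_±`. -/
noncomputable def curvature (w : ℂ) : CplxAlg E G :=
  (∑ s, A.laxCoeff (-1) s w • toCplx (d (-1) s)) - (∑ s, A.laxCoeff 1 s w • toCplx (d 1 s)) +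
    ⁅∑ s, A.laxCoeff 1 s w • toCplx (cur 1 s), ∑ s, A.laxCoeff (-1) s w • toCplx (cur (-1) s)⁆

variable (A) in
/-- The equation of motion of the site `r`. -/
noncomputable def eom (r : Fin N) : RealAlg E G :=
  couplingSum A d 1 r + couplingSum A d (-1) r + ⁅cur (-1) r, couplingSum A cur 1 r⁆ +
    ⁅cur 1 r, couplingSum A cur (-1) r⁆ - (A.k r / 2) • ⁅cur 1 r, cur (-1) r⁆

theorem sum_smul_lie {L : Type*} [LieRing L] [LieAlgebra ℂ L] (a : Fin N → ℂ) (x : Fin N → L)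
    (y : L) : ⁅∑ s, a s • x s, y⁆ = ∑ s, a s • ⁅x s, y⁆ := by
  simp only [sum_lie, smul_lie]

theorem lie_sum_smul {L : Type*} [LieRing L] [LieAlgebra ℂ L] (a : Fin N → ℂ) (x : Fin N → L)
    (y : L) : ⁅y, ∑ s, a s • x s⁆ = ∑ s, a s • ⁅y, x s⁆ := by
  simp only [lie_sum, lie_smul]

theorem sum_smul_pole {V : Type*} [AddCommGroup V] [Module ℂ V] (a : Fin N → ℂ)
    (ρ : Fin N → Fin N → ℂ) (c : Fin N → ℂ) (v : Fin N → V) :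
    ∑ s, (a s + ∑ r, c r * ρ s r) • v s = ∑ r, (a r • v r + c r • ∑ s, ρ s r • v s) := by
  simp only [add_smul, Finset.sum_smul, Finset.sum_add_distrib, Finset.smul_sum, smul_smul]
  rw [Finset.sum_comm]

include hA

/-- For distinct sites, the product of two poles splits into simple poles with coefficient
`±2ρ_{st}`. At a common site it is the double pole of `-ℓ_s`, and the two terms in `ρ_{ss}` cancel.
-/
theorem Params.Admissible.phi_mul_phi (s t : Fin N) {w : ℂ} (hw : ∀ r, w ≠ A.z r) :
    A.ellInf * (A.phi 1 s (A.z s) / (w - A.z s) * (A.phi (-1) t (A.z t) / (w - A.z t))) =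
      (if s = t then -(A.ell s : ℂ) / (w - A.z s) ^ 2 else 0) +
        (2 / (w - A.z s) * A.rho s t - 2 / (w - A.z t) * A.rho s t) := by
  have h1 := sub_ne_zero.2 (hw s)
  have h2 := sub_ne_zero.2 (hw t)
  rcases eq_or_ne s t with rfl | h
  · rw [if_pos rfl, (hA.levels_eq s).1, Params.ellOfZeros]
    field_simp
    ring
  · have h3 : (A.z s : ℂ) - A.z t ≠ 0 := by
      rw [sub_ne_zero]
      exact_mod_cast hA.z_injective.ne h
    rw [if_neg h, Params.rho, if_neg h]
    field_simp
    ring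

/-- The factor `ℓ^∞ R_+ R_-` turns all coefficients into explicit poles at the sites. Every double
pole multiplies the left-hand side of `hmc`, hence cancels; in the simple poles, `hmc` trades `k_r
(d (-1) r - d 1 r)` for a commutator. -/
theorem curvature_eq (hmc : ∀ r, d (-1) r - d 1 r + ⁅cur 1 r, cur (-1) r⁆ = 0) {w : ℂ}
    (hw : A.Regular w) :
    (A.ellInf * (A.ratio 1 w * A.ratio (-1) w)) • curvature A cur d w =
      ∑ r, (2 / (w - A.z r)) • toCplx (eom A cur d r) := by
  have hm : ∀ s, A.ellInf * (A.ratio 1 w * A.ratio (-1) w) * A.laxCoeff (-1) s w =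
      (-(A.ell s : ℂ) / (w - A.z s) ^ 2 + A.k s / (w - A.z s)) +
        ∑ r, 2 / (w - A.z r) * A.rhoT (-1) s r := by
    intro s
    have h1 := hA.ratio_mul_eq (-1) s hw.1
    have h2 := A.laxCoeff_mul_ratio (-1) s hw
    rw [neg_neg, ← h2, ← (hA.levels_eq s).1, ← (hA.levels_eq s).2] at h1
    have h3 : ∑ r, 2 / (w - A.z r) * A.rhoT (-1) s r =
        2 * ∑ r, A.rhoT (-1) s r / (w - A.z r) := by
      rw [Finset.mul_sum]
      exact Finset.sum_congr rfl fun r _ => by ring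
    rw [h3]
    push_cast at h1
    linear_combination h1
  have hn : ∀ s, A.ellInf * (A.ratio 1 w * A.ratio (-1) w) * A.laxCoeff 1 s w =
      (-(A.ell s : ℂ) / (w - A.z s) ^ 2 + A.k s / (w - A.z s)) +
        ∑ r, (-(2 / (w - A.z r))) * A.rhoT 1 s r := by
    intro s
    have h1 := hA.ratio_mul_eq 1 s hw.1
    have h2 := A.laxCoeff_mul_ratio 1 s hw
    rw [← h2, ← (hA.levels_eq s).1, ← (hA.levels_eq s).2] at h1
    have h3 : ∑ r, (-(2 / (w - A.z r))) * A.rhoT 1 s r =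
        -(2 * ∑ r, A.rhoT 1 s r / (w - A.z r)) := by
      rw [Finset.mul_sum, ← Finset.sum_neg_distrib]
      exact Finset.sum_congr rfl fun r _ => by ring
    rw [h3]
    push_cast at h1
    linear_combination h1
  have hb : ∀ s t, A.ellInf * (A.ratio 1 w * A.ratio (-1) w) *
      (A.laxCoeff 1 s w * A.laxCoeff (-1) t w) =
      (if s = t then -(A.ell s : ℂ) / (w - A.z s) ^ 2 else 0) +
        (2 / (w - A.z s) * A.rho s t - 2 / (w - A.z t) * A.rho s t) := by
    intro s t
    rw [← hA.phi_mul_phi s t hw.1, ← A.laxCoeff_mul_ratio 1 s hw,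
      ← A.laxCoeff_mul_ratio (-1) t hw]
    ring
  set b : Fin N → Fin N → CplxAlg E G := fun s t => toCplx ⁅cur 1 s, cur (-1) t⁆ with hbd
  have hbr : (A.ellInf * (A.ratio 1 w * A.ratio (-1) w)) •
      ⁅∑ s, A.laxCoeff 1 s w • toCplx (cur 1 s),
        ∑ s, A.laxCoeff (-1) s w • toCplx (cur (-1) s)⁆ =
      ∑ r, ((-(A.ell r : ℂ) / (w - A.z r) ^ 2) • b r r + (2 / (w - A.z r)) •
        (∑ t, A.rhoT (-1) t r • b r t - ∑ s, A.rhoT 1 s r • b s r)) := by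
    have e1 : (A.ellInf * (A.ratio 1 w * A.ratio (-1) w)) •
        ⁅∑ s, A.laxCoeff 1 s w • toCplx (cur 1 s),
          ∑ s, A.laxCoeff (-1) s w • toCplx (cur (-1) s)⁆ = ∑ s, ∑ t,
        (A.ellInf * (A.ratio 1 w * A.ratio (-1) w) *
          (A.laxCoeff 1 s w * A.laxCoeff (-1) t w)) • b s t := by
      refine (congrArg _ (sum_smul_lie _ _ _)).trans ?_
      rw [Finset.smul_sum]
      refine Finset.sum_congr rfl fun s _ => ?_
      refine (congrArg (fun v => _ • _ • v) (lie_sum_smul _ _ _)).trans ?_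
      simp only [hbd, toCplx_lie, Finset.smul_sum, smul_smul, mul_assoc]
    rw [e1]
    simp only [hb, add_smul, sub_smul, ite_smul, zero_smul, Finset.sum_add_distrib,
      Finset.sum_sub_distrib, Finset.sum_ite_eq, Finset.mem_univ, if_true, smul_sub,
      Finset.smul_sum, smul_smul]
    congr 2
    rw [Finset.sum_comm]
    rfl
  have hE : ∀ r, toCplx (eom A cur d r) = (∑ s, A.rhoT 1 s r • toCplx (d 1 s)) +
      (∑ s, A.rhoT (-1) s r • toCplx (d (-1) s)) + (∑ t, A.rhoT (-1) t r • b r t -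
        ∑ s, A.rhoT 1 s r • b s r) - ((A.k r : ℂ) / 2) • b r r := by
    intro r
    have e1 : toCplx ⁅cur (-1) r, couplingSum A cur 1 r⁆ = -∑ s, A.rhoT 1 s r • b s r := by
      rw [← lie_skew, map_neg, toCplx_lie, toCplx_couplingSum hA]
      refine congrArg Neg.neg ((sum_smul_lie _ _ _).trans ?_)
      simp only [hbd, toCplx_lie]
    have e2 : toCplx ⁅cur 1 r, couplingSum A cur (-1) r⁆ = ∑ t, A.rhoT (-1) t r • b r t := by
      rw [toCplx_lie, toCplx_couplingSum hA]
      refine (lie_sum_smul _ _ _).trans ?_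
      simp only [hbd, toCplx_lie]
    rw [eom, map_sub, map_add, map_add, map_add, e1, e2, toCplx_smul, toCplx_couplingSum hA,
      toCplx_couplingSum hA]
    push_cast
    abel
  have hmc' : ∀ r, b r r = toCplx (d 1 r) - toCplx (d (-1) r) := by
    intro r
    have := congrArg toCplx (hmc r)
    rw [map_add, map_sub, map_zero] at this
    rw [eq_sub_iff_add_eq, ← sub_eq_zero, ← this]
    abel
  rw [curvature, smul_add, smul_sub, hbr, Finset.smul_sum, Finset.smul_sum]
  simp only [smul_smul, hm, hn]
  rw [sum_smul_pole, sum_smul_pole, ← Finset.sum_sub_distrib, ← Finset.sum_add_distrib]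
  refine Finset.sum_congr rfl fun r _ => ?_
  rw [hE]
  generalize ∑ t, A.rhoT (-1) t r • b r t - ∑ s, A.rhoT 1 s r • b s r = β
  rw [hmc' r]
  module

/-- The factor in `curvature_eq` is nonzero at regular points, and the residues of a sum of poles
are determined by its values there. Linear forms reduce the vector-valued statement to the scalar
one. -/
theorem eom_eq_zero_iff (hmc : ∀ r, d (-1) r - d 1 r + ⁅cur 1 r, cur (-1) r⁆ = 0) :
    (∀ r, eom A cur d r = 0) ↔
      ∀ w, A.Regular w → ∀ f : Module.Dual ℂ (CplxAlg E G), f (curvature A cur d w) = 0 := by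
  constructor
  · intro h w hw f
    have h1 := curvature_eq hA cur d hmc hw
    simp only [h, map_zero, smul_zero, Finset.sum_const_zero] at h1
    rw [(smul_eq_zero_iff_right (mul_ne_zero hA.ellInf_ne (mul_ne_zero (A.ratio_ne_zero 1 hw)
      (A.ratio_ne_zero (-1) hw)))).1 h1, map_zero]
  · intro h r
    refine toCplx_injective ?_
    rw [map_zero, ← Module.forall_dual_apply_eq_zero_iff ℂ]
    intro f
    have := (hA.eq_zero_of_sum_eq_zero (fun _ => 0) (fun s => 2 * f (toCplx (eom A cur d s)))
      (fun w hw => ?_) r).2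
    · simpa using this
    · have h1 := congrArg f (curvature_eq hA cur d hmc hw)
      rw [map_smul, h w hw f, smul_zero, map_sum] at h1
      refine Eq.trans ?_ h1.symm
      refine Finset.sum_congr rfl fun s _ => ?_
      rw [map_smul, smul_eq_mul]
      ring

end CoupledPCM

/-! ### The Lax pair in Lagrangian variables, and pull-backs of the left-invariant form -/

namespace CoupledPCM

variable {E G : Type*} [NormedAddCommGroup E] [NormedSpace ℝ E] [FiniteDimensional ℝ E]
  [TopologicalSpace G] [ChartedSpace E G] [Group G] [LieGroup 𝓘(ℝ, E) ∞ G]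

section Lax

variable [LieAlgebra.IsSimple ℂ (CplxAlg E G)]
  {N : ℕ} {A : Params N} (hA : A.Admissible) (P : Fin N → Patch E G)
  (q q' : Fin N → E) (p : Fin N → (E →L[ℝ] ℝ))

theorem laxM_eq (w : ℂ) : laxM A P q q' p w = algM A (phaseCurrents A P q q' p) w := by
  simp only [laxM, algM, weight, gaudin_eq, div_div]

include hA

/-- With Legendre momenta, `ℳ` is half the sum, and `ℒ` half the difference, of the same two chiral
expressions. Dividing `gaudinAlg_solved` by `φ = -ℓ^∞ R_+ R_-` gives the latter. -/
theorem laxPM_legendreMom {q : Fin N → E} (hq : ∀ r, q r ∈ (P r).c.target) (v : Fin N → E)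
    (σ : ℤˣ) {w : ℂ} (hw : A.Regular w) :
    laxPM A P q q' (legendreMom P q q' A v) σ w =
      ∑ r, A.laxCoeff σ r w • toCplx (lightCurrent P q q' v σ r) := by
  have h0 := hA.ellInf_ne
  have h1 := A.ratio_ne_zero 1 hw
  have h2 := A.ratio_ne_zero (-1) hw
  have e1 : ∀ s, (A.twist w)⁻¹ * (1 / 2 * (A.ellInf *
      (A.ratio (-1) w * (A.phi 1 s (A.z s) / (w - A.z s))))) = -(1 / 2) * A.laxCoeff 1 s w := by
    intro s
    rw [hA.twist_eq 1 hw.1, ← A.laxCoeff_mul_ratio 1 s hw]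
    field_simp
  have e2 : ∀ s, (A.twist w)⁻¹ * (1 / 2 * (A.ellInf *
      (A.ratio 1 w * (A.phi (-1) s (A.z s) / (w - A.z s))))) =
      -(1 / 2) * A.laxCoeff (-1) s w := by
    intro s
    rw [hA.twist_eq 1 hw.1, ← A.laxCoeff_mul_ratio (-1) s hw]
    field_simp
  have hL : laxL A P q q' (legendreMom P q q' A v) w =
      (1 / 2 : ℂ) • ((∑ s, A.laxCoeff 1 s w • toCplx (lightCurrent P q q' v 1 s)) -
        ∑ s, A.laxCoeff (-1) s w • toCplx (lightCurrent P q q' v (-1) s)) := by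
    rw [laxL, gaudin_eq, phaseCurrents_legendreMom q' hq, gaudinAlg_solved hA _ hw.1]
    rw [smul_add, smul_neg, Finset.smul_sum, Finset.smul_sum]
    simp only [smul_smul, e1, e2]
    simp only [mul_smul, ← Finset.smul_sum]
    module
  rw [laxPM, hL, laxM_eq, phaseCurrents_legendreMom q' hq, algM_solved hA _ hw.2]
  rcases Int.units_eq_one_or σ with rfl | rfl
  · push_cast
    module
  · push_cast
    module

end Lax

section Forms

/-- The pull-back of the left-invariant form along a map, with values in the model space. -/
noncomputable def pullForm {V : Type*} [NormedAddCommGroup V] [NormedSpace ℝ V] (P : Patch E G)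
    (φ : V → E) (e : V) (y : V) : E := leftFormE P.c (φ y) (fderiv ℝ φ y e)

variable {V : Type*} [NormedAddCommGroup V] [NormedSpace ℝ V] {P : Patch E G} {φ : V → E} {y : V}

theorem hasFDerivAt_leftFormE_comp (hφ : ContDiffAt ℝ ∞ φ y) (hm : φ y ∈ P.c.target) :
    HasFDerivAt (fun y => leftFormE P.c (φ y))
      ((fderiv ℝ (leftFormE P.c) (φ y)).comp (fderiv ℝ φ y)) y :=
  HasFDerivAt.comp (g := leftFormE P.c) (f := φ) y
    ((contDiffAt_leftFormE P.mem_atlas hm).differentiableAt (by simp)).hasFDerivAt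
    (hφ.differentiableAt (by simp)).hasFDerivAt

theorem hasFDerivAt_form_comp (hφ : ContDiffAt ℝ ∞ φ y) (hm : φ y ∈ P.c.target) :
    HasFDerivAt (fun y => P.form (φ y)) ((fderiv ℝ P.form (φ y)).comp (fderiv ℝ φ y)) y :=
  HasFDerivAt.comp (g := P.form) (f := φ) y (P.differentiableAt_form hm).hasFDerivAt
    (hφ.differentiableAt (by simp)).hasFDerivAt

omit [FiniteDimensional ℝ E] in
theorem hasFDerivAt_fderiv (hφ : ContDiffAt ℝ ∞ φ y) :
    HasFDerivAt (fderiv ℝ φ) (fderiv ℝ (fderiv ℝ φ) y) y :=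
  ((hφ.fderiv_right (m := 1) (by norm_cast)).differentiableAt one_ne_zero).hasFDerivAt

omit [FiniteDimensional ℝ E] in
theorem fderiv_fderiv_comm (hφ : ContDiffAt ℝ ∞ φ y) (d e : V) :
    fderiv ℝ (fderiv ℝ φ) y d e = fderiv ℝ (fderiv ℝ φ) y e d :=
  (hφ.isSymmSndFDerivAt
    (by rw [minSmoothness_of_isRCLikeNormedField]; exact ENat.LEInfty.out)).eq d e

theorem differentiableAt_pullForm (hφ : ContDiffAt ℝ ∞ φ y) (hm : φ y ∈ P.c.target) (e : V) :
    DifferentiableAt ℝ (pullForm P φ e) y :=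
  ((hasFDerivAt_leftFormE_comp hφ hm).clm_apply
    ((hasFDerivAt_fderiv hφ).clm_apply (hasFDerivAt_const e y))).differentiableAt

theorem fderiv_pullForm (hφ : ContDiffAt ℝ ∞ φ y) (hm : φ y ∈ P.c.target) (d e : V) :
    fderiv ℝ (pullForm P φ e) y d =
      fderiv ℝ (leftFormE P.c) (φ y) (fderiv ℝ φ y d) (fderiv ℝ φ y e) +
        leftFormE P.c (φ y) (fderiv ℝ (fderiv ℝ φ) y d e) := by
  have h := (hasFDerivAt_leftFormE_comp hφ hm).clm_apply
    ((hasFDerivAt_fderiv hφ).clm_apply (hasFDerivAt_const e y))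
  rw [show fderiv ℝ (pullForm P φ e) y = _ from h.fderiv]
  simp [add_comm]

/-- The second derivatives of `φ` are symmetric and cancel, so the Maurer-Cartan equation passes to
the pull-back. -/
theorem pullForm_flat (hφ : ContDiffAt ℝ ∞ φ y) (hm : φ y ∈ P.c.target) (d e : V) :
    (ofModel (fderiv ℝ (pullForm P φ e) y d) : RealAlg E G) -
      ofModel (fderiv ℝ (pullForm P φ d) y e) +
      ⁅(ofModel (pullForm P φ d y) : RealAlg E G), ofModel (pullForm P φ e y)⁆ = 0 := by
  have h := maurerCartan P.mem_atlas hm (fderiv ℝ φ y d) (fderiv ℝ φ y e)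
  rw [← map_sub, fderiv_pullForm hφ hm, fderiv_pullForm hφ hm, fderiv_fderiv_comm hφ d e,
    add_sub_add_right_eq_sub, h]
  exact neg_add_cancel _

end Forms

end CoupledPCM

/-! ### Variation of the Hamiltonian density at fixed momenta -/

namespace CoupledPCM

theorem hasDerivAt_half_quadratic {V X : Type*} [NormedAddCommGroup V] [NormedSpace ℝ V]
    [FiniteDimensional ℝ V] [AddCommGroup X] [Module ℝ X] (B : X →ₗ[ℝ] X →ₗ[ℝ] ℂ)
    (hB : ∀ x y, B x y = B y x) (M : V →ₗ[ℝ] X) {x : ℝ → V} {x' : V} {t : ℝ}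
    (h : HasDerivAt x x' t) :
    HasDerivAt (fun s => (1 / 2 : ℂ) * B (M (x s)) (M (x s))) (B (M (x t)) (M x')) t := by
  set T := (B.compl₁₂ M M).toContinuousBilinearMap with hT
  have h1 : HasDerivAt (fun s => T (x s)) (T x') t := T.hasFDerivAt.comp_hasDerivAt t h
  refine ((h1.clm_apply h).const_mul (1 / 2 : ℂ)).congr_deriv ?_
  change (1 / 2 : ℂ) * (B (M x') (M (x t)) + B (M (x t)) (M x')) = _
  rw [hB (M x')]
  ring

variable {E G : Type*} [NormedAddCommGroup E] [NormedSpace ℝ E] [FiniteDimensional ℝ E]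
  [TopologicalSpace G] [ChartedSpace E G] [Group G] [LieGroup 𝓘(ℝ, E) ∞ G]

variable (E G) in
/-- The form `κ` on the model space. -/
noncomputable def kappaE : E →L[ℝ] E →L[ℝ] ℝ :=
  ((kappa E G).compl₁₂ (ofModel (G := G)) (ofModel (G := G))).toContinuousBilinearMap

theorem kappaE_apply (x y : E) : kappaE E G x y = kappa E G (ofModel x) (ofModel y) := rfl

variable (E G) in
/-- The identification of a family of pairs in the model space with one in `𝔤₀`. -/
noncomputable def ofModelPair (N : ℕ) : ((Fin N → E) × (Fin N → E)) →ₗ[ℝ]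
    ((Fin N → RealAlg E G) × (Fin N → RealAlg E G)) where
  toFun x := (fun r => ofModel (x.1 r), fun r => ofModel (x.2 r))
  map_add' _ _ := rfl
  map_smul' _ _ := rfl

variable (E G) in
/-- The identification of `𝔤₀` with the model space. -/
noncomputable def toModel : RealAlg E G →ₗ[ℝ] E where
  toFun x := x
  map_add' _ _ := rfl
  map_smul' _ _ := rfl

omit [FiniteDimensional ℝ E] [LieGroup 𝓘(ℝ, E) ∞ G] in
theorem ofModel_toModel (x : RealAlg E G) : ofModel (toModel E G x) = x := rfl

section Variation

variable [LieAlgebra.IsSimple ℂ (CplxAlg E G)]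

variable (E G) in
/-- The identification of the dual of the model space with itself by means of `κ`. -/
noncomputable def sharp : (E →L[ℝ] ℝ) →ₗ[ℝ] E where
  toFun β := toModel E G (((kappa E G).toDual (kappa_nondegenerate E G)).symm
    (β.toLinearMap ∘ₗ toModel E G))
  map_add' x y := by
    rw [← map_add, ← map_add]
    rfl
  map_smul' a x := by
    rw [← map_smul, RingHom.id_apply, ← map_smul]
    rfl

/-- Differentiability comes from that of the inverse of the left-invariant form, but the derivative
`Y'` is not computed. It is characterised by differentiating `κ(toAlg α, g⁻¹ ∂_e g) = α(e)`, which
is all that is used later. -/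
theorem Patch.hasDerivAt_toAlg (P : Patch E G) {q : E} (hq : q ∈ P.c.target) (u : E)
    {α : ℝ → (E →L[ℝ] ℝ)} {α' : E →L[ℝ] ℝ} (hα : HasDerivAt α α' 0) :
    ∃ Y' : E, HasDerivAt (fun s : ℝ => toModel E G (P.toAlg (q + s • u) (α s))) Y' 0 ∧
      ∀ e, kappaE E G Y' (leftFormE P.c q e) + kappaE E G (toModel E G (P.toAlg q (α 0)))
        (fderiv ℝ (leftFormE P.c) q u e) = α' e := by
  have hline : HasDerivAt (fun s : ℝ => q + s • u) u 0 := by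
    simpa using ((hasDerivAt_id (0 : ℝ)).smul_const u).const_add q
  have h0 : q + (0 : ℝ) • u = q := by simp
  have hL : HasDerivAt (fun s : ℝ => leftFormE P.c (q + s • u))
      (fderiv ℝ (leftFormE P.c) q u) 0 := by
    refine HasFDerivAt.comp_hasDerivAt (l := leftFormE P.c) 0 ?_ hline
    rw [h0]
    exact ((contDiffAt_leftFormE P.mem_atlas hq).differentiableAt (by simp)).hasFDerivAt
  obtain ⟨Y', hY⟩ : ∃ Y' : E,
      HasDerivAt (fun s : ℝ => toModel E G (P.toAlg (q + s • u) (α s))) Y' 0 := by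
    have h2 : DifferentiableAt ℝ (fun s : ℝ => (leftFormE P.c (q + s • u)).inverse) 0 := by
      obtain ⟨e, he⟩ := isInvertible_leftFormE P.mem_atlas hq
      have h2 : ContDiffAt ℝ 1 ContinuousLinearMap.inverse (leftFormE P.c (q + (0 : ℝ) • u)) := by
        have := FiniteDimensional.complete ℝ E
        rw [h0, ← he]
        exact contDiffAt_map_inverse e
      exact (h2.differentiableAt one_ne_zero).comp (f := fun s : ℝ => leftFormE P.c (q + s • u)) 0
        hL.differentiableAt
    have h3 := (LinearMap.toContinuousLinearMap (sharp E G)).hasFDerivAt.comp_hasDerivAt 0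
      (hα.clm_comp h2.hasDerivAt)
    exact ⟨_, h3⟩
  refine ⟨Y', hY, fun e => ?_⟩
  have h1 : HasDerivAt (fun s : ℝ => kappaE E G (toModel E G (P.toAlg (q + s • u) (α s)))
      (leftFormE P.c (q + s • u) e)) _ 0 :=
    ((kappaE E G).hasFDerivAt.comp_hasDerivAt 0 hY).clm_apply
      (hL.clm_apply (hasDerivAt_const 0 e))
  have h2 : HasDerivAt (fun s => α s e) (α' e) 0 := by
    simpa using hα.clm_apply (hasDerivAt_const 0 e)
  have h3 : (fun s : ℝ => kappaE E G (toModel E G (P.toAlg (q + s • u) (α s)))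
      (leftFormE P.c (q + s • u) e)) =ᶠ[𝓝 0] fun s => α s e := by
    have h4 : ∀ᶠ s in 𝓝 (0 : ℝ), q + s • u ∈ P.c.target :=
      hline.continuousAt.eventually (by simpa using P.c.open_target.mem_nhds hq)
    filter_upwards [h4] with s hs
    exact P.kappa_toAlg _ _ (P.isInvertible_leftForm hs) e
  have h5 := (h1.congr_of_eventuallyEq h3.symm).unique h2
  rw [← h5]
  simp only [Function.comp_apply, h0, map_zero, add_zero]

variable {N : ℕ} {A : Params N} (hA : A.Admissible) {P : Fin N → Patch E G}
  {q : Fin N → E} (q' : Fin N → E) (hq : ∀ r, q r ∈ (P r).c.target) (v : Fin N → E)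

omit [LieAlgebra.IsSimple ℂ (CplxAlg E G)] in
theorem Patch.lamLeft_eq (P : Patch E G) (q u : E) : P.lamLeft q u = P.form q u := by
  ext e
  rw [lamLeft_apply, P.lam_apply]

include hA hq

/-- The variation of the Hamiltonian density at fixed momenta. -/
theorem hasDerivAt_ham (a b : Fin N → E) : HasDerivAt
    (fun s : ℝ => ham A P (q + s • a) (q' + s • b) (legendreMom P q q' A v))
    ((∑ r, (kappa E G (couplingSum A (lightCurrent P q q' v) 1 r -
        couplingSum A (lightCurrent P q q' v) (-1) r)
        (ofModel (fderiv ℝ (leftFormE (P r).c) (q r) (a r) (q' r) +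
          leftFormE (P r).c (q r) (b r))) -
      A.k r * (fderiv ℝ (P r).form (q r) (a r) (q' r) (v r) + (P r).form (q r) (b r) (v r)) -
      kappa E G (couplingSum A (lightCurrent P q q' v) 1 r +
        couplingSum A (lightCurrent P q q' v) (-1) r)
        (ofModel (fderiv ℝ (leftFormE (P r).c) (q r) (a r) (v r)))) : ℝ) : ℂ) 0 := by
  set p := legendreMom P q q' A v with hp
  set S := couplingSum A (lightCurrent P q q' v) with hS
  have h0 : ∀ x y : E, x + (0 : ℝ) • y = x := fun x y => by simp
  have hline : ∀ x y : E, HasDerivAt (fun s : ℝ => x + s • y) y 0 := fun x y => by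
    simpa using ((hasDerivAt_id (0 : ℝ)).smul_const y).const_add x
  have hL : ∀ r, HasDerivAt (fun s : ℝ => leftFormE (P r).c (q r + s • a r) (q' r + s • b r))
      (fderiv ℝ (leftFormE (P r).c) (q r) (a r) (q' r) + leftFormE (P r).c (q r) (b r)) 0 := by
    intro r
    have h1 : HasDerivAt (fun s : ℝ => leftFormE (P r).c (q r + s • a r))
        (fderiv ℝ (leftFormE (P r).c) (q r) (a r)) 0 := by
      refine HasFDerivAt.comp_hasDerivAt (l := leftFormE (P r).c) 0 ?_ (hline _ _)
      rw [h0]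
      exact ((contDiffAt_leftFormE (P r).mem_atlas (hq r)).differentiableAt (by simp)).hasFDerivAt
    have h2 := h1.clm_apply (hline (q' r) (b r))
    simpa only [h0] using h2
  have hα : ∀ r, HasDerivAt (fun s : ℝ => p r - A.k r • (P r).form (q r + s • a r) (q' r + s • b r))
      (-(A.k r • (fderiv ℝ (P r).form (q r) (a r) (q' r) + (P r).form (q r) (b r)))) 0 := by
    intro r
    have h1 : HasDerivAt (fun s : ℝ => (P r).form (q r + s • a r))
        (fderiv ℝ (P r).form (q r) (a r)) 0 := by
      refine HasFDerivAt.comp_hasDerivAt (l := (P r).form) 0 ?_ (hline _ _)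
      rw [h0]
      exact ((P r).differentiableAt_form (hq r)).hasFDerivAt
    have h2 := ((h1.clm_apply (hline (q' r) (b r))).const_smul (A.k r)).const_sub (p r)
    simp only [h0] at h2
    exact h2
  choose Y' hY hY' using fun r => (P r).hasDerivAt_toAlg (hq r) (a r) (hα r)
  set xE : ℝ → (Fin N → E) × (Fin N → E) := fun s =>
    (fun r => leftFormE (P r).c (q r + s • a r) (q' r + s • b r),
      fun r => toModel E G ((P r).toAlg (q r + s • a r)
        (p r - A.k r • (P r).form (q r + s • a r) (q' r + s • b r))) -
        A.k r • leftFormE (P r).c (q r + s • a r) (q' r + s • b r)) with hxE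
  have hx : ∀ s : ℝ, ofModelPair E G N (xE s) = phaseCurrents A P (q + s • a) (q' + s • b) p := by
    intro s
    refine Prod.ext rfl ?_
    funext r
    simp only [phaseCurrents, takiffZero, Pi.add_apply, Pi.smul_apply, Patch.lamLeft_eq]
    rw [sub_right_comm, ← Patch.toAlg_smul, ← Patch.toAlg_sub]
    rfl
  have hx0 : ofModelPair E G N (xE 0) = solved A (lightCurrent P q q' v) := by
    rw [hx, zero_smul, zero_smul, add_zero, add_zero, hp, phaseCurrents_legendreMom q' hq]
  have hY0 : ∀ r, (P r).toAlg (q r) (p r - A.k r • (P r).form (q r + (0 : ℝ) • a r)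
      (q' r + (0 : ℝ) • b r)) = S 1 r + S (-1) r := by
    intro r
    rw [h0, h0, ← Patch.lamLeft_eq, Patch.toAlg_sub, Patch.toAlg_smul]
    exact toAlg_legendreMom q' hq v r
  have hd : HasDerivAt xE (fun r => fderiv ℝ (leftFormE (P r).c) (q r) (a r) (q' r) +
      leftFormE (P r).c (q r) (b r), fun r => Y' r - A.k r •
      (fderiv ℝ (leftFormE (P r).c) (q r) (a r) (q' r) + leftFormE (P r).c (q r) (b r))) 0 :=
    (hasDerivAt_pi.2 hL).prodMk (hasDerivAt_pi.2 fun r => (hY r).sub ((hL r).const_smul (A.k r)))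
  have key := hasDerivAt_half_quadratic (hamPolar A) (hamPolar_comm A) (ofModelPair E G N) hd
  simp only [hx] at key
  simp only [← ham_eq hA] at key
  refine key.congr_deriv ?_
  rw [← hx, hx0, hamPolar_solved hA]
  congr 1
  refine Finset.sum_congr rfl fun r _ => ?_
  -- The derivative of the density in `J_{[0]}` is `g⁻¹ ∂_v g`, so `Y'` is paired with this vector
  -- only, and the characterisation of `Y'` at `e = v r` suffices.
  have h1 := hY' r (v r)
  simp only [kappaE_apply, ofModel_toModel, hY0, neg_apply, smul_apply,
    add_apply, smul_eq_mul] at h1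
  change kappa E G (S 1 r - S (-1) r + _) (ofModel (_ + _)) + kappa E G _ (ofModel (_ - _)) = _
  rw [lightCurrent_add, map_sub ofModel, map_smul ofModel, map_sub, map_smul, map_add (kappa E G),
    LinearMap.add_apply, map_smul (kappa E G), LinearMap.smul_apply, leftForm_apply,
    kappa_comm (ofModel (leftFormE (P r).c (q r) (v r))) (ofModel (Y' r))]
  simp only [smul_eq_mul]
  linear_combination h1

theorem lineDeriv_ham_velocity (b : Fin N → E) :
    lineDeriv ℝ (fun q'' => ham A P q q'' (legendreMom P q q' A v)) q' b =
      ((∑ r, (kappa E G (couplingSum A (lightCurrent P q q' v) 1 r -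
        couplingSum A (lightCurrent P q q' v) (-1) r)
        (ofModel (leftFormE (P r).c (q r) (b r))) -
      A.k r * (P r).form (q r) (b r) (v r)) : ℝ) : ℂ) := by
  have h := hasDerivAt_ham hA q' hq v 0 b
  simp only [smul_zero, add_zero, Pi.zero_apply, map_zero, zero_apply, zero_add, sub_zero] at h
  exact h.deriv

theorem lineDeriv_ham_position (a : Fin N → E) :
    lineDeriv ℝ (fun q'' => ham A P q'' q' (legendreMom P q q' A v)) q a =
      ((∑ r, (kappa E G (couplingSum A (lightCurrent P q q' v) 1 r -
        couplingSum A (lightCurrent P q q' v) (-1) r)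
        (ofModel (fderiv ℝ (leftFormE (P r).c) (q r) (a r) (q' r))) -
      A.k r * fderiv ℝ (P r).form (q r) (a r) (q' r) (v r) -
      kappa E G (couplingSum A (lightCurrent P q q' v) 1 r +
        couplingSum A (lightCurrent P q q' v) (-1) r)
        (ofModel (fderiv ℝ (leftFormE (P r).c) (q r) (a r) (v r)))) : ℝ) : ℂ) := by
  have h := hasDerivAt_ham hA q' hq v a 0
  simp only [smul_zero, add_zero, Pi.zero_apply, map_zero, zero_apply] at h
  exact h.deriv

end Variation

end CoupledPCM

/-! ### The Euler-Lagrange expression of one site -/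

namespace CoupledPCM

variable {E G : Type*} [NormedAddCommGroup E] [NormedSpace ℝ E] [FiniteDimensional ℝ E]
  [TopologicalSpace G] [ChartedSpace E G] [Group G] [LieGroup 𝓘(ℝ, E) ∞ G]

theorem HasFDerivAt.hasDerivAt_fst {F : Type*} [NormedAddCommGroup F] [NormedSpace ℝ F]
    {f : ℝ × ℝ → F} {f' : ℝ × ℝ →L[ℝ] F} {t x : ℝ} (h : HasFDerivAt f f' (t, x)) :
    HasDerivAt (fun s => f (s, x)) (f' (1, 0)) t :=
  h.comp_hasDerivAt (f := fun s : ℝ => (s, x)) t ((hasDerivAt_id t).prodMk (hasDerivAt_const t x))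

theorem HasFDerivAt.hasDerivAt_snd {F : Type*} [NormedAddCommGroup F] [NormedSpace ℝ F]
    {f : ℝ × ℝ → F} {f' : ℝ × ℝ →L[ℝ] F} {t x : ℝ} (h : HasFDerivAt f f' (t, x)) :
    HasDerivAt (fun s => f (t, s)) (f' (0, 1)) x :=
  h.comp_hasDerivAt (f := fun s : ℝ => (t, s)) x ((hasDerivAt_const x t).prodMk (hasDerivAt_id x))

section Site

variable {P : Patch E G} {φ : ℝ × ℝ → E} {y : ℝ × ℝ} (hφ : ContDiffAt ℝ ∞ φ y)
  (hm : φ y ∈ P.c.target) {z : ℝ × ℝ → E} (hz : DifferentiableAt ℝ z y) (κ₀ : ℝ) (u : E)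

include hφ hm hz

theorem hasFDerivAt_kappaE_leftFormE : ∃ f' : ℝ × ℝ →L[ℝ] ℝ,
    HasFDerivAt (fun y => kappaE E G (z y) (leftFormE P.c (φ y) u)) f' y ∧
    ∀ d, f' d = kappaE E G (fderiv ℝ z y d) (leftFormE P.c (φ y) u) +
      kappaE E G (z y) (fderiv ℝ (leftFormE P.c) (φ y) (fderiv ℝ φ y d) u) := by
  have h1 : HasFDerivAt (fun y => kappaE E G (z y)) ((kappaE E G).comp (fderiv ℝ z y)) y :=
    HasFDerivAt.comp (g := kappaE E G) (f := z) y (kappaE E G).hasFDerivAt hz.hasFDerivAt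
  have h2 := h1.clm_apply
    ((hasFDerivAt_leftFormE_comp hφ hm).clm_apply (hasFDerivAt_const u y))
  refine ⟨_, h2, fun d => ?_⟩
  simp [add_comm]

omit hz

theorem hasFDerivAt_form_fderiv (e : ℝ × ℝ) : ∃ f' : ℝ × ℝ →L[ℝ] ℝ,
    HasFDerivAt (fun y => P.form (φ y) (fderiv ℝ φ y e) u) f' y ∧
    ∀ d, f' d = fderiv ℝ P.form (φ y) (fderiv ℝ φ y d) (fderiv ℝ φ y e) u +
      P.form (φ y) (fderiv ℝ (fderiv ℝ φ) y d e) u := by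
  have h2 := ((hasFDerivAt_form_comp hφ hm).clm_apply
    ((hasFDerivAt_fderiv hφ).clm_apply (hasFDerivAt_const e y))).clm_apply (hasFDerivAt_const u y)
  refine ⟨_, h2, fun d => ?_⟩
  simp [add_comm]

include hz

theorem hasFDerivAt_siteMomentum : ∃ f' : ℝ × ℝ →L[ℝ] ℝ,
    HasFDerivAt (fun y => kappaE E G (z y) (leftFormE P.c (φ y) u) +
      κ₀ * P.form (φ y) (dx φ y) u) f' y ∧
    ∀ d, f' d = kappaE E G (fderiv ℝ z y d) (leftFormE P.c (φ y) u) +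
      kappaE E G (z y) (fderiv ℝ (leftFormE P.c) (φ y) (fderiv ℝ φ y d) u) +
      κ₀ * (fderiv ℝ P.form (φ y) (fderiv ℝ φ y d) (dx φ y) u +
        P.form (φ y) (fderiv ℝ (fderiv ℝ φ) y d (0, 1)) u) := by
  obtain ⟨f₁, h₁, e₁⟩ := hasFDerivAt_kappaE_leftFormE hφ hm hz u
  obtain ⟨f₂, h₂, e₂⟩ := hasFDerivAt_form_fderiv hφ hm u (0, 1)
  refine ⟨_, h₁.add (h₂.const_mul κ₀), fun d => ?_⟩
  simp [e₁, e₂, dx]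

theorem hasFDerivAt_siteFlux : ∃ f' : ℝ × ℝ →L[ℝ] ℝ,
    HasFDerivAt (fun y => kappaE E G (z y) (leftFormE P.c (φ y) u) -
      κ₀ * P.form (φ y) u (dt φ y)) f' y ∧
    ∀ d, f' d = kappaE E G (fderiv ℝ z y d) (leftFormE P.c (φ y) u) +
      kappaE E G (z y) (fderiv ℝ (leftFormE P.c) (φ y) (fderiv ℝ φ y d) u) +
      κ₀ * (fderiv ℝ P.form (φ y) (fderiv ℝ φ y d) (dt φ y) u +
        P.form (φ y) (fderiv ℝ (fderiv ℝ φ) y d (1, 0)) u) := by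
  obtain ⟨f₁, h₁, e₁⟩ := hasFDerivAt_kappaE_leftFormE hφ hm hz u
  obtain ⟨f₂, h₂, e₂⟩ := hasFDerivAt_form_fderiv hφ hm u (1, 0)
  refine ⟨f₁ + κ₀ • f₂, ?_, fun d => ?_⟩
  · refine (h₁.add (h₂.const_mul κ₀)).congr_of_eventuallyEq
      (Filter.Eventually.of_forall fun y => ?_)
    simp only [Pi.add_apply]
    rw [P.form_swap, dt]
    ring
  · simp [e₁, e₂, dt]

omit hz in
/-- The Euler-Lagrange expression of a site, paired with a variation. -/
theorem site_identity (a b z k : E) :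
    kappaE E G a (leftFormE P.c (φ y) u) +
        kappaE E G z (fderiv ℝ (leftFormE P.c) (φ y) (dt φ y) u) +
        κ₀ * (fderiv ℝ P.form (φ y) (dt φ y) (dx φ y) u +
          P.form (φ y) (fderiv ℝ (fderiv ℝ φ) y (1, 0) (0, 1)) u) -
      (kappaE E G b (leftFormE P.c (φ y) u) +
        kappaE E G k (fderiv ℝ (leftFormE P.c) (φ y) (dx φ y) u) +
        κ₀ * (fderiv ℝ P.form (φ y) (dx φ y) (dt φ y) u +
          P.form (φ y) (fderiv ℝ (fderiv ℝ φ) y (0, 1) (1, 0)) u)) +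
      (kappaE E G k (fderiv ℝ (leftFormE P.c) (φ y) u (dx φ y)) -
        κ₀ * fderiv ℝ P.form (φ y) u (dx φ y) (dt φ y) -
        kappaE E G z (fderiv ℝ (leftFormE P.c) (φ y) u (dt φ y))) =
    kappa E G (ofModel (a - b) + ⁅leftForm P.c (φ y) (dt φ y), (ofModel z : RealAlg E G)⁆ +
      ⁅(ofModel k : RealAlg E G), leftForm P.c (φ y) (dx φ y)⁆ +
      κ₀ • ⁅leftForm P.c (φ y) (dt φ y), leftForm P.c (φ y) (dx φ y)⁆)
      (leftForm P.c (φ y) u) := by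
  -- `m1` and `m2` turn the antisymmetrised derivatives of the left-invariant form into brackets,
  -- and `m3` turns the cyclic derivatives of the two-form into a triple product; invariance of `κ`
  -- then moves `u` alone into the second slot.
  have m1 := congrArg (kappa E G (ofModel z))
    (maurerCartan P.mem_atlas hm (dt φ y) u)
  have m2 := congrArg (kappa E G (ofModel k))
    (maurerCartan P.mem_atlas hm (dx φ y) u)
  have m3 := P.fderiv_form_cyclic hm (dt φ y) (dx φ y) u
  rw [map_sub, map_sub, map_neg, ← kappa_lie] at m1 m2
  rw [← kappa_lie] at m3
  have m4 := P.fderiv_form_swap hm u (dt φ y) (dx φ y)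
  have m5 := P.fderiv_form_swap hm (dx φ y) (dt φ y) u
  rw [fderiv_fderiv_comm hφ (0, 1) (1, 0)]
  simp only [map_add, map_sub, map_smul, LinearMap.add_apply, LinearMap.sub_apply,
    LinearMap.smul_apply, smul_eq_mul, kappaE_apply]
  rw [← lie_skew (leftForm P.c (φ y) (dt φ y)) (ofModel z), map_neg, LinearMap.neg_apply]
  simp only [leftForm_apply] at *
  linear_combination m1 - m2 + κ₀ * m3 - κ₀ * m4 - κ₀ * m5

end Site

end CoupledPCM

/-! ### Equations of motion of the fields: zero curvature and Hamilton's equations -/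

namespace CoupledPCM

variable {E G : Type*} [NormedAddCommGroup E] [NormedSpace ℝ E] [FiniteDimensional ℝ E]
  [TopologicalSpace G] [ChartedSpace E G] [Group G] [LieGroup 𝓘(ℝ, E) ∞ G]

section Fields

variable {N : ℕ} {A : Params N} {P : Fin N → Patch E G} {φ : Fin N → ℝ × ℝ → E}

variable (P φ) in
/-- The light-cone currents of the fields, with values in the model space. -/
noncomputable def currentE (σ : ℤˣ) (r : Fin N) : ℝ × ℝ → E :=
  pullForm (P r) (φ r) (1, ((σ : ℤ) : ℝ))

variable (P φ) in
/-- The derivatives `∂_∓ j_±` of the light-cone currents. -/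
noncomputable def crossDeriv (y : ℝ × ℝ) (σ : ℤˣ) (r : Fin N) : RealAlg E G :=
  ofModel (fderiv ℝ (currentE P φ σ r) y (1, -((σ : ℤ) : ℝ)))

variable (P φ) in
/-- The light-cone currents at a point. -/
noncomputable def currents (y : ℝ × ℝ) (σ : ℤˣ) (r : Fin N) : RealAlg E G :=
  fieldCurrent P φ σ r y

theorem currents_eq (y : ℝ × ℝ) (σ : ℤˣ) (r : Fin N) :
    currents P φ y σ r = ofModel (currentE P φ σ r y) := by
  have h : ((1, ((σ : ℤ) : ℝ)) : ℝ × ℝ) = (1, 0) + ((σ : ℤ) : ℝ) • (0, 1) := by simp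
  rw [currentE, pullForm, h, map_add, map_add, map_smul, map_smul, map_add, map_smul]
  rfl

variable (A P φ) in
/-- The combinations of currents entering the momenta, with values in the model space. -/
noncomputable def couplingE (σ : ℤˣ) (r : Fin N) (y : ℝ × ℝ) : E :=
  ∑ s, (A.rhoT σ s r).re • currentE P φ σ s y

theorem couplingSum_currents (y : ℝ × ℝ) (σ : ℤˣ) (r : Fin N) :
    couplingSum A (currents P φ y) σ r = ofModel (couplingE A P φ σ r y) := by
  simp only [couplingSum, couplingE, map_sum, map_smul, currents_eq]

variable (hφ : ∀ r, ContDiff ℝ ∞ (φ r)) (hm : ∀ r y, φ r y ∈ (P r).c.target)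
include hφ hm

theorem differentiableAt_currentE (σ : ℤˣ) (r : Fin N) (y : ℝ × ℝ) :
    DifferentiableAt ℝ (currentE P φ σ r) y :=
  differentiableAt_pullForm (hφ r).contDiffAt (hm r y) _

theorem hasFDerivAt_couplingE (σ : ℤˣ) (r : Fin N) (y : ℝ × ℝ) :
    HasFDerivAt (couplingE A P φ σ r)
      (∑ s, (A.rhoT σ s r).re • fderiv ℝ (currentE P φ σ s) y) y :=
  HasFDerivAt.fun_sum fun s _ => (differentiableAt_currentE hφ hm σ s y).hasFDerivAt.const_smul _

theorem couplingSum_crossDeriv (y : ℝ × ℝ) (σ : ℤˣ) (r : Fin N) :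
    couplingSum A (crossDeriv P φ y) σ r =
      ofModel (fderiv ℝ (couplingE A P φ σ r) y (1, -((σ : ℤ) : ℝ))) := by
  rw [(hasFDerivAt_couplingE hφ hm σ r y).fderiv]
  simp only [couplingSum, crossDeriv, sum_apply, smul_apply, map_sum, map_smul]

/-- This is `pullForm_flat` in the light-cone directions `(1, 1)` and `(1, -1)`; it holds for every
field, with no equation of motion. -/
theorem crossDeriv_flat (y : ℝ × ℝ) (r : Fin N) :
    crossDeriv P φ y (-1) r - crossDeriv P φ y 1 r +
      ⁅currents P φ y 1 r, currents P φ y (-1) r⁆ = 0 := by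
  have h := pullForm_flat (P := P r) (hφ r).contDiffAt (hm r y) (1, 1) (1, -1)
  simp only [currents_eq, crossDeriv, currentE]
  push_cast
  rw [neg_neg]
  exact h

/-- Passing from light-cone to `t` and `x` components brings `eom` to the form that `site_identity`
produces from the Hamiltonian side. -/
theorem eom_currents (y : ℝ × ℝ) (r : Fin N) :
    eom A (currents P φ y) (crossDeriv P φ y) r =
      ofModel (fderiv ℝ (fun y => couplingE A P φ 1 r y + couplingE A P φ (-1) r y) y (1, 0) -
        fderiv ℝ (fun y => couplingE A P φ 1 r y - couplingE A P φ (-1) r y) y (0, 1)) +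
      ⁅leftForm (P r).c (φ r y) (dt (φ r) y),
        (ofModel (couplingE A P φ 1 r y + couplingE A P φ (-1) r y) : RealAlg E G)⁆ +
      ⁅(ofModel (couplingE A P φ 1 r y - couplingE A P φ (-1) r y) : RealAlg E G),
        leftForm (P r).c (φ r y) (dx (φ r) y)⁆ +
      A.k r • ⁅leftForm (P r).c (φ r y) (dt (φ r) y), leftForm (P r).c (φ r y) (dx (φ r) y)⁆ := by
  have h1 := (hasFDerivAt_couplingE (A := A) hφ hm 1 r y).differentiableAt
  have h2 := (hasFDerivAt_couplingE (A := A) hφ hm (-1) r y).differentiableAt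
  rw [fderiv_fun_add h1 h2, fderiv_fun_sub h1 h2, eom, couplingSum_crossDeriv hφ hm,
    couplingSum_crossDeriv hφ hm, couplingSum_currents, couplingSum_currents]
  have e1 : ((1, -(((1 : ℤˣ) : ℤ) : ℝ)) : ℝ × ℝ) = (1, 0) - (0, 1) := by simp
  have e2 : ((1, -((((-1 : ℤˣ)) : ℤ) : ℝ)) : ℝ × ℝ) = (1, 0) + (0, 1) := by simp
  rw [e1, e2]
  have e3 : currents P φ y 1 r = leftForm (P r).c (φ r y) (dt (φ r) y) +
      leftForm (P r).c (φ r y) (dx (φ r) y) := by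
    simp [currents, fieldCurrent, lightCurrent]
  have e4 : currents P φ y (-1) r = leftForm (P r).c (φ r y) (dt (φ r) y) -
      leftForm (P r).c (φ r y) (dx (φ r) y) := by
    simp [currents, fieldCurrent, lightCurrent, sub_eq_add_neg]
  rw [e3, e4]
  simp only [map_add, map_sub, add_apply, sub_apply, lie_add, add_lie, lie_sub, sub_lie, lie_self]
  generalize leftForm (P r).c (φ r y) (dt (φ r) y) = a
  generalize leftForm (P r).c (φ r y) (dx (φ r) y) = b
  rw [← lie_skew a b, ← lie_skew b (ofModel (couplingE A P φ 1 r y)),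
    ← lie_skew b (ofModel (couplingE A P φ (-1) r y))]
  module

variable [LieAlgebra.IsSimple ℂ (CplxAlg E G)] (hA : A.Admissible)
  {π : Fin N → ℝ × ℝ → (E →L[ℝ] ℝ)} (hπ : IsLegendre A P φ π)

section Legendre

include hA hπ
omit hφ

theorem IsLegendre.eq_legendreMom (y : ℝ × ℝ) : (fun r => π r y) =
    legendreMom P (fun r => φ r y) (fun r => dx (φ r) y) A (fun r => dt (φ r) y) :=
  velocityEq_unique hA _ (fun r => hm r y) (velocityEq_legendreMom hA _ (fun r => hm r y) _) (hπ y)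

theorem fieldLax_eq (σ : ℤˣ) {w : ℂ} (hw : A.Regular w) (y : ℝ × ℝ) :
    fieldLax A P φ π σ w y = ∑ r, A.laxCoeff σ r w • toCplx (currents P φ y σ r) := by
  rw [fieldLax, hπ.eq_legendreMom hm hA]
  exact laxPM_legendreMom hA P _ (fun r => hm r y) _ σ hw

end Legendre

include hA hπ

theorem hasFDerivAt_fieldLax (σ : ℤˣ) {w : ℂ} (hw : A.Regular w)
    (f : Module.Dual ℂ (CplxAlg E G)) (y : ℝ × ℝ) : ∃ f' : ℝ × ℝ →L[ℝ] ℂ,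
    HasFDerivAt (fun y' => f (fieldLax A P φ π σ w y')) f' y ∧ ∀ d, f' d =
      ∑ r, A.laxCoeff σ r w * f (toCplx (ofModel (fderiv ℝ (currentE P φ σ r) y d))) := by
  set g : E →L[ℝ] ℂ := LinearMap.toContinuousLinearMap
    ((f.restrictScalars ℝ) ∘ₗ (toCplx : RealAlg E G →ₗ[ℝ] CplxAlg E G) ∘ₗ ofModel) with hg
  have h : (fun y' => f (fieldLax A P φ π σ w y')) =
      fun y' => ∑ r, A.laxCoeff σ r w * g (currentE P φ σ r y') := by
    funext y'
    rw [fieldLax_eq hm hA hπ σ hw, map_sum]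
    simp only [map_smul, currents_eq, smul_eq_mul]
    rfl
  rw [h]
  refine ⟨_, HasFDerivAt.fun_sum fun r _ => (g.hasFDerivAt.comp y
    (differentiableAt_currentE hφ hm σ r y).hasFDerivAt).const_mul (A.laxCoeff σ r w), fun d => ?_⟩
  simp only [sum_apply, smul_apply, smul_eq_mul]
  rfl

theorem zeroCurvature_iff : ZeroCurvature A P φ π ↔
    ∀ y r, eom A (currents P φ y) (crossDeriv P φ y) r = 0 := by
  have key : ∀ w, A.Regular w → ∀ (f : Module.Dual ℂ (CplxAlg E G)) (y : ℝ × ℝ),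
      (dt (fun y' => f (fieldLax A P φ π (-1) w y')) y
        + dx (fun y' => f (fieldLax A P φ π (-1) w y')) y)
      - (dt (fun y' => f (fieldLax A P φ π 1 w y')) y
        - dx (fun y' => f (fieldLax A P φ π 1 w y')) y)
      + f ⁅fieldLax A P φ π 1 w y, fieldLax A P φ π (-1) w y⁆ =
      f (curvature A (currents P φ y) (crossDeriv P φ y) w) := by
    intro w hw f y
    obtain ⟨f₁, h₁, e₁⟩ := hasFDerivAt_fieldLax hφ hm hA hπ 1 hw f y
    obtain ⟨f₂, h₂, e₂⟩ := hasFDerivAt_fieldLax hφ hm hA hπ (-1) hw f y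
    rw [dt, dx, dt, dx, h₁.fderiv, h₂.fderiv, ← map_add, ← map_sub, e₁, e₂,
      fieldLax_eq hm hA hπ 1 hw, fieldLax_eq hm hA hπ (-1) hw, curvature, map_add, map_sub, map_sum,
      map_sum]
    simp only [map_smul, smul_eq_mul, crossDeriv]
    simp
  have h2 := fun y => eom_eq_zero_iff hA (currents P φ y) (crossDeriv P φ y)
    (crossDeriv_flat hφ hm y)
  simp only [h2]
  constructor
  · intro h y w hw f
    rw [← key w hw]
    exact h w hw f y
  · intro h w hw f y
    rw [key w hw]
    exact h y w hw f

/-- The momenta have a time derivative whether or not the equations of motion hold. `key` states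
that it exceeds the right-hand side of Hamilton's equation by `∑_r κ(eom_r, g⁻¹ ∂_u g)`, so the
equation holds exactly when these pairings sum to zero for every `u`. -/
theorem momentumEq_iff : MomentumEq A P φ π ↔
    ∀ y r, eom A (currents P φ y) (crossDeriv P φ y) r = 0 := by
  set z : Fin N → ℝ × ℝ → E := fun r y => couplingE A P φ 1 r y + couplingE A P φ (-1) r y with hz
  set k : Fin N → ℝ × ℝ → E := fun r y => couplingE A P φ 1 r y - couplingE A P φ (-1) r y with hk
  have hzd : ∀ r y, DifferentiableAt ℝ (z r) y := fun r y =>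
    ((hasFDerivAt_couplingE hφ hm 1 r y).add (hasFDerivAt_couplingE hφ hm (-1) r y)).differentiableAt
  have hkd : ∀ r y, DifferentiableAt ℝ (k r) y := fun r y =>
    ((hasFDerivAt_couplingE hφ hm 1 r y).sub (hasFDerivAt_couplingE hφ hm (-1) r y)).differentiableAt
  have hzz : ∀ r y, couplingSum A (currents P φ y) 1 r + couplingSum A (currents P φ y) (-1) r =
      ofModel (z r y) := fun r y => by
    simp only [couplingSum_currents, hz, map_add]
  have hkk : ∀ r y, couplingSum A (currents P φ y) 1 r - couplingSum A (currents P φ y) (-1) r =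
      ofModel (k r y) := fun r y => by
    simp only [couplingSum_currents, hk, map_sub]
  have key : ∀ (t x : ℝ) (u : Fin N → E), HasDerivAt
      (fun τ : ℝ => ((∑ r, π r (τ, x) (u r) : ℝ) : ℂ))
      ((deriv (fun ξ : ℝ =>
          lineDeriv ℝ (fun q' => ham A P (fun r => φ r (t, ξ)) q' (fun r => π r (t, ξ)))
            (fun r => dx (φ r) (t, ξ)) u) x
        - lineDeriv ℝ (fun q => ham A P q (fun r => dx (φ r) (t, x)) (fun r => π r (t, x)))
            (fun r => φ r (t, x)) u) +
        ((∑ r, kappa E G (eom A (currents P φ (t, x)) (crossDeriv P φ (t, x)) r)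
          (leftForm (P r).c (φ r (t, x)) (u r)) : ℝ) : ℂ)) t := by
    intro t x u
    have hp : (fun τ : ℝ => ((∑ r, π r (τ, x) (u r) : ℝ) : ℂ)) = fun τ : ℝ =>
        ((∑ r, (kappaE E G (z r (τ, x)) (leftFormE (P r).c (φ r (τ, x)) (u r)) +
          A.k r * (P r).form (φ r (τ, x)) (dx (φ r) (τ, x)) (u r)) : ℝ) : ℂ) := by
      funext τ
      congr 1
      refine Finset.sum_congr rfl fun r _ => ?_
      rw [show π r (τ, x) = _ from congrFun (hπ.eq_legendreMom hm hA (τ, x)) r, legendreMom_apply,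
        (P r).lam_apply, kappaE_apply, ← hzz]
      rfl
    have hv : (fun ξ : ℝ =>
        lineDeriv ℝ (fun q' => ham A P (fun r => φ r (t, ξ)) q' (fun r => π r (t, ξ)))
          (fun r => dx (φ r) (t, ξ)) u) = fun ξ : ℝ =>
        ((∑ r, (kappaE E G (k r (t, ξ)) (leftFormE (P r).c (φ r (t, ξ)) (u r)) -
          A.k r * (P r).form (φ r (t, ξ)) (u r) (dt (φ r) (t, ξ))) : ℝ) : ℂ) := by
      funext ξ
      rw [hπ.eq_legendreMom hm hA, lineDeriv_ham_velocity hA _ fun r => hm r (t, ξ)]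
      congr 1
      refine Finset.sum_congr rfl fun r _ => ?_
      rw [kappaE_apply, ← hkk]
      rfl
    choose f₁ h₁ e₁ using fun r => hasFDerivAt_siteMomentum (hφ r).contDiffAt (hm r (t, x))
      (hzd r (t, x)) (A.k r) (u r)
    choose f₂ h₂ e₂ using fun r => hasFDerivAt_siteFlux (hφ r).contDiffAt (hm r (t, x))
      (hkd r (t, x)) (A.k r) (u r)
    have d₁ := (HasFDerivAt.hasDerivAt_fst
      (HasFDerivAt.fun_sum fun r (_ : r ∈ Finset.univ) => h₁ r)).ofReal_comp
    have d₂ := (HasFDerivAt.hasDerivAt_snd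
      (HasFDerivAt.fun_sum fun r (_ : r ∈ Finset.univ) => h₂ r)).ofReal_comp
    rw [hp, hv, d₂.deriv, hπ.eq_legendreMom hm hA, lineDeriv_ham_position hA _ fun r => hm r (t, x)]
    refine d₁.congr_deriv ?_
    norm_cast
    rw [sum_apply, sum_apply, ← Finset.sum_sub_distrib, ← Finset.sum_add_distrib]
    refine Finset.sum_congr rfl fun r _ => ?_
    rw [eom_currents hφ hm, ← site_identity (hφ r).contDiffAt (hm r (t, x)), e₁, e₂,
      kappaE_apply (k r (t, x)) (fderiv ℝ (leftFormE (P r).c) (φ r (t, x)) (u r) _), ← hkk,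
      kappaE_apply (z r (t, x)) (fderiv ℝ (leftFormE (P r).c) (φ r (t, x)) (u r) _), ← hzz]
    simp only [dt, dx]
    change _ = _ - (kappa E G (couplingSum A (currents P φ (t, x)) 1 r -
      couplingSum A (currents P φ (t, x)) (-1) r) _ - _ - kappa E G (couplingSum A
      (currents P φ (t, x)) 1 r + couplingSum A (currents P φ (t, x)) (-1) r) _) + _
    ring
  constructor
  · rintro h ⟨t, x⟩ r
    refine eq_of_forall_kappa fun e => ?_
    -- The left-invariant form is onto, so variations of a single site reach all of `𝔤₀` and
    -- nondegeneracy of `κ` applies.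
    obtain ⟨w, rfl⟩ := (P r).surjective_leftForm (hm r (t, x)) e
    have h1 := (h t x (Pi.single r w)).unique (key t x (Pi.single r w))
    rw [left_eq_add, Complex.ofReal_eq_zero, Finset.sum_eq_single r
      (fun s _ hs => by rw [Pi.single_eq_of_ne hs, map_zero, map_zero])
      (fun h => (h (Finset.mem_univ r)).elim), Pi.single_eq_same] at h1
    rw [h1, map_zero, LinearMap.zero_apply]
  · intro h t x u
    have h1 := key t x u
    simpa only [h (t, x), map_zero, LinearMap.zero_apply, Finset.sum_const_zero,
      Complex.ofReal_zero, add_zero] using h1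

end Fields

end CoupledPCM

/-! ### The action -/

namespace CoupledPCM

section Action

variable {E G : Type*} [NormedAddCommGroup E] [NormedSpace ℝ E] [FiniteDimensional ℝ E]
  [TopologicalSpace G] [ChartedSpace E G] [Group G] [LieGroup 𝓘(ℝ, E) ∞ G]
  [LieAlgebra.IsSimple ℂ (CplxAlg E G)]
  {N : ℕ} {A : Params N} (hA : A.Admissible) {P : Fin N → Patch E G} {φ : Fin N → ℝ × ℝ → E}
  {π : Fin N → ℝ × ℝ → (E →L[ℝ] ℝ)} (hm : ∀ r y, φ r y ∈ (P r).c.target)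
  (hπ : IsLegendre A P φ π) {D : Space}

omit [LieAlgebra.IsSimple ℂ (CplxAlg E G)] in
theorem FiniteAction.integrableOn_kappa_couplingSum
    (h : FiniteAction P φ D) (σ : ℤˣ) (r : Fin N) :
    IntegrableOn (fun y => kappa E G (couplingSum A (currents P φ y) σ r) (currents P φ y σ r))
      D.world := by
  simp only [couplingSum, map_sum, LinearMap.sum_apply, map_smul, LinearMap.smul_apply,
    smul_eq_mul]
  exact integrable_finsetSum _ fun s _ => (h.1 σ σ s r).const_mul _

include hA hm hπ

/-- The energy density couples currents of equal chirality, which the Lagrangian does not contain;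
their integrability is used here. -/
theorem FiniteAction.integrableOn_fieldHam (h : FiniteAction P φ D) :
    IntegrableOn (fieldHam A P φ π) D.world := by
  have e : fieldHam A P φ π = fun y => (((1 / 2 : ℝ) * ∑ r,
      (kappa E G (couplingSum A (currents P φ y) 1 r) (currents P φ y 1 r) +
        kappa E G (couplingSum A (currents P φ y) (-1) r) (currents P φ y (-1) r)) : ℝ) : ℂ) := by
    funext y
    rw [fieldHam, hπ.eq_legendreMom hm hA]
    exact ham_legendreMom hA _ (fun r => hm r y) _
  rw [e]
  refine Integrable.ofReal (Integrable.const_mul (integrable_finsetSum _ fun r _ => ?_) _)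
  exact (h.integrableOn_kappa_couplingSum 1 r).add (h.integrableOn_kappa_couplingSum (-1) r)

theorem action_eq (h : FiniteAction P φ D) :
    action A P φ π D =
      (∫ y in D.world, ∑ r, ∑ s, A.rho r s *
        (kappa E G (fieldCurrent P φ 1 r y) (fieldCurrent P φ (-1) s y) : ℂ))
      + ∑ r, A.kOfZeros r *
        ((∫ y in D.world, (P r).lam (φ r y) ![dx (φ r) y, dt (φ r) y] : ℝ) : ℂ) := by
  have iH := h.integrableOn_fieldHam hA hm hπ
  have i1 : IntegrableOn (fun y => ∑ r, ∑ s, A.rho r s *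
      (kappa E G (fieldCurrent P φ 1 r y) (fieldCurrent P φ (-1) s y) : ℂ)) D.world :=
    integrable_finsetSum _ fun r _ => integrable_finsetSum _ fun s _ =>
      (h.1 1 (-1) r s).ofReal.const_mul _
  have i2 : ∀ r, IntegrableOn (fun y => A.kOfZeros r *
      ((P r).lam (φ r y) ![dx (φ r) y, dt (φ r) y] : ℂ)) D.world := fun r =>
    (h.2 r).ofReal.const_mul _
  have i3 : IntegrableOn (fun y => ∑ r, A.kOfZeros r *
      ((P r).lam (φ r y) ![dx (φ r) y, dt (φ r) y] : ℂ)) D.world :=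
    integrable_finsetSum _ fun r _ => i2 r
  -- Writing the pairing of momenta and velocities as Lagrangian plus Hamiltonian splits its
  -- integral into integrable pieces, and the Hamiltonian part cancels against the iterated integral
  -- by Fubini.
  have hl : ∀ y, ((∑ r, π r y (dt (φ r) y) : ℝ) : ℂ) =
      (∑ r, ∑ s, A.rho r s *
        (kappa E G (fieldCurrent P φ 1 r y) (fieldCurrent P φ (-1) s y) : ℂ) +
      ∑ r, A.kOfZeros r * ((P r).lam (φ r y) ![dx (φ r) y, dt (φ r) y] : ℂ)) +
      fieldHam A P φ π y := by
    intro y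
    have h1 := lagrangian_eq hA (fun r => dx (φ r) y) (fun r => hm r y) (fun r => dt (φ r) y)
    rw [← hπ.eq_legendreMom hm hA y, sub_eq_iff_eq_add] at h1
    exact h1
  have hH : ∫ t : ℝ, ∫ x in D.dom, fieldHam A P φ π (t, x) =
      ∫ y in D.world, fieldHam A P φ π y := by
    rw [IntegrableOn, D.restrict_world] at iH
    rw [D.restrict_world, integral_prod _ iH]
  rw [action, hH, ← integral_complex_ofReal]
  simp only [hl]
  have i4 : IntegrableOn (fun y => ∑ r, ∑ s, A.rho r s *
      (kappa E G (fieldCurrent P φ 1 r y) (fieldCurrent P φ (-1) s y) : ℂ) +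
      ∑ r, A.kOfZeros r * ((P r).lam (φ r y) ![dx (φ r) y, dt (φ r) y] : ℂ)) D.world := i1.add i3
  rw [integral_add i4 iH, integral_add i1 i3, add_sub_cancel_right, integral_finsetSum _
    fun r _ => i2 r]
  congr 1
  refine Finset.sum_congr rfl fun r _ => ?_
  rw [integral_const_mul, integral_complex_ofReal]

end Action

end CoupledPCM

/-! ### Assembly of the claims -/

open CoupledPCM in
theorem mainTheorem4 {E G : Type*} [NormedAddCommGroup E] [NormedSpace ℝ E]
    [FiniteDimensional ℝ E] [TopologicalSpace G] [ChartedSpace E G] [Group G]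
    [LieGroup 𝓘(ℝ, E) ∞ G] [LieAlgebra.IsSimple ℂ (CplxAlg E G)]
    {N : ℕ} (A : Params N) (hA : A.Admissible) (P : Fin N → Patch E G) :
    -- levels in terms of positions and zeros; the couplings are real
    (∀ r, (A.ell r : ℂ) = A.ellOfZeros r ∧ (A.k r : ℂ) = A.kOfZeros r) ∧
    (∀ r s, (A.rho r s).im = 0) ∧
    -- inverse Legendre transform of the Hamiltonian density
    (∀ q : Fin N → E, (∀ r, q r ∈ (P r).c.target) → ∀ q' v : Fin N → E,
      ∃ p : Fin N → (E →L[ℝ] ℝ),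
        VelocityEq A P q q' p v ∧ (∀ p', VelocityEq A P q q' p' v → p' = p) ∧
        ((∑ r, p r (v r) : ℝ) : ℂ) - ham A P q q' p =
          ∑ r, ∑ s, A.rho r s *
            (kappa E G (lightCurrent P q q' v 1 r) (lightCurrent P q q' v (-1) s) : ℂ)
          + ∑ r, A.kOfZeros r * ((P r).lam (q r) ![q' r, v r] : ℂ)) ∧
    ∀ (D : Space) (φ : Fin N → ℝ × ℝ → E) (π : Fin N → ℝ × ℝ → (E →L[ℝ] ℝ)),
      (∀ r, IsField D (P r) (φ r)) → IsLegendre A P φ π →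
      -- the action
      (FiniteAction P φ D → ∀ Φ : Fin N → ℝ × ℝ × ℝ → E,
        (∀ r, IsExtension D (P r) (φ r) (Φ r)) →
        action A P φ π D =
          (∫ y in D.world, ∑ r, ∑ s, A.rho r s *
            (kappa E G (fieldCurrent P φ 1 r y) (fieldCurrent P φ (-1) s y) : ℂ))
          + ∑ r, A.kOfZeros r * (wzTerm D (P r) (Φ r) : ℂ)) ∧
      -- the Lax pair
      (∀ (s : ℤˣ) (w : ℂ), A.Regular w → ∀ y,
        fieldLax A P φ π s w y =
          ∑ r, (A.phi s r (A.z r) / A.phi s r w) ⊗ₜ[ℝ] fieldCurrent P φ s r y) ∧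
      (MomentumEq A P φ π ↔ ZeroCurvature A P φ π) := by
  refine ⟨hA.levels_eq, hA.rho_im, fun q hq q' v => ?_, fun D φ π hφ hπ => ?_⟩
  · exact ⟨legendreMom P q q' A v, velocityEq_legendreMom hA q' hq v,
      fun p' hp' => velocityEq_unique hA q' hq (velocityEq_legendreMom hA q' hq v) hp',
      lagrangian_eq hA q' hq v⟩
  have hm : ∀ r y, φ r y ∈ (P r).c.target := fun r => (hφ r).mem
  refine ⟨fun hfin Φ hΦ => ?_, fun s w hw y => ?_, ?_⟩
  · simp only [action_eq hA hm hπ hfin, wzTerm_eq (hΦ _) (hfin.2 _)]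
  · rw [fieldLax_eq hm hA hπ s hw]
    simp only [tmul_eq_smul, A.laxCoeff_eq_div]
    rfl
  -- Both conditions are equivalent to the vanishing of `eom` at every point and every site.
  · rw [momentumEq_iff (fun r => (hφ r).smooth) hm hA hπ,
      zeroCurvature_iff (fun r => (hφ r).smooth) hm hA hπ]
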